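/- For $\tau\in\mathbb C$ with $\operatorname{Im}\tau>0$ let $[1,\tau]=\{m+n\tau: m,n\in\mathbb Z\}$, let $g_2(\tau)=60\sum_{\omega\ne 0}\omega^{-4}$ and $g_3(\tau)=140\sum_{\omega\neq 0}\omega^{-6}$ (sums over $\omega\in[1,\tau]\setminus\{0\}$), let $\zeta(z)=\frac1z+\sum_{\omega\ne0}\left(\frac1{z-\omega}+\frac1\omega+\frac z{\omega^2}\right)$ be the Weierstrass zeta function of $[1,\tau]$, and let $\eta_1(\tau)=\zeta(z+1)-\zeta(z)$ and $\eta_2(\tau)=\zeta(z+\tau)-\zeta(z)$ be its quasi-periods. For $\alpha\in(0,\pi)$ put $$p_1(\alpha)=2g_2(e^{i\alpha})\,\eta_1(e^{i\alpha})-3g_3(e^{i\alpha}),\qquad p_2(\alpha)=2g_2(e^{i\alpha})\,\eta_2(e^{i\alpha})-3g_3(e^{i\alpha})\,e^{i\alpha},$$ $$P(\alpha)=\operatorname{Im}\left(\overline{p_1(\alpha)}\,p_2(\alpha)\right).$$ Let $\Sigma$ be a Riemann surface and let $F,G:\Sigma\to\mathbb C$ be holomorphic with $(dF,dG)\ne(0,0)$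 everywhere and $\operatorname{Re}\int_\gamma F\,dG=0$ for every closed curve $\gamma$ in $\Sigma$. The improper affine front with Weierstrass data $(F,G)$ is the map $$\psi=\left(G+\overline F,\ \tfrac12\left(|G|^2-|F|^2\right)+\operatorname{Re}\left(GF-2\int F\,dG\right)\right):\Sigma\to\mathbb C\times\mathbb R=\mathbb R^3.$$ It is complete if there is a symmetric bilinear form $T$ on $\Sigma$ with compact support such that $T+ds^2$ is a complete (smooth) Riemannian metric on $\Sigma$, where $ds^2=|dF|^2+|dG|^2+dF\,dG+\overline{dF\,dG}$. Its total curvature is $\int_\Sigma K_\tau\,dA_\tau$, where $K_\tau$ and $dA_\tau$ are the Gaussian curvature and the area element of the metric $d\tau^2=2(|dF|^2+|dG|^2)$. **Theorem.** There exists $\alpha_0\in(\pi/3,\pi/2)$ such that $P(\alpha_0)=0$ and such that there exists a complete improper affine front $\psi:\left(\mathbb C/[1,e^{i\alpha_0}]\right)\setminus\{[0]\}\to\mathbb R^3$ whose total curvature is $-8\pi$. It has genus $1$, that is, the compact Riemann surface $\mathbb C/[1,e^{i\alpha_0}]$ has genus $1$. -/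

import Mathlib

open scoped Manifold ContDiff Topology UpperHalfPlane

namespace ImproperAffine

noncomputable section

/-! ### Elliptic functions of the lattice `[1, τ]` -/

/-- The pair of periods `1, τ`; it spans the lattice `[1, τ] = {m + n τ : m, n ∈ ℤ}`. -/
def periods (τ : ℍ) : PeriodPair where
  ω₁ := 1
  ω₂ := τ
  indep := by
    rw [LinearIndependent.pair_iff]
    intro s t h
    have him := congrArg Complex.im h
    have hre := congrArg Complex.re h
    simp at him hre
    have ht : t = 0 := him.resolve_right τ.coe_im_pos.ne'
    exact ⟨by simpa [ht] using hre, ht⟩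

/-- The Weierstrass zeta function
`ζ(z) = 1/z + ∑_{l ≠ 0} (1/(z - l) + 1/l + z/l²)` of a lattice.  As for Mathlib's `℘`, the term
`1/z` is the summand with `l = 0`, since `1/0 = 0`. -/
def weierstrassZeta (L : PeriodPair) (z : ℂ) : ℂ :=
  ∑' l : L.lattice, (1 / (z - (l : ℂ)) + 1 / (l : ℂ) + z / (l : ℂ) ^ 2)

/-- The increment `ζ(z + l) - ζ(z)` of the zeta function along the period `l`.  It does not depend
on `z`; it is taken here at `z = -l/2`, which is not a pole when `l` is one of the two basic
periods of `L`. -/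
def quasiPeriod (L : PeriodPair) (l : ℂ) : ℂ :=
  weierstrassZeta L (-(l / 2) + l) - weierstrassZeta L (-(l / 2))

/-- The quasi-period `η₁ = ζ(z + 1) - ζ(z)` of `[1, τ]`. -/
def eta₁ (τ : ℍ) : ℂ := quasiPeriod (periods τ) 1

/-- The quasi-period `η₂ = ζ(z + τ) - ζ(z)` of `[1, τ]`. -/
def eta₂ (τ : ℍ) : ℂ := quasiPeriod (periods τ) τ

/-- `e^{iα}` as a point of the upper half plane, for `0 < α < π`. -/
def expI (α : Set.Ioo (0 : ℝ) Real.pi) : ℍ :=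
  ⟨Complex.exp (Complex.I * ((α : ℝ) : ℂ)), by
    rw [mul_comm, Complex.exp_ofReal_mul_I_im]
    exact Real.sin_pos_of_pos_of_lt_pi α.2.1 α.2.2⟩

/-- `p₁(α) = 2 g₂ η₁ - 3 g₃` for the lattice `[1, e^{iα}]`. -/
def p₁ (α : Set.Ioo (0 : ℝ) Real.pi) : ℂ :=
  2 * (periods (expI α)).g₂ * eta₁ (expI α) - 3 * (periods (expI α)).g₃

/-- `p₂(α) = 2 g₂ η₂ - 3 g₃ e^{iα}` for the lattice `[1, e^{iα}]`. -/
def p₂ (α : Set.Ioo (0 : ℝ) Real.pi) : ℂ :=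
  2 * (periods (expI α)).g₂ * eta₂ (expI α) - 3 * (periods (expI α)).g₃ * (expI α : ℂ)

/-- `P(α) = Im (conj (p₁(α)) p₂(α))`. -/
def P (α : Set.Ioo (0 : ℝ) Real.pi) : ℝ := (starRingEnd ℂ (p₁ α) * p₂ α).im

/-! ### The Riemann surface `ℂ / Λ` -/

/-- The quotient `ℂ / Λ` of `ℂ` by the lattice `Λ` spanned by a pair of periods. -/
abbrev ComplexTorus (L : PeriodPair) : Type := ℂ ⧸ L.lattice.toAddSubgroup

/-- The projection `ℂ → ℂ / Λ`. -/
abbrev torusMk (L : PeriodPair) : ℂ → ComplexTorus L :=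
  QuotientAddGroup.mk (s := L.lattice.toAddSubgroup)

theorem isClosed_lattice_toAddSubgroup (L : PeriodPair) :
    IsClosed (L.lattice.toAddSubgroup : Set ℂ) := L.isClosed_lattice

instance (L : PeriodPair) : IsClosed (L.lattice.toAddSubgroup : Set ℂ) :=
  isClosed_lattice_toAddSubgroup L

theorem isAddQuotientCoveringMap_torusMk (L : PeriodPair) :
    IsAddQuotientCoveringMap (torusMk L) L.lattice.toAddSubgroup :=
  AddSubgroup.isAddQuotientCoveringMap_of_comm _
    ⟨inferInstanceAs (DiscreteTopology L.lattice)⟩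

theorem isLocalHomeomorph_torusMk (L : PeriodPair) : IsLocalHomeomorph (torusMk L) :=
  (isAddQuotientCoveringMap_torusMk L).isCoveringMap.isLocalHomeomorph

/-- The charts of `ℂ / Λ` are local inverses of the projection `ℂ → ℂ / Λ`. -/
instance (L : PeriodPair) : ChartedSpace ℂ (ComplexTorus L) :=
  (isLocalHomeomorph_torusMk L).chartedSpace QuotientAddGroup.mk_surjective

/-- The changes of charts of `ℂ / Λ` are locally translations, so `ℂ / Λ` is a complex manifold
of dimension one. -/
instance (L : PeriodPair) : IsManifold 𝓘(ℂ) ω (ComplexTorus L) := by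
  apply isManifold_of_contDiffOn
  have key : ∀ e ∈ atlas ℂ (ComplexTorus L), ∀ z ∈ e.target, e.symm z = torusMk L z := by
    rintro e ⟨q, rfl⟩ z -
    simp [chartAt_self_eq]
  intro e e' he he'
  simp only [modelWithCornersSelf_coe, modelWithCornersSelf_coe_symm, Set.range_id,
    Set.preimage_id_eq, id_eq, Set.inter_univ, Function.comp_id, Function.id_comp]
  set f := e.symm ≫ₕ e' with hf
  intro z hz
  have hmem : ∀ w ∈ f.source, f w - w ∈ L.lattice := by
    intro w hw
    rw [hf, OpenPartialHomeomorph.trans_source] at hw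
    have h1 := key e he w hw.1
    have h2 := key e' he' _ (e'.map_source hw.2)
    rw [e'.left_inv hw.2, h1] at h2
    have h3 := QuotientAddGroup.eq.mp h2
    have h4 : f w - w = -w + e' (torusMk L w) := by
      rw [← h1]; simp only [hf, OpenPartialHomeomorph.coe_trans, Function.comp_apply]; ring
    rw [h4]; exact h3
  -- a continuous map with values in the lattice is locally constant
  have hev : ∀ᶠ w in 𝓝 z, f w = w + (f z - z) := by
    have hc : ContinuousAt (fun w => f w - w) z :=
      (f.continuousAt hz).sub continuousAt_id
    have h1 := hc.preimage_mem_nhds (L.compl_lattice_sdiff_singleton_mem_nhds (f z - z))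
    filter_upwards [h1, f.open_source.mem_nhds hz] with w hw hws
    have : f w - w = f z - z := by
      by_contra hne
      exact hw ⟨hmem w hws, hne⟩
    rw [← this]; ring
  exact (ContDiffAt.congr_of_eventuallyEq (contDiffAt_id.add contDiffAt_const)
    hev).contDiffWithinAt

/-- The torus with the point `[0]` removed. -/
def puncturedTorus (L : PeriodPair) : TopologicalSpace.Opens (ComplexTorus L) :=
  ⟨{0}ᶜ, isOpen_compl_singleton⟩

/-- `X`, a closed orientable surface, has genus `g`: it is compact and connected, and the rank of
its first homology group (the abelianized fundamental group) is `2 g`. -/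
def HasGenus (X : Type*) [TopologicalSpace X] (g : ℕ) : Prop :=
  CompactSpace X ∧ ConnectedSpace X ∧
    ∀ x : X, Module.rank ℤ (Additive (Abelianization (FundamentalGroup X x))) = 2 * (g : Cardinal)

/-! ### Improper affine fronts on a Riemann surface -/

/-- A Riemann surface is in particular a smooth real surface. -/
instance {S : Type*} [TopologicalSpace S] [ChartedSpace ℂ S] [IsManifold 𝓘(ℂ) ω S] :
    IsManifold 𝓘(ℝ, ℂ) ∞ S := by
  apply isManifold_of_contDiffOn
  intro e e' he he'
  have h := (contDiffGroupoid ω 𝓘(ℂ)).compatible he he'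
  have h1 := (mem_groupoid_of_pregroupoid.mp h).1
  simp only [contDiffPregroupoid, modelWithCornersSelf_coe, modelWithCornersSelf_coe_symm,
    Set.range_id, Set.preimage_id_eq, id_eq, Set.inter_univ, Function.comp_id,
    Function.id_comp] at h1 ⊢
  exact (h1.restrict_scalars ℝ).of_le le_top

variable {S : Type*} [TopologicalSpace S] [ChartedSpace ℂ S]

/-- `γ`, restricted to `[0, 1]`, is a `C¹` curve.  (Piecewise `C¹` curves are covered, because
they can be reparametrized so as to have zero velocity at their corners.) -/
def IsC1Curve (γ : ℝ → S) : Prop := ContMDiffOn 𝓘(ℝ) 𝓘(ℝ, ℂ) 1 γ (Set.Icc 0 1)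

/-- The line integral `∫_γ F dG`. -/
def lineIntegral (F G : S → ℂ) (γ : ℝ → S) : ℂ :=
  ∫ t in (0 : ℝ)..1, F (γ t) * deriv (fun s => G (γ s)) t

/-- `ψ : S → ℂ × ℝ = ℝ³` is the improper affine front (improper affine map) with Weierstrass
data `(F, G)`. -/
structure IsImproperAffineFront (F G : S → ℂ) (ψ : S → ℂ × ℝ) : Prop where
  holo_F : MDifferentiable 𝓘(ℂ) 𝓘(ℂ) F
  holo_G : MDifferentiable 𝓘(ℂ) 𝓘(ℂ) G
  /-- `(F, G)` is a regular curve: `(dF, dG) ≠ (0, 0)` everywhere. -/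
  regular : ∀ p : S, ¬ (mfderiv 𝓘(ℂ) 𝓘(ℂ) F p = 0 ∧ mfderiv 𝓘(ℂ) 𝓘(ℂ) G p = 0)
  /-- The period condition `Re ∫_γ F dG = 0` for all closed curves. -/
  period : ∀ γ : ℝ → S, IsC1Curve γ → γ 0 = γ 1 → (lineIntegral F G γ).re = 0
  /-- `ψ = (G + F̄, (|G|² - |F|²)/2 + Re (G F - 2 ∫ F dG))`, where `J = Re ∫ F dG` is
  well defined up to an additive constant. -/
  formula : ∃ J : S → ℝ,
    (∀ γ : ℝ → S, IsC1Curve γ → J (γ 1) - J (γ 0) = (lineIntegral F G γ).re) ∧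
    ∀ p : S, ψ p = (G p + starRingEnd ℂ (F p),
      (1 / 2) * (‖G p‖ ^ 2 - ‖F p‖ ^ 2) + (G p * F p).re - 2 * J p)

/-- The real differential of `X = F̄ + G` at `p`, applied to a real tangent vector `v`. -/
def dX (F G : S → ℂ) (p : S) (v : TangentSpace 𝓘(ℝ, ℂ) p) : ℂ :=
  mfderiv 𝓘(ℝ, ℂ) 𝓘(ℝ, ℂ) (fun q => starRingEnd ℂ (F q) + G q) p v

/-- The flat fundamental form
`ds² = ⟨dX, dX⟩ = |dF|² + |dG|² + dF dG + conj (dF dG)`, as a (possibly degenerate) symmetric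
bilinear form on the real tangent space at `p`. -/
def flatForm (F G : S → ℂ) (p : S) (v w : TangentSpace 𝓘(ℝ, ℂ) p) : ℝ :=
  inner ℝ (dX F G p v) (dX F G p w)

/-- A smooth Riemannian metric on `S` is complete if the Riemannian distance (the infimum of
the lengths of curves) makes `S` a complete space. -/
def IsCompleteMetric [IsManifold 𝓘(ℂ) ω S] [RegularSpace S]
    (g : Bundle.ContMDiffRiemannianMetric 𝓘(ℝ, ℂ) ∞ ℂ
      (fun p : S => TangentSpace 𝓘(ℝ, ℂ) p)) : Prop :=
  letI : Bundle.RiemannianBundle (fun p : S => TangentSpace 𝓘(ℝ, ℂ) p) :=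
    ⟨g.toContinuousRiemannianMetric.toRiemannianMetric⟩
  letI : PseudoEMetricSpace S := PseudoEMetricSpace.ofRiemannianMetric 𝓘(ℝ, ℂ) S
  CompleteSpace S

/-- The improper affine front with Weierstrass data `(F, G)` is complete: there is a symmetric
bilinear form `T` with compact support such that `T + ds²` is a complete Riemannian metric. -/
def IsCompleteFront [IsManifold 𝓘(ℂ) ω S] [RegularSpace S] (F G : S → ℂ) : Prop :=
  ∃ T : ∀ p : S, TangentSpace 𝓘(ℝ, ℂ) p →L[ℝ] TangentSpace 𝓘(ℝ, ℂ) p →L[ℝ] ℝ,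
    (∀ p v w, T p v w = T p w v) ∧
    (∃ K : Set S, IsCompact K ∧ ∀ p ∉ K, T p = 0) ∧
    ∃ g : Bundle.ContMDiffRiemannianMetric 𝓘(ℝ, ℂ) ∞ ℂ
        (fun p : S => TangentSpace 𝓘(ℝ, ℂ) p),
      (∀ p v w, g.inner p v w = T p v w + flatForm F G p v w) ∧ IsCompleteMetric g

/-- The factor `λ` in `dτ² = 2 (|dF|² + |dG|²) = λ |dz|²`, in the coordinate `z` given by the
chart `e`. -/
def density (F G : S → ℂ) (e : OpenPartialHomeomorph S ℂ) (z : ℂ) : ℝ :=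
  2 * (‖deriv (F ∘ e.symm) z‖ ^ 2 + ‖deriv (G ∘ e.symm) z‖ ^ 2)

/-- The Gaussian curvature `K = -Δ (log λ) / (2 λ)` of the conformal metric `dτ² = λ |dz|²`. -/
def gaussCurvature (F G : S → ℂ) (p : S) : ℝ :=
  -(Laplacian.laplacian (fun z => Real.log (density F G (chartAt ℂ p) z))
      (chartAt ℂ p p)) / (2 * density F G (chartAt ℂ p) (chartAt ℂ p p))

/-- `μ` is the area measure of `dτ²`: on each chart it is `λ dx dy`. -/
def IsAreaMeasure [MeasurableSpace S] (F G : S → ℂ) (μ : MeasureTheory.Measure S) : Prop :=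
  ∀ e ∈ atlas ℂ S, ∀ E ⊆ e.source, MeasurableSet E →
    μ E = ∫⁻ z in e '' E, ENNReal.ofReal (density F G e z)

/-- The total curvature `∫ K dA` of the metric `dτ² = 2 (|dF|² + |dG|²)` exists and is `κ`. -/
def HasTotalCurvature (F G : S → ℂ) (κ : ℝ) : Prop :=
  letI : MeasurableSpace S := borel S
  ∃ μ : MeasureTheory.Measure S, IsAreaMeasure F G μ ∧
    MeasureTheory.Integrable (gaussCurvature F G) μ ∧ ∫ p, gaussCurvature F G p ∂μ = κ

end

end ImproperAffine

namespace ImproperAffine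

open scoped PeriodPair
open Filter

/-! ### The differential equations of `℘` -/

section Elliptic

variable (L : PeriodPair)

/-! On the once punctured torus take F = c ℘ and G = ℘' with a constant c ≠ 0. This data is regular
because ℘' and ℘'' have no common zero (`weierstrassP_regular`). The form F dG = c ℘ ℘'' dz has the
explicit primitive c·`periodIntegral`, built from ℘ ℘', ζ and z. Its increments along the basic
periods are -c p₁/5 and -c p₂/5, so the period condition reads Re(c p₁) = Re(c p₂) = 0. A nonzero c
solves this as soon as conj(p₁) p₂ is real, that is, P = 0.

A zero of P comes from the intermediate value theorem. The square lattice has g₃ = 0 and η₂ = -i η₁,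
so P < 0 at π/2; the hexagonal lattice has g₂ = 0, so P > 0 at π/3. Strictness uses that g₂ and g₃
do not both vanish, and that η₁ and η₂ do not both vanish. Continuity of P comes from uniform bounds
on the lattice sums.

Completeness: near the puncture |℘''| dominates |c ℘'|, so X = F̄ + G is an immersion there, and a
cutoff multiple of the Euclidean form repairs ds² on a compact set. The function X is proper,
because ℘' has a higher pole than ℘, and it does not increase lengths for the repaired metric; this
forces completeness (`isCompleteMetric_of_proper`).

Total curvature: with dτ² = λ|dz|² one has K dA = -½ Δ log λ dx dy. The function log λ is smooth and
doubly periodic except for the singularity -4 log|z|² at lattice points. Subtracting a compactly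
supported function with the same singularity leaves a periodic C² function, whose Laplacian has
integral zero; the subtracted function contributes 16π, so the total is -8π. The genus is read off
from the covering of the torus by ℂ, whose deck group is the lattice. -/

theorem lattice_countable : (L.lattice : Set ℂ).Countable :=
  countable_of_Lindelof_of_discrete (X := L.lattice)

theorem isOpen_compl_lattice : IsOpen ((L.lattice : Set ℂ)ᶜ) := L.isClosed_lattice.isOpen_compl

/-- A countable set does not disconnect the plane. Both the identity theorem and the constancy of
functions with zero derivative are applied on this set. -/
theorem isPreconnected_compl_lattice : IsPreconnected ((L.lattice : Set ℂ)ᶜ) :=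
  (Set.Countable.isConnected_compl_of_one_lt_rank (by simp) (lattice_countable L)).2

variable {L} in
theorem eventually_notMem_lattice {z : ℂ} (hz : z ∉ L.lattice) : ∀ᶠ w in 𝓝 z, w ∉ L.lattice :=
  (isOpen_compl_lattice L).mem_nhds hz

theorem add_notMem_lattice {z l : ℂ} (hz : z ∉ L.lattice) (hl : l ∈ L.lattice) :
    z + l ∉ L.lattice := fun h => hz (by simpa using sub_mem h hl)

theorem hasDerivAt_weierstrassP {z : ℂ} (hz : z ∉ L.lattice) :
    HasDerivAt ℘[L] (℘'[L] z) z := by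
  have := (L.differentiableOn_weierstrassP.differentiableAt
    ((isOpen_compl_lattice L).mem_nhds hz)).hasDerivAt
  rwa [L.deriv_weierstrassP] at this

theorem tendsto_weierstrassP_zero :
    Tendsto (fun z => z ^ 2 * ℘[L] z) (𝓝[≠] 0) (𝓝 1) := by
  have h : ContinuousAt (fun z => z ^ 2 * L.weierstrassPExcept 0 z + 1) 0 := by
    have := (L.analyticAt_weierstrassPExcept 0).continuousAt
    fun_prop
  have h' := h.tendsto.mono_left (nhdsWithin_le_nhds (s := {0}ᶜ))
  simp only [ne_eq, OfNat.ofNat_ne_zero, not_false_eq_true, zero_pow, zero_mul, zero_add] at h'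
  refine h'.congr' ?_
  filter_upwards [self_mem_nhdsWithin] with z hz
  have := L.ite_eq_one_sub_sq_mul_weierstrassP 0 (zero_mem _) z
  simp [show z ≠ 0 from hz] at this
  exact this.symm

theorem tendsto_derivWeierstrassP_zero :
    Tendsto (fun z => z ^ 3 * ℘'[L] z) (𝓝[≠] 0) (𝓝 (-2)) := by
  have h : ContinuousAt (fun z => z ^ 3 * L.derivWeierstrassPExcept 0 z - 2) 0 := by
    have := (L.analyticAt_derivWeierstrassPExcept 0).continuousAt
    fun_prop
  have h' := h.tendsto.mono_left (nhdsWithin_le_nhds (s := {0}ᶜ))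
  simp only [ne_eq, OfNat.ofNat_ne_zero, not_false_eq_true, zero_pow, zero_mul, zero_sub] at h'
  refine h'.congr' ?_
  filter_upwards [self_mem_nhdsWithin] with z hz
  have := L.derivWeierstrassPExcept_sub 0 z
  simp only [ZeroMemClass.coe_zero, sub_zero] at this
  rw [← this]
  field_simp [show z ≠ 0 from hz]

theorem tendsto_norm_weierstrassP_zero : Tendsto (fun z => ‖℘[L] z‖) (𝓝[≠] 0) atTop := by
  have h1 : Tendsto (fun z : ℂ => ‖z ^ 2 * ℘[L] z‖) (𝓝[≠] 0) (𝓝 1) := by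
    simpa using (tendsto_weierstrassP_zero L).norm
  have h2 : Tendsto (fun z : ℂ => ‖z‖⁻¹ ^ 2) (𝓝[≠] 0) atTop :=
    (tendsto_pow_atTop two_ne_zero).comp (tendsto_norm_nhdsNE_zero.inv_tendsto_nhdsGT_zero)
  refine (h1.pos_mul_atTop one_pos h2).congr' ?_
  filter_upwards [self_mem_nhdsWithin] with z hz
  have : ‖z‖ ≠ 0 := by simpa using hz
  simp only [norm_mul, norm_pow]
  field_simp

/-- Differentiate ℘'² = 4℘³ - g₂℘ - g₃. The factor ℘' cannot be cancelled pointwise, since it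
vanishes at half-periods. -/
theorem weierstrassP_second_deriv_mul {z : ℂ} (hz : z ∉ L.lattice) :
    ℘'[L] z * (deriv ℘'[L] z - (6 * ℘[L] z ^ 2 - L.g₂ / 2)) = 0 := by
  have h1 : HasDerivAt ℘'[L] (deriv ℘'[L] z) z :=
    (L.differentiableOn_derivWeierstrassP.differentiableAt
      ((isOpen_compl_lattice L).mem_nhds hz)).hasDerivAt
  have h2 := hasDerivAt_weierstrassP L hz
  have h3 := h1.pow 2
  have h4 := (((h2.pow 3).const_mul 4).sub (h2.const_mul L.g₂)).sub_const L.g₃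
  have h5 : (℘'[L] ^ 2) =ᶠ[𝓝 z] fun w => 4 * ℘[L] w ^ 3 - L.g₂ * ℘[L] w - L.g₃ := by
    filter_upwards [eventually_notMem_lattice hz] with w hw
    exact L.derivWeierstrassP_sq w hw
  have h6 := (h3.congr_of_eventuallyEq h5.symm).unique h4
  simp at h6
  linear_combination h6 / 2

/-- By the identity theorem ℘' would vanish off the whole lattice, against z³ ℘'(z) → -2 at the
origin. -/
theorem not_eventually_derivWeierstrassP_eq_zero {z : ℂ} (hz : z ∉ L.lattice) :
    ¬ ∀ᶠ w in 𝓝 z, ℘'[L] w = 0 := by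
  intro h
  have h0 := (L.analyticOnNhd_derivWeierstrassP).eqOn_zero_of_preconnected_of_eventuallyEq_zero
    (isPreconnected_compl_lattice L) hz h
  have h1 : Tendsto (fun z => z ^ 3 * ℘'[L] z) (𝓝[≠] 0) (𝓝 0) := by
    refine tendsto_const_nhds.congr' ?_
    filter_upwards [self_mem_nhdsWithin, mem_nhdsWithin_of_mem_nhds
      (L.compl_lattice_sdiff_singleton_mem_nhds 0)] with w hw hw'
    have : w ∈ (L.lattice : Set ℂ)ᶜ := fun h => hw' ⟨h, hw⟩
    simp [h0 this]
  have := tendsto_nhds_unique h1 (tendsto_derivWeierstrassP_zero L)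
  norm_num at this

/-- If the equation failed at z, it would fail near z by continuity, and the product identity would
make ℘' vanish on a neighbourhood. -/
theorem deriv_derivWeierstrassP {z : ℂ} (hz : z ∉ L.lattice) :
    deriv ℘'[L] z = 6 * ℘[L] z ^ 2 - L.g₂ / 2 := by
  have hd : ContinuousAt (fun w => deriv ℘'[L] w - (6 * ℘[L] w ^ 2 - L.g₂ / 2)) z := by
    have := (L.analyticOnNhd_derivWeierstrassP z hz).deriv.continuousAt
    have := (L.analyticOnNhd_weierstrassP z hz).continuousAt
    fun_prop
  by_contra hne
  refine not_eventually_derivWeierstrassP_eq_zero L hz ?_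
  filter_upwards [hd.eventually_ne (sub_ne_zero.mpr hne), eventually_notMem_lattice hz] with w h1 h2
  exact (mul_eq_zero.mp (weierstrassP_second_deriv_mul L h2)).resolve_right h1

theorem hasDerivAt_derivWeierstrassP {z : ℂ} (hz : z ∉ L.lattice) :
    HasDerivAt ℘'[L] (6 * ℘[L] z ^ 2 - L.g₂ / 2) z := by
  rw [← deriv_derivWeierstrassP L hz]
  exact (L.differentiableOn_derivWeierstrassP.differentiableAt
      ((isOpen_compl_lattice L).mem_nhds hz)).hasDerivAt

/-- `℘'` and `℘''` have no common zero. -/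
theorem weierstrassP_regular {z : ℂ} (hz : z ∉ L.lattice) (h1 : ℘'[L] z = 0) :
    6 * ℘[L] z ^ 2 - L.g₂ / 2 ≠ 0 := by
  intro h2
  set e := ℘[L] z with he
  have hy : AnalyticAt ℂ (fun w => ℘[L] w - e) z :=
    (L.analyticOnNhd_weierstrassP z hz).sub analyticAt_const
  have hd : deriv (fun w => ℘[L] w - e) =ᶠ[𝓝 z] ℘'[L] := by
    filter_upwards [eventually_notMem_lattice hz] with w hw
    exact ((hasDerivAt_weierstrassP L hw).sub_const e).deriv
  -- With y = ℘ - e the assumption 6e² = g₂/2 gives y'' = y · 6(℘ + e), so ord y ≤ ord y''. But y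
  -- and y' vanish at z, so ord y = ord y'' + 2. Hence the order is infinite and ℘' vanishes near z.
  have hdd : deriv (deriv (fun w => ℘[L] w - e)) =ᶠ[𝓝 z]
      fun w => (℘[L] w - e) * (6 * (℘[L] w + e)) := by
    have := hd.deriv
    filter_upwards [this, eventually_notMem_lattice hz] with w hw hw'
    rw [hw, deriv_derivWeierstrassP L hw']
    linear_combination h2
  set y : ℂ → ℂ := fun w => ℘[L] w - e with hydef
  have ho1 : analyticOrderAt y z = analyticOrderAt (deriv y) z + 1 := by
    rw [hy.analyticOrderAt_deriv_add_one]
    simp [hydef, he]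
  have ho2 : analyticOrderAt (deriv y) z = analyticOrderAt (deriv (deriv y)) z + 1 := by
    rw [hy.deriv.analyticOrderAt_deriv_add_one, hd.eq_of_nhds, h1]
    congr 1; ext w; simp
  have ho3 : analyticOrderAt y z ≤ analyticOrderAt (deriv (deriv y)) z := by
    rw [analyticOrderAt_congr hdd]
    have ha : AnalyticAt ℂ (fun w => 6 * (℘[L] w + e)) z := by
      have := L.analyticOnNhd_weierstrassP z hz
      fun_prop
    have := analyticOrderAt_mul hy ha
    rw [show (fun w => (℘[L] w - e) * (6 * (℘[L] w + e))) = y * fun w => 6 * (℘[L] w + e) from rfl,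
      this]
    exact le_self_add
  have htop : analyticOrderAt y z = ⊤ := by
    by_contra hne
    obtain ⟨n, hn⟩ := ENat.ne_top_iff_exists.mp hne
    rw [ho1, ho2] at ho3
    have : analyticOrderAt (deriv (deriv y)) z ≠ ⊤ := by
      intro h
      rw [ho1, ho2, h] at hne
      simp at hne
    obtain ⟨m, hm⟩ := ENat.ne_top_iff_exists.mp this
    rw [← hm] at ho3
    norm_cast at ho3
    omega
  have hd0 : analyticOrderAt (deriv y) z = ⊤ := by
    rw [ho1] at htop
    simpa using htop
  have h0 := analyticOrderAt_eq_top.mp hd0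
  exact not_eventually_derivWeierstrassP_eq_zero L hz (by
    filter_upwards [h0, hd] with w h3 h4
    rw [← h4, h3])

theorem derivWeierstrassP_half {l : ℂ} (hl : l ∈ L.lattice) :
    ℘'[L] (l / 2) = 0 := by
  have h1 := L.derivWeierstrassP_add_coe (-(l / 2)) ⟨l, hl⟩
  rw [L.derivWeierstrassP_neg] at h1
  have h2 : -(l / 2) + l = l / 2 := by ring
  simp only [h2] at h1
  exact CharZero.eq_neg_self_iff.mp h1

/-- Otherwise ℘'² = 4℘³, and at a half-period ℘, ℘' and ℘'' would all vanish. -/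
theorem g₂_g₃_not_both_zero : ¬ (L.g₂ = 0 ∧ L.g₃ = 0) := by
  rintro ⟨h2, h3⟩
  have hz := L.ω₁_div_two_notMem_lattice
  have h1 := derivWeierstrassP_half L L.ω₁_mem_lattice
  have := L.derivWeierstrassP_sq _ hz
  rw [h1, h2, h3] at this
  have h0 : ℘[L] (L.ω₁ / 2) = 0 := by simpa using this.symm
  exact weierstrassP_regular L hz h1 (by simp [h0, h2])

end Elliptic

end ImproperAffine

namespace ImproperAffine

open scoped PeriodPair
open Filter

/-! ### The zeta function -/

section Zeta

variable (L : PeriodPair)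

/-- The zeta function without its pole at the origin. -/
noncomputable def zetaExcept (z : ℂ) : ℂ :=
  ∑' l : L.lattice, if (l : ℂ) = 0 then 0 else (1 / (z - (l : ℂ)) + 1 / (l : ℂ) + z / (l : ℂ) ^ 2)

/-- In this form the summand is visibly O(|l|⁻³), which is what makes the series converge. -/
theorem zeta_summand_eq {z l : ℂ} (hl : l ≠ 0) (hz : z ≠ l) :
    1 / (z - l) + 1 / l + z / l ^ 2 = z ^ 2 / (l ^ 2 * (z - l)) := by
  have : z - l ≠ 0 := sub_ne_zero.mpr hz
  field_simp
  ring

theorem norm_zeta_summand_le (r : ℝ) (hr : 0 < r) (s : ℂ) (hs : ‖s‖ < r) (l : ℂ)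
    (h : 2 * r ≤ ‖l‖) :
    ‖1 / (s - l) + 1 / l + s / l ^ 2‖ ≤ 2 * r ^ 2 * ‖l‖ ^ (-3 : ℝ) := by
  have hl : 0 < ‖l‖ := by linarith
  have hsl : s ≠ l := by rintro rfl; linarith
  have h1 : ‖l‖ / 2 ≤ ‖s - l‖ := by
    rw [norm_sub_rev]
    exact .trans (by linarith) (norm_sub_norm_le l s)
  rw [zeta_summand_eq (norm_pos_iff.mp hl) hsl]
  have h3 : ‖l‖ ^ (-3 : ℝ) = (‖l‖ ^ 3)⁻¹ := by
    rw [Real.rpow_neg hl.le]; norm_cast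
  rw [h3, norm_div, norm_mul, norm_pow, norm_pow]
  calc ‖s‖ ^ 2 / (‖l‖ ^ 2 * ‖s - l‖) ≤ r ^ 2 / (‖l‖ ^ 2 * (‖l‖ / 2)) := by gcongr
    _ = 2 * r ^ 2 * (‖l‖ ^ 3)⁻¹ := by field_simp

theorem hasSumLocallyUniformly_zetaExcept :
    HasSumLocallyUniformly
      (fun (l : L.lattice) (z : ℂ) ↦
        if (l : ℂ) = 0 then 0 else (1 / (z - (l : ℂ)) + 1 / (l : ℂ) + z / (l : ℂ) ^ 2))
      (zetaExcept L) := by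
  refine L.hasSumLocallyUniformly_aux (u := fun r l => 2 * r ^ 2 * ‖l‖ ^ (-3 : ℝ)) _
    (fun _ _ ↦ (ZLattice.summable_norm_rpow _ _ (by simp; norm_num)).mul_left _) fun r hr ↦
    Filter.eventually_atTop.mpr ⟨2 * r, ?_⟩
  rintro _ h s hs l rfl
  split_ifs
  · simp only [norm_zero]; positivity
  · exact norm_zeta_summand_le r hr s hs l h

theorem weierstrassZeta_eq (z : ℂ) : weierstrassZeta L z = 1 / z + zetaExcept L z := by
  have h1 : 1 / z = ∑' l : L.lattice, if l = 0 then 1 / z else 0 := by simp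
  have h2 : Summable fun l : L.lattice => if (l : ℂ) = 0 then (0 : ℂ)
      else (1 / (z - (l : ℂ)) + 1 / (l : ℂ) + z / (l : ℂ) ^ 2) :=
    (hasSumLocallyUniformly_zetaExcept L).hasSum.summable
  rw [h1, zetaExcept, ← Summable.tsum_add
    (summable_of_hasFiniteSupport ((Set.finite_singleton (0 : L.lattice)).subset (by simp))) h2]
  refine tsum_congr fun l => ?_
  by_cases hl : l = 0
  · simp [hl]
  · simp [hl]

theorem differentiable_zeta_summand (l : L.lattice) :
    DifferentiableOn ℂ (fun z : ℂ => if (l : ℂ) = 0 then (0 : ℂ)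
      else (1 / (z - (l : ℂ)) + 1 / (l : ℂ) + z / (l : ℂ) ^ 2)) (L.lattice \ {(0 : ℂ)})ᶜ := by
  split_ifs with hl
  · simp
  · refine .add (.add (.div (by fun_prop) (by fun_prop) fun x hx ↦ ?_) (by fun_prop)) (by fun_prop)
    have : x ≠ l := by rintro rfl; simp_all
    simpa [sub_eq_zero]

theorem differentiableOn_zetaExcept :
    DifferentiableOn ℂ (zetaExcept L) (L.lattice \ {(0 : ℂ)})ᶜ :=
  (hasSumLocallyUniformly_zetaExcept L).hasSumLocallyUniformlyOn.differentiableOn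
    (.of_forall fun _ ↦ .fun_sum fun i _ ↦ differentiable_zeta_summand L i)
    L.isOpen_compl_lattice_sdiff

theorem deriv_zetaExcept :
    Set.EqOn (deriv (zetaExcept L)) (fun z => -L.weierstrassPExcept 0 z)
      (L.lattice \ {(0 : ℂ)})ᶜ := by
  refine ((hasSumLocallyUniformly_zetaExcept L).tendstoLocallyUniformlyOn.deriv
    (.of_forall fun s ↦ .fun_sum fun i _ ↦ differentiable_zeta_summand L i)
    L.isOpen_compl_lattice_sdiff).unique ?_
  have hneg := (L.hasSumLocallyUniformly_weierstrassPExcept 0).tendstoLocallyUniformlyOn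
    (s := (L.lattice \ {(0 : ℂ)})ᶜ)
  refine (hneg.neg).congr ?_
  intro s z hz
  simp only [Function.comp_apply, Pi.neg_apply]
  rw [deriv_fun_sum fun i _ => (differentiable_zeta_summand L i).differentiableAt
    (L.isOpen_compl_lattice_sdiff.mem_nhds hz), ← Finset.sum_neg_distrib]
  refine Finset.sum_congr rfl fun l _ => ?_
  split_ifs with hl
  · simp
  · have hzl : z - l ≠ 0 := fun e ↦ hl (by
      obtain rfl := sub_eq_zero.mp e
      simpa using hz)
    have h1 : HasDerivAt (fun z : ℂ => 1 / (z - (l : ℂ)) + 1 / (l : ℂ) + z / (l : ℂ) ^ 2)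
        (-1 / (z - l) ^ 2 + 1 / (l : ℂ) ^ 2) z := by
      simpa using ((((hasDerivAt_id z).sub_const (l : ℂ)).fun_inv hzl).add_const
        (1 / (l : ℂ))).fun_add ((hasDerivAt_id z).div_const ((l : ℂ) ^ 2))
    rw [h1.deriv]
    ring

theorem analyticAt_zetaExcept : AnalyticAt ℂ (zetaExcept L) 0 :=
  (differentiableOn_zetaExcept L).analyticAt (L.compl_lattice_sdiff_singleton_mem_nhds 0)

theorem weierstrassZeta_neg (z : ℂ) : weierstrassZeta L (-z) = -weierstrassZeta L z := by
  simp only [weierstrassZeta]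
  rw [← (Equiv.neg L.lattice).tsum_eq, ← tsum_neg]
  refine tsum_congr fun l => ?_
  simp only [Equiv.neg_apply, NegMemClass.coe_neg]
  rw [show -z - -(l : ℂ) = -(z - l) by ring]
  simp only [div_neg, even_two, Even.neg_pow]
  ring

theorem hasDerivAt_weierstrassZeta {z : ℂ} (hz : z ∉ L.lattice) :
    HasDerivAt (weierstrassZeta L) (-℘[L] z) z := by
  have hz0 : z ≠ 0 := by rintro rfl; exact hz (zero_mem _)
  have hz' : z ∈ (L.lattice \ {(0 : ℂ)} : Set ℂ)ᶜ := fun h => hz h.1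
  have h1 := ((differentiableOn_zetaExcept L).differentiableAt
    (L.isOpen_compl_lattice_sdiff.mem_nhds hz')).hasDerivAt
  rw [deriv_zetaExcept L hz'] at h1
  have h2 := (hasDerivAt_inv hz0).add h1
  have h3 : weierstrassZeta L = (fun z => z⁻¹) + zetaExcept L := by
    ext w; simp [weierstrassZeta_eq]
  rw [h3]
  refine h2.congr_deriv ?_
  have := L.weierstrassPExcept_add 0 z
  simp at this
  rw [← this]; ring

/-- The increment has derivative ℘(u) - ℘(u + l) = 0 on the connected complement of the lattice. -/
theorem weierstrassZeta_add_sub {l z w : ℂ} (hl : l ∈ L.lattice) (hz : z ∉ L.lattice)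
    (hw : w ∉ L.lattice) :
    weierstrassZeta L (z + l) - weierstrassZeta L z
      = weierstrassZeta L (w + l) - weierstrassZeta L w := by
  have hd : ∀ u ∈ (L.lattice : Set ℂ)ᶜ,
      HasDerivAt (fun u => weierstrassZeta L (u + l) - weierstrassZeta L u) 0 u := by
    intro u hu
    have h1 := (hasDerivAt_weierstrassZeta L (add_notMem_lattice L hu hl)).comp_add_const u l
    have h2 := h1.sub (hasDerivAt_weierstrassZeta L hu)
    refine h2.congr_deriv ?_
    rw [show u + l = u + (⟨l, hl⟩ : L.lattice) from rfl, L.weierstrassP_add_coe u ⟨l, hl⟩]; ring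
  exact (isOpen_compl_lattice L).is_const_of_deriv_eq_zero (isPreconnected_compl_lattice L)
    (fun u hu => (hd u hu).differentiableAt.differentiableWithinAt)
    (fun u hu => (hd u hu).deriv) hz hw

theorem weierstrassZeta_add {l z : ℂ} (hl : l ∈ L.lattice) (hl2 : l / 2 ∉ L.lattice)
    (hz : z ∉ L.lattice) :
    weierstrassZeta L (z + l) = weierstrassZeta L z + quasiPeriod L l := by
  have := weierstrassZeta_add_sub L hl hz (w := -(l / 2)) (by simpa using hl2)
  rw [quasiPeriod, ← this]; ring

theorem quasiPeriod_eq (l : ℂ) : quasiPeriod L l = 2 * weierstrassZeta L (l / 2) := by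
  rw [quasiPeriod, weierstrassZeta_neg, show -(l / 2) + l = l / 2 by ring]; ring

/-- A primitive of `℘ ℘''`. -/
noncomputable def periodIntegral (z : ℂ) : ℂ :=
  (3 / 5) * (℘[L] z * ℘'[L] z) - (2 / 5) * L.g₂ * weierstrassZeta L z + (3 / 5) * L.g₃ * z

/-- The first order equation says ℘'² = (2/3)℘℘'' - (2/3)g₂℘ - g₃, hence (℘℘')' = (5/3)℘℘'' -
(2/3)g₂℘ - g₃. Integrating and using ζ' = -℘ explains the coefficients 3/5, 2/5, 3/5. -/
theorem hasDerivAt_periodIntegral {z : ℂ} (hz : z ∉ L.lattice) :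
    HasDerivAt (periodIntegral L) (℘[L] z * (6 * ℘[L] z ^ 2 - L.g₂ / 2)) z := by
  have h1 := ((hasDerivAt_weierstrassP L hz).mul (hasDerivAt_derivWeierstrassP L hz)).const_mul
    (3 / 5 : ℂ)
  have h2 := (hasDerivAt_weierstrassZeta L hz).const_mul ((2 / 5) * L.g₂)
  have h3 := (hasDerivAt_id z).const_mul ((3 / 5) * L.g₃)
  refine ((h1.sub h2).add h3).congr_deriv ?_
  simp only [mul_one]
  linear_combination (3 / 5) * L.derivWeierstrassP_sq z hz

/-- Only the terms in ζ and z fail to be periodic. This is the origin of p₁ and p₂. -/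
theorem periodIntegral_add {l z : ℂ} (hl : l ∈ L.lattice) (hl2 : l / 2 ∉ L.lattice)
    (hz : z ∉ L.lattice) :
    periodIntegral L (z + l) = periodIntegral L z
      - (1 / 5) * (2 * L.g₂ * quasiPeriod L l - 3 * L.g₃ * l) := by
  have h1 := L.weierstrassP_add_coe z ⟨l, hl⟩
  have h2 := L.derivWeierstrassP_add_coe z ⟨l, hl⟩
  simp only at h1 h2
  rw [periodIntegral, periodIntegral, h1, h2, weierstrassZeta_add L hl hl2 hz]
  ring

/-- The real part of `c ∫ ℘ ℘''` is periodic if `Re (c pᵢ) = 0` for both basic periods. -/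
theorem re_periodIntegral_add {c : ℂ}
    (h1 : (c * (2 * L.g₂ * quasiPeriod L L.ω₁ - 3 * L.g₃ * L.ω₁)).re = 0)
    (h2 : (c * (2 * L.g₂ * quasiPeriod L L.ω₂ - 3 * L.g₃ * L.ω₂)).re = 0)
    {l z : ℂ} (hl : l ∈ L.lattice) (hz : z ∉ L.lattice) :
    (c * periodIntegral L (z + l)).re = (c * periodIntegral L z).re := by
  -- The periods that leave the real part invariant form a group, so the two generators suffice. The
  -- increment formula could not be used for every l at once: it needs l/2 off the lattice.
  let S : AddSubgroup ℂ :=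
    { carrier := {l | l ∈ L.lattice ∧ ∀ z ∉ L.lattice,
        (c * periodIntegral L (z + l)).re = (c * periodIntegral L z).re}
      add_mem' := by
        rintro a b ⟨ha, ha'⟩ ⟨hb, hb'⟩
        refine ⟨add_mem ha hb, fun z hz => ?_⟩
        rw [← add_assoc, hb' _ (add_notMem_lattice L hz ha), ha' _ hz]
      zero_mem' := ⟨zero_mem _, by simp⟩
      neg_mem' := by
        rintro a ⟨ha, ha'⟩
        refine ⟨neg_mem ha, fun z hz => ?_⟩
        rw [← ha' _ (add_notMem_lattice L hz (neg_mem ha)), neg_add_cancel_right] }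
  have key : ∀ l, l ∈ L.lattice → l / 2 ∉ L.lattice →
      (c * (2 * L.g₂ * quasiPeriod L l - 3 * L.g₃ * l)).re = 0 → l ∈ S := by
    intro l hl hl2 h
    refine ⟨hl, fun z hz => ?_⟩
    rw [periodIntegral_add L hl hl2 hz, mul_sub, Complex.sub_re, mul_left_comm,
      show (1 / 5 : ℂ) = ((1 / 5 : ℝ) : ℂ) by norm_num, Complex.re_ofReal_mul, h]
    simp
  have hle : L.lattice ≤ S.toIntSubmodule := by
    rw [PeriodPair.lattice, Submodule.span_le]
    rintro _ (rfl | rfl)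
    · exact key _ L.ω₁_mem_lattice L.ω₁_div_two_notMem_lattice h1
    · exact key _ L.ω₂_mem_lattice L.ω₂_div_two_notMem_lattice h2
  exact (hle hl).2 z hz

/-! ### Non-vanishing of the quasi-periods -/

open Classical in
/-- `ζ² - ℘`, with the removable singularities at lattice points filled in when `ζ` is
periodic. -/
noncomputable def zetaSqSubP (z : ℂ) : ℂ :=
  if z ∈ L.lattice then 0 else weierstrassZeta L z ^ 2 - ℘[L] z

/-- Write ζ = 1/z + E and ℘ = 1/z² + W. Then ζ² - ℘ = 2E/z + E² - W, where E(0) = E'(0) = W(0) = 0,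
so E/z is the analytic `dslope` of E and the value at 0 is indeed the chosen 0. -/
theorem analyticAt_zetaSqSubP_zero : AnalyticAt ℂ (zetaSqSubP L) 0 := by
  have hE := analyticAt_zetaExcept L
  have hE0 : zetaExcept L 0 = 0 := by
    simp [zetaExcept]
  have hE1 : deriv (zetaExcept L) 0 = 0 := by
    rw [deriv_zetaExcept L (by simp)]; simp
  have hds : AnalyticAt ℂ (dslope (zetaExcept L) 0) 0 := by
    obtain ⟨p, hp⟩ := hE
    exact hp.has_fpower_series_dslope_fslope.analyticAt
  have hP := L.analyticAt_weierstrassPExcept 0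
  have h : AnalyticAt ℂ (fun z => 2 * dslope (zetaExcept L) 0 z + zetaExcept L z ^ 2
    - L.weierstrassPExcept 0 z) 0 := by fun_prop
  refine h.congr ?_
  filter_upwards [L.compl_lattice_sdiff_singleton_mem_nhds 0] with z hz
  by_cases hz0 : z = 0
  · subst hz0
    simp [zetaSqSubP, dslope_same, hE0, hE1]
  · have hzL : z ∉ L.lattice := fun h => hz ⟨h, hz0⟩
    have := L.weierstrassPExcept_add 0 z
    simp only [ZeroMemClass.coe_zero, sub_zero] at this
    rw [zetaSqSubP, if_neg hzL, weierstrassZeta_eq, dslope_of_ne _ hz0, slope_def_field, hE0, ← this]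
    field_simp
    ring

/-- If `ζ` were periodic, then `ζ² = ℘`. -/
theorem zetaSqSubP_eq_zero (hper : ∀ l ∈ L.lattice, ∀ z ∉ L.lattice,
    weierstrassZeta L (z + l) = weierstrassZeta L z) : zetaSqSubP L = 0 := by
  have hadd : ∀ z : ℂ, ∀ l : L.lattice, zetaSqSubP L (z + l) = zetaSqSubP L z := by
    intro z l
    by_cases hz : z ∈ L.lattice
    · rw [zetaSqSubP, if_pos (add_mem hz l.2), zetaSqSubP, if_pos hz]
    · rw [zetaSqSubP, if_neg (add_notMem_lattice L hz l.2), zetaSqSubP, if_neg hz,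
        hper _ l.2 _ hz, L.weierstrassP_add_coe]
  have han : ∀ z, AnalyticAt ℂ (zetaSqSubP L) z := by
    intro z
    by_cases hz : z ∈ L.lattice
    · have h0 := analyticAt_zetaSqSubP_zero L
      have hsub : zetaSqSubP L = fun w => zetaSqSubP L (w - z) := by
        ext w
        rw [← hadd (w - z) ⟨z, hz⟩]; simp
      rw [hsub]
      rw [← sub_self z] at h0
      exact h0.comp (f := fun w => w - z) (by fun_prop)
    · have : AnalyticAt ℂ (fun z => weierstrassZeta L z ^ 2 - ℘[L] z) z := by
        have h1 : AnalyticAt ℂ (weierstrassZeta L) z := by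
          refine DifferentiableOn.analyticAt (s := (L.lattice : Set ℂ)ᶜ)
            (fun w hw => ?_) ((isOpen_compl_lattice L).mem_nhds hz)
          exact (hasDerivAt_weierstrassZeta L hw).differentiableAt.differentiableWithinAt
        have h2 := L.analyticOnNhd_weierstrassP z hz
        fun_prop
      refine this.congr ?_
      filter_upwards [eventually_notMem_lattice hz] with w hw
      rw [zetaSqSubP, if_neg hw]
  ext x
  have : Differentiable ℂ (zetaSqSubP L) := fun x ↦ (han x).differentiableAt
  -- Liouville: the function is entire and has compact range by periodicity; its constant value is
  -- read off at 0.
  exact (this.apply_eq_apply_of_bounded (IsZLattice.isCompact_range_of_periodic L.lattice _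
    this.continuous fun z w hw ↦ by lift w to L.lattice using hw; exact hadd z w).isBounded
    x 0).trans (if_pos (by simp))

/-- The quasi-periods of a lattice do not both vanish. -/
theorem quasiPeriod_not_both_zero :
    ¬ (quasiPeriod L L.ω₁ = 0 ∧ quasiPeriod L L.ω₂ = 0) := by
  rintro ⟨h1, h2⟩
  let S : AddSubgroup ℂ :=
    { carrier := {l | l ∈ L.lattice ∧ ∀ z ∉ L.lattice,
        weierstrassZeta L (z + l) = weierstrassZeta L z}
      add_mem' := by
        rintro a b ⟨ha, ha'⟩ ⟨hb, hb'⟩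
        refine ⟨add_mem ha hb, fun z hz => ?_⟩
        rw [← add_assoc, hb' _ (add_notMem_lattice L hz ha), ha' _ hz]
      zero_mem' := ⟨zero_mem _, by simp⟩
      neg_mem' := by
        rintro a ⟨ha, ha'⟩
        refine ⟨neg_mem ha, fun z hz => ?_⟩
        rw [← ha' _ (add_notMem_lattice L hz (neg_mem ha)), neg_add_cancel_right] }
  have hle : L.lattice ≤ S.toIntSubmodule := by
    rw [PeriodPair.lattice, Submodule.span_le]
    rintro _ (rfl | rfl)
    · exact ⟨L.ω₁_mem_lattice, fun z hz => by
        rw [weierstrassZeta_add L L.ω₁_mem_lattice L.ω₁_div_two_notMem_lattice hz, h1, add_zero]⟩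
    · exact ⟨L.ω₂_mem_lattice, fun z hz => by
        rw [weierstrassZeta_add L L.ω₂_mem_lattice L.ω₂_div_two_notMem_lattice hz, h2, add_zero]⟩
  have h0 := zetaSqSubP_eq_zero L fun l hl => (hle hl).2
  have hsq : ∀ z ∉ L.lattice, weierstrassZeta L z ^ 2 = ℘[L] z := by
    intro z hz
    have := congrFun h0 z
    rwa [zetaSqSubP, if_neg hz, Pi.zero_apply, sub_eq_zero] at this
  -- At this half-period ζ vanishes, being half of the first quasi-period. From ζ² = ℘ one gets ℘ =
  -- 0, and from its derivative ℘' = -2ζ³ also ℘'' = 0, against `weierstrassP_regular`.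
  have hz := L.ω₁_div_two_notMem_lattice
  have hd := derivWeierstrassP_half L L.ω₁_mem_lattice
  have hzeta : weierstrassZeta L (L.ω₁ / 2) = 0 := by
    have := quasiPeriod_eq L L.ω₁
    rw [h1] at this
    simpa using this.symm
  have hP : ℘[L] (L.ω₁ / 2) = 0 := by rw [← hsq _ hz, hzeta]; simp
  have hdz : ∀ z ∉ L.lattice, ℘'[L] z = -2 * weierstrassZeta L z ^ 3 := by
    intro z hz
    have h3 := (hasDerivAt_weierstrassZeta L hz).pow 2
    have h4 : (weierstrassZeta L ^ 2) =ᶠ[𝓝 z] ℘[L] := by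
      filter_upwards [eventually_notMem_lattice hz] with w hw using hsq w hw
    have h5 := (h3.congr_of_eventuallyEq h4.symm).unique (hasDerivAt_weierstrassP L hz)
    simp only [Nat.cast_ofNat] at h5
    rw [← h5, ← hsq z hz]; ring
  refine weierstrassP_regular L hz hd ?_
  have h6 := ((hasDerivAt_weierstrassZeta L hz).pow 3).const_mul (-2)
  have h7 : ℘'[L] =ᶠ[𝓝 (L.ω₁ / 2)] fun z => -2 * (weierstrassZeta L ^ 3) z := by
    filter_upwards [eventually_notMem_lattice hz] with w hw using hdz w hw
  rw [(hasDerivAt_derivWeierstrassP L hz).unique (h6.congr_of_eventuallyEq h7), hzeta]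
  simp

end Zeta

end ImproperAffine

namespace ImproperAffine

open scoped PeriodPair
open Filter

/-! ### Lattices with symmetries -/

section Symmetry

variable (L : PeriodPair)

/-- Multiplication by `u` as a permutation of a lattice stable under `u` and `u⁻¹`. -/
noncomputable def latticeMulEquiv {u : ℂ} (hu : u ≠ 0) (h1 : ∀ l ∈ L.lattice, u * l ∈ L.lattice)
    (h2 : ∀ l ∈ L.lattice, u⁻¹ * l ∈ L.lattice) : L.lattice ≃ L.lattice where
  toFun l := ⟨u * l, h1 _ l.2⟩
  invFun l := ⟨u⁻¹ * l, h2 _ l.2⟩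
  left_inv l := by ext; simp [hu]
  right_inv l := by ext; simp [hu]

theorem mul_mem_lattice_of_periods {u : ℂ} (h1 : u * L.ω₁ ∈ L.lattice) (h2 : u * L.ω₂ ∈ L.lattice) :
    ∀ l ∈ L.lattice, u * l ∈ L.lattice := by
  intro l hl
  obtain ⟨m, n, rfl⟩ := PeriodPair.mem_lattice.mp hl
  have : u * (m * L.ω₁ + n * L.ω₂) = m • (u * L.ω₁) + n • (u * L.ω₂) := by
    simp only [zsmul_eq_mul]; ring
  rw [this]
  exact add_mem (L.lattice.smul_mem _ h1) (L.lattice.smul_mem _ h2)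

/-- Reindex the sum by l ↦ u l. A symmetry with uⁿ ≠ 1 therefore forces G n to vanish. -/
theorem G_symm {u : ℂ} (hu : u ≠ 0) (h1 : ∀ l ∈ L.lattice, u * l ∈ L.lattice)
    (h2 : ∀ l ∈ L.lattice, u⁻¹ * l ∈ L.lattice) (n : ℕ) : L.G n = (u ^ n)⁻¹ * L.G n := by
  conv_lhs => rw [PeriodPair.G, ← (latticeMulEquiv L hu h1 h2).tsum_eq]
  rw [PeriodPair.G, ← tsum_mul_left]
  refine tsum_congr fun l => ?_
  simp [latticeMulEquiv, mul_pow, mul_comm]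

theorem weierstrassZeta_symm {u : ℂ} (hu : u ≠ 0) (h1 : ∀ l ∈ L.lattice, u * l ∈ L.lattice)
    (h2 : ∀ l ∈ L.lattice, u⁻¹ * l ∈ L.lattice) (z : ℂ) :
    weierstrassZeta L (u * z) = u⁻¹ * weierstrassZeta L z := by
  rw [weierstrassZeta, ← (latticeMulEquiv L hu h1 h2).tsum_eq, weierstrassZeta, ← tsum_mul_left]
  refine tsum_congr fun l => ?_
  simp only [latticeMulEquiv, Equiv.coe_fn_mk]
  rw [← mul_sub]
  by_cases hl : (l : ℂ) = 0
  · simp [hl, mul_comm]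
  · by_cases hz : z - l = 0
    · simp only [hz]; field_simp
    · field_simp

end Symmetry

/-! ### The function `P` -/

section PFunction

theorem expI_coe (α : Set.Ioo (0 : ℝ) Real.pi) :
    (expI α : ℂ) = Complex.exp (Complex.I * ((α : ℝ) : ℂ)) := rfl

/-- Multiplication by i preserves the square lattice. It kills g₃ (as i⁶ = -1) and gives η₂ = -i η₁,
so that P = -|2 g₂ η₁|². -/
theorem P_neg_of_eq_pi_div_two (α : Set.Ioo (0 : ℝ) Real.pi) (hα : (α : ℝ) = Real.pi / 2) :
    P α < 0 := by
  have hE : (expI α : ℂ) = Complex.I := by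
    rw [expI_coe, hα, mul_comm]; push_cast; exact Complex.exp_pi_div_two_mul_I
  set L := periods (expI α) with hL
  have hω₁ : L.ω₁ = 1 := rfl
  have hω₂ : L.ω₂ = Complex.I := hE
  have m1 := L.ω₁_mem_lattice
  have m2 := L.ω₂_mem_lattice
  rw [hω₁] at m1
  rw [hω₂] at m2
  have h1 : ∀ l ∈ L.lattice, Complex.I * l ∈ L.lattice :=
    mul_mem_lattice_of_periods L (by rw [hω₁, mul_one]; exact m2)
      (by rw [hω₂, Complex.I_mul_I]; exact neg_mem m1)
  have h2 : ∀ l ∈ L.lattice, Complex.I⁻¹ * l ∈ L.lattice := by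
    intro l hl
    rw [Complex.inv_I, neg_mul]
    exact neg_mem (h1 l hl)
  have hg3 : L.g₃ = 0 := by
    have := G_symm L Complex.I_ne_zero h1 h2 6
    rw [show Complex.I ^ 6 = -1 by rw [show (6 : ℕ) = 4 + 2 by rfl, pow_add]; simp] at this
    have h0 : L.G 6 = 0 := by
      rw [← CharZero.eq_neg_self_iff]; simpa using this
    simp [PeriodPair.g₃, h0]
  have hg2 : L.g₂ ≠ 0 := fun h => g₂_g₃_not_both_zero L ⟨h, hg3⟩
  have heta : eta₂ (expI α) = -Complex.I * eta₁ (expI α) := by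
    rw [eta₂, eta₁, quasiPeriod_eq, quasiPeriod_eq, hE]
    have := weierstrassZeta_symm L Complex.I_ne_zero h1 h2 (1 / 2)
    rw [← hL, show Complex.I / 2 = Complex.I * (1 / 2) by ring, this, Complex.inv_I]; ring
  have heta1 : eta₁ (expI α) ≠ 0 := by
    intro h
    refine quasiPeriod_not_both_zero L ⟨h, ?_⟩
    change eta₂ (expI α) = 0
    rw [heta, h, mul_zero]
  have hp : starRingEnd ℂ (p₁ α) * p₂ α
      = -((Complex.normSq (2 * L.g₂ * eta₁ (expI α)) : ℝ) : ℂ) * Complex.I := by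
    rw [Complex.normSq_eq_conj_mul_self, p₁, p₂, ← hL, hg3, heta]
    simp only [mul_zero, zero_mul, sub_zero]
    ring
  have hpos : 0 < Complex.normSq (2 * L.g₂ * eta₁ (expI α)) := by
    rw [Complex.normSq_pos]
    simp [hg2, heta1]
  rw [P, hp]
  simpa using hpos

/-- The sixth root of unity ρ preserves the hexagonal lattice, and ρ⁴ = -ρ ≠ 1 kills g₂. Then p₂ = ρ
p₁ and P = |3 g₃|² Im ρ. -/
theorem P_pos_of_eq_pi_div_three (α : Set.Ioo (0 : ℝ) Real.pi) (hα : (α : ℝ) = Real.pi / 3) :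
    0 < P α := by
  have hE : (expI α : ℂ) = 1 / 2 + (Real.sqrt 3 / 2 : ℝ) * Complex.I := by
    rw [expI_coe, hα, mul_comm, Complex.exp_mul_I, ← Complex.ofReal_cos, ← Complex.ofReal_sin,
      Real.cos_pi_div_three, Real.sin_pi_div_three]
    push_cast; rfl
  have him : 0 < (expI α : ℂ).im := (expI α).im_pos
  set ρ : ℂ := (expI α : ℂ) with hρ
  have hsq : ρ ^ 2 = ρ - 1 := by
    rw [hE]
    have : ((Real.sqrt 3 : ℝ) : ℂ) ^ 2 = 3 := by
      rw [← Complex.ofReal_pow, Real.sq_sqrt (by norm_num)]; norm_num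
    push_cast
    ring_nf
    rw [Complex.I_sq, this]
    ring
  set L := periods (expI α) with hL
  have hω₁ : L.ω₁ = 1 := rfl
  have hω₂ : L.ω₂ = ρ := rfl
  have m1 := L.ω₁_mem_lattice
  have m2 := L.ω₂_mem_lattice
  rw [hω₁] at m1
  rw [hω₂] at m2
  have hρ0 : ρ ≠ 0 := by rintro h; rw [h] at him; simp at him
  have hinv : ρ⁻¹ = 1 - ρ := by
    field_simp
    linear_combination hsq
  have h1 : ∀ l ∈ L.lattice, ρ * l ∈ L.lattice :=
    mul_mem_lattice_of_periods L (by rw [hω₁, mul_one]; exact m2)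
      (by rw [hω₂, ← sq, hsq]; exact sub_mem m2 m1)
  have h2 : ∀ l ∈ L.lattice, ρ⁻¹ * l ∈ L.lattice := by
    intro l hl
    rw [hinv, sub_mul, one_mul]
    exact sub_mem hl (h1 l hl)
  have hg2 : L.g₂ = 0 := by
    have := G_symm L hρ0 h1 h2 4
    have h4 : ρ ^ 4 = -ρ := by
      linear_combination (ρ ^ 2 + ρ) * hsq
    rw [h4] at this
    have h0 : L.G 4 = 0 := by
      have h5 : (ρ + 1) * L.G 4 = 0 := by
        field_simp at this
        linear_combination this
      refine (mul_eq_zero.mp h5).resolve_left fun h => ?_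
      have := congrArg Complex.im h
      simp at this
      exact him.ne' this
    simp [PeriodPair.g₂, h0]
  have hg3 : L.g₃ ≠ 0 := fun h => g₂_g₃_not_both_zero L ⟨hg2, h⟩
  have hp : starRingEnd ℂ (p₁ α) * p₂ α
      = ((Complex.normSq (3 * L.g₃) : ℝ) : ℂ) * ρ := by
    rw [Complex.normSq_eq_conj_mul_self, p₁, p₂, ← hL, hg2]
    simp only [mul_zero, zero_mul, zero_sub, map_neg]
    ring
  have hpos : 0 < Complex.normSq (3 * L.g₃) := by
    rw [Complex.normSq_pos]
    simp [hg3]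
  rw [P, hp, Complex.im_ofReal_mul]
  positivity

/-! #### Continuity -/

/-- The norm `√(m² + n²)` on `ℤ × ℤ`. -/
noncomputable def gaussNorm (p : ℤ × ℤ) : ℝ := ‖(p.1 : ℂ) + p.2 * Complex.I‖

theorem gaussNorm_sq (p : ℤ × ℤ) : gaussNorm p ^ 2 = (p.1 : ℝ) ^ 2 + (p.2 : ℝ) ^ 2 := by
  rw [gaussNorm, ← Complex.normSq_eq_norm_sq, Complex.normSq_apply]
  simp; ring

theorem gaussNorm_nonneg (p : ℤ × ℤ) : 0 ≤ gaussNorm p := norm_nonneg _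

theorem gaussNorm_pos {p : ℤ × ℤ} (hp : p ≠ 0) : 0 < gaussNorm p := by
  refine lt_of_le_of_ne (gaussNorm_nonneg p) fun h => hp ?_
  have := gaussNorm_sq p
  rw [← h] at this
  have h1 : (p.1 : ℝ) = 0 := by nlinarith [sq_nonneg (p.1 : ℝ), sq_nonneg (p.2 : ℝ)]
  have h2 : (p.2 : ℝ) = 0 := by nlinarith [sq_nonneg (p.1 : ℝ), sq_nonneg (p.2 : ℝ)]
  ext
  · exact_mod_cast h1
  · exact_mod_cast h2

theorem summable_gaussNorm (k : ℕ) (hk : 2 < k) : Summable fun p : ℤ × ℤ => (gaussNorm p ^ k)⁻¹ := by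
  have h := ZLattice.summable_norm_rpow (periods UpperHalfPlane.I).lattice (-(k : ℝ)) (by
    simp; exact_mod_cast hk)
  rw [← ((periods UpperHalfPlane.I).latticeEquivProd.symm.toEquiv).summable_iff] at h
  refine h.congr fun p => ?_
  have h1 : ‖(periods UpperHalfPlane.I).latticeEquivProd.symm p‖ = gaussNorm p := by
    rw [Submodule.coe_norm, PeriodPair.latticeEquiv_symm_apply]
    simp [gaussNorm, periods]
  simp only [Function.comp_apply, LinearEquiv.coe_toEquiv, h1]
  rw [Real.rpow_neg (gaussNorm_nonneg p), Real.rpow_natCast]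

/-- The square of the right side is m² + n² + 2mn cos α = (1 - cos α)(m² + n²) + cos α (m + n)², and
0 ≤ cos α ≤ 1/2. The bound is uniform in α, so one summable series dominates all the lattice sums.
-/
theorem half_gaussNorm_le {α : ℝ} (hα : α ∈ Set.Icc (Real.pi / 3) (Real.pi / 2)) (p : ℤ × ℤ) :
    gaussNorm p / 2 ≤ ‖(p.1 : ℂ) + p.2 * Complex.exp (Complex.I * (α : ℂ))‖ := by
  have hpi := Real.pi_pos
  have hc0 : 0 ≤ Real.cos α := Real.cos_nonneg_of_mem_Icc ⟨by linarith [hα.1], hα.2⟩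
  have hc1 : Real.cos α ≤ 1 / 2 := by
    rw [← Real.cos_pi_div_three]
    exact Real.cos_le_cos_of_nonneg_of_le_pi (by positivity) (by linarith [hα.2]) hα.1
  refine abs_le_of_sq_le_sq' ?_ (norm_nonneg _) |>.2
  rw [div_pow, gaussNorm_sq, ← Complex.normSq_eq_norm_sq, mul_comm Complex.I, Complex.exp_mul_I,
    ← Complex.ofReal_cos, ← Complex.ofReal_sin, Complex.normSq_apply]
  simp [-Complex.ofReal_cos, -Complex.ofReal_sin]
  have hs := Real.sin_sq_add_cos_sq α
  have key : ((p.1 : ℝ) + p.2 * Real.cos α) * (p.1 + p.2 * Real.cos α)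
      + p.2 * Real.sin α * (p.2 * Real.sin α)
      = (p.1 : ℝ) ^ 2 + p.2 ^ 2 + 2 * Real.cos α * (p.1 * p.2) := by
    linear_combination (p.2 : ℝ) ^ 2 * hs
  rw [key]
  nlinarith [mul_nonneg hc0 (sq_nonneg ((p.1 : ℝ) + p.2)),
    mul_nonneg (sub_nonneg.mpr hc1) (add_nonneg (sq_nonneg (p.1 : ℝ)) (sq_nonneg (p.2 : ℝ)))]

theorem continuousOn_tsum_inv_pow (k : ℕ) (hk : 2 < k) :
    ContinuousOn (fun α : ℝ => ∑' p : ℤ × ℤ,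
      (((p.1 : ℂ) + p.2 * Complex.exp (Complex.I * (α : ℂ))) ^ k)⁻¹)
      (Set.Icc (Real.pi / 3) (Real.pi / 2)) := by
  refine continuousOn_tsum (u := fun p => 2 ^ k * (gaussNorm p ^ k)⁻¹) ?_
    ((summable_gaussNorm k hk).mul_left _) ?_
  · intro p
    by_cases hp : p = 0
    · subst hp; simpa using continuousOn_const
    · refine ContinuousOn.inv₀ (by fun_prop) fun α hα => pow_ne_zero _ ?_
      rw [← norm_pos_iff]
      exact lt_of_lt_of_le (half_pos (gaussNorm_pos hp)) (half_gaussNorm_le hα p)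
  · intro p α hα
    by_cases hp : p = 0
    · subst hp; simp [show k ≠ 0 by omega]
      exact pow_nonneg (gaussNorm_nonneg _) _
    · have h := half_gaussNorm_le hα p
      have h0 := gaussNorm_pos hp
      rw [norm_inv, norm_pow]
      calc (‖(p.1 : ℂ) + p.2 * Complex.exp (Complex.I * (α : ℂ))‖ ^ k)⁻¹
          ≤ ((gaussNorm p / 2) ^ k)⁻¹ := by gcongr
        _ = 2 ^ k * (gaussNorm p ^ k)⁻¹ := by rw [div_pow, inv_div, div_eq_mul_inv]

/-- Evaluates ζ at the half-period (a + b e^{iα})/2, for use with (a, b) = (1, 0) and (0, 1), where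
it is half a quasi-period. The hypothesis `hab` keeps the half-period away from the lattice: twice
its difference with a lattice point has coordinates (a - 2m, b - 2n). -/
theorem continuousOn_tsum_zeta (a b : ℤ)
    (hz : ∀ α : ℝ, ‖((a : ℂ) + b * Complex.exp (Complex.I * (α : ℂ))) / 2‖ = 1 / 2)
    (hab : ∀ p : ℤ × ℤ, gaussNorm p ≤ gaussNorm (a - 2 * p.1, b - 2 * p.2)) :
    ContinuousOn (fun α : ℝ => ∑' p : ℤ × ℤ,
      (1 / (((a : ℂ) + b * Complex.exp (Complex.I * (α : ℂ))) / 2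
          - (p.1 + p.2 * Complex.exp (Complex.I * (α : ℂ))))
        + 1 / (p.1 + p.2 * Complex.exp (Complex.I * (α : ℂ)))
        + ((a : ℂ) + b * Complex.exp (Complex.I * (α : ℂ))) / 2
          / (p.1 + p.2 * Complex.exp (Complex.I * (α : ℂ))) ^ 2))
      (Set.Icc (Real.pi / 3) (Real.pi / 2)) := by
  have hne : ∀ α : ℝ, ((a : ℂ) + b * Complex.exp (Complex.I * (α : ℂ))) / 2 ≠ 0 := fun α => by
    rw [← norm_pos_iff, hz]; norm_num
  have hsub : ∀ α ∈ Set.Icc (Real.pi / 3) (Real.pi / 2), ∀ p : ℤ × ℤ, gaussNorm p / 4 ≤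
      ‖((a : ℂ) + b * Complex.exp (Complex.I * (α : ℂ))) / 2
          - (p.1 + p.2 * Complex.exp (Complex.I * (α : ℂ)))‖ := by
    intro α hα p
    have h := half_gaussNorm_le hα (a - 2 * p.1, b - 2 * p.2)
    have h1 := hab p
    have h2 : ((a : ℂ) + b * Complex.exp (Complex.I * (α : ℂ))) / 2
          - (p.1 + p.2 * Complex.exp (Complex.I * (α : ℂ)))
        = (1 / 2 : ℝ) * (((a - 2 * p.1 : ℤ) : ℂ)
          + ((b - 2 * p.2 : ℤ) : ℂ) * Complex.exp (Complex.I * (α : ℂ))) := by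
      push_cast; ring
    rw [h2, norm_mul, Complex.norm_real]
    norm_num at h ⊢
    linarith
  -- The summand at p = 0 is 1/z with |z| = 1/2, of norm 2. The 4 is (1/2)² / ((1/2)² · (1/4)), from
  -- the bounds on |z|, |l| and |z - l|.
  refine continuousOn_tsum (u := fun p => (if p = 0 then 2 else 0) + 4 * (gaussNorm p ^ 3)⁻¹) ?_
    (((summable_of_hasFiniteSupport ((Set.finite_singleton (0 : ℤ × ℤ)).subset (by simp)))).add
      ((summable_gaussNorm 3 (by norm_num)).mul_left _)) ?_
  · intro p
    by_cases hp : p = 0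
    · subst hp
      simp only [Prod.fst_zero, Prod.snd_zero, Int.cast_zero, zero_mul, add_zero, sub_zero,
        div_zero, ne_eq, OfNat.ofNat_ne_zero, not_false_eq_true, zero_pow]
      exact ContinuousOn.div (by fun_prop) (by fun_prop) fun α _ => hne α
    · have h0 := gaussNorm_pos hp
      have hl : ∀ α ∈ Set.Icc (Real.pi / 3) (Real.pi / 2),
          (p.1 + p.2 * Complex.exp (Complex.I * (α : ℂ))) ≠ 0 := fun α hα => by
        rw [← norm_pos_iff]
        exact lt_of_lt_of_le (half_pos h0) (half_gaussNorm_le hα p)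
      refine .add (.add (.div (by fun_prop) (by fun_prop) fun α hα => ?_)
        (.div (by fun_prop) (by fun_prop) hl)) (.div (by fun_prop) (by fun_prop)
          fun α hα => pow_ne_zero _ (hl α hα))
      rw [← norm_pos_iff]
      exact lt_of_lt_of_le (by positivity) (hsub α hα p)
  · intro p α hα
    by_cases hp : p = 0
    · subst hp
      have h4 : 0 ≤ 4 * (gaussNorm (0 : ℤ × ℤ) ^ 3)⁻¹ := by
        have := gaussNorm_nonneg 0; positivity
      simp only [Prod.fst_zero, Prod.snd_zero, Int.cast_zero, zero_mul, add_zero, sub_zero,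
        div_zero, ne_eq, OfNat.ofNat_ne_zero, not_false_eq_true, zero_pow, if_true]
      rw [norm_div, norm_one, hz]
      linarith
    · have h0 := gaussNorm_pos hp
      have h1 := half_gaussNorm_le hα p
      have h2 := hsub α hα p
      have hl : (p.1 + p.2 * Complex.exp (Complex.I * (α : ℂ))) ≠ 0 := by
        rw [← norm_pos_iff]; linarith
      have hzl := norm_pos_iff.mp (lt_of_lt_of_le (by positivity) h2)
      rw [zeta_summand_eq hl (sub_ne_zero.mp hzl), norm_div, norm_mul, norm_pow, norm_pow, hz,
        if_neg hp, zero_add]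
      calc _ ≤ (1 / 2) ^ 2 / ((gaussNorm p / 2) ^ 2 * (gaussNorm p / 4)) := by gcongr
        _ = 4 * (gaussNorm p ^ 3)⁻¹ := by field_simp

theorem G_expI (α : Set.Ioo (0 : ℝ) Real.pi) (k : ℕ) :
    (periods (expI α)).G k = ∑' p : ℤ × ℤ,
      (((p.1 : ℂ) + p.2 * Complex.exp (Complex.I * ((α : ℝ) : ℂ))) ^ k)⁻¹ := by
  rw [PeriodPair.G, ← ((periods (expI α)).latticeEquivProd.symm.toEquiv).tsum_eq]
  refine tsum_congr fun p => ?_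
  simp only [LinearEquiv.coe_toEquiv, PeriodPair.latticeEquiv_symm_apply]
  simp [periods, expI]

theorem weierstrassZeta_expI (α : Set.Ioo (0 : ℝ) Real.pi) (z : ℂ) :
    weierstrassZeta (periods (expI α)) z = ∑' p : ℤ × ℤ,
      (1 / (z - (p.1 + p.2 * Complex.exp (Complex.I * ((α : ℝ) : ℂ))))
        + 1 / (p.1 + p.2 * Complex.exp (Complex.I * ((α : ℝ) : ℂ)))
        + z / (p.1 + p.2 * Complex.exp (Complex.I * ((α : ℝ) : ℂ))) ^ 2) := by
  rw [weierstrassZeta, ← ((periods (expI α)).latticeEquivProd.symm.toEquiv).tsum_eq]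
  refine tsum_congr fun p => ?_
  simp only [LinearEquiv.coe_toEquiv, PeriodPair.latticeEquiv_symm_apply]
  simp [periods, expI]

/-- Passing from the subtype to a function of a real variable makes the intermediate value theorem
applicable on [π/3, π/2]. -/
theorem exists_P_eq_continuousOn : ∃ Q : ℝ → ℝ,
    ContinuousOn Q (Set.Icc (Real.pi / 3) (Real.pi / 2)) ∧
    ∀ α : Set.Ioo (0 : ℝ) Real.pi, P α = Q α := by
  have h4 := continuousOn_tsum_inv_pow 4 (by norm_num)
  have h6 := continuousOn_tsum_inv_pow 6 (by norm_num)
  have z1 := continuousOn_tsum_zeta 1 0 (by simp) (fun p => by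
    refine abs_le_of_sq_le_sq' ?_ (gaussNorm_nonneg _) |>.2
    rw [gaussNorm_sq, gaussNorm_sq]
    have : p.1 ^ 2 ≤ (1 - 2 * p.1) ^ 2 := by
      rcases le_or_gt p.1 0 with h | h <;> nlinarith
    have : (p.1 : ℝ) ^ 2 ≤ (1 - 2 * p.1) ^ 2 := by exact_mod_cast this
    push_cast
    nlinarith [sq_nonneg (p.2 : ℝ)])
  have z2 := continuousOn_tsum_zeta 0 1 (fun α => by
      rw [mul_comm Complex.I]; simp [Complex.norm_exp_ofReal_mul_I]) (fun p => by
    refine abs_le_of_sq_le_sq' ?_ (gaussNorm_nonneg _) |>.2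
    rw [gaussNorm_sq, gaussNorm_sq]
    have : p.2 ^ 2 ≤ (1 - 2 * p.2) ^ 2 := by
      rcases le_or_gt p.2 0 with h | h <;> nlinarith
    have : (p.2 : ℝ) ^ 2 ≤ (1 - 2 * p.2) ^ 2 := by exact_mod_cast this
    push_cast
    nlinarith [sq_nonneg (p.1 : ℝ)])
  have he : ContinuousOn (fun α : ℝ => Complex.exp (Complex.I * (α : ℂ)))
    (Set.Icc (Real.pi / 3) (Real.pi / 2)) := by fun_prop
  have hp1 := (((h4.const_mul 60).const_mul 2).mul (z1.const_mul 2)).sub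
    ((h6.const_mul 140).const_mul 3)
  have hp2 := (((h4.const_mul 60).const_mul 2).mul (z2.const_mul 2)).sub
    (((h6.const_mul 140).const_mul 3).mul he)
  refine ⟨_, Complex.continuous_im.comp_continuousOn
    ((Complex.continuous_conj.comp_continuousOn hp1).mul hp2), fun α => ?_⟩
  simp only [P, Pi.mul_apply, Pi.sub_apply, p₁, p₂, eta₁, eta₂, quasiPeriod_eq, PeriodPair.g₂, PeriodPair.g₃, G_expI,
    weierstrassZeta_expI, expI_coe, Function.comp_apply, Int.cast_zero, Int.cast_one, zero_mul,
    one_mul, zero_add, add_zero]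

theorem exists_P_eq_zero : ∃ α₀ : Set.Ioo (0 : ℝ) Real.pi,
    Real.pi / 3 < (α₀ : ℝ) ∧ (α₀ : ℝ) < Real.pi / 2 ∧ P α₀ = 0 := by
  obtain ⟨Q, hQ, hPQ⟩ := exists_P_eq_continuousOn
  have hpi := Real.pi_pos
  have h3 := P_pos_of_eq_pi_div_three ⟨Real.pi / 3, by positivity, by linarith⟩ rfl
  have h2 := P_neg_of_eq_pi_div_two ⟨Real.pi / 2, by positivity, by linarith⟩ rfl
  rw [hPQ] at h2 h3
  obtain ⟨a, ha, ha0⟩ := intermediate_value_Icc' (by linarith) hQ ⟨h2.le, h3.le⟩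
  have h3' : a ≠ Real.pi / 3 := by rintro rfl; exact h3.ne' ha0
  have h2' : a ≠ Real.pi / 2 := by rintro rfl; exact h2.ne ha0
  have hl := lt_of_le_of_ne ha.1 h3'.symm
  have hr := lt_of_le_of_ne ha.2 h2'
  exact ⟨⟨a, by linarith, by linarith⟩, hl, hr, by rw [hPQ]; exact ha0⟩

/-- If `conj p₁ p₂` is real, some nonzero multiple of `(p₁, p₂)` is imaginary. -/
theorem exists_re_mul_eq_zero {a b : ℂ} (h : (starRingEnd ℂ a * b).im = 0) :
    ∃ c : ℂ, c ≠ 0 ∧ (c * a).re = 0 ∧ (c * b).re = 0 := by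
  by_cases ha : a = 0
  · by_cases hb : b = 0
    · exact ⟨1, one_ne_zero, by simp [ha], by simp [hb]⟩
    · refine ⟨Complex.I * starRingEnd ℂ b, by simpa using hb, by simp [ha], ?_⟩
      rw [mul_assoc, ← Complex.normSq_eq_conj_mul_self]; simp
  · refine ⟨Complex.I * starRingEnd ℂ a, by simpa using ha, ?_, ?_⟩
    · rw [mul_assoc, ← Complex.normSq_eq_conj_mul_self]; simp
    · rw [mul_assoc, Complex.I_mul_re, h, neg_zero]

end PFunction

end ImproperAffine

namespace ImproperAffine

open scoped PeriodPair
open Filter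

/-! ### Functions and charts on the punctured torus -/

section Torus

variable {L : PeriodPair}

theorem torusMk_eq_iff {z w : ℂ} : torusMk L z = torusMk L w ↔ w - z ∈ L.lattice := by
  rw [torusMk, QuotientAddGroup.eq, neg_add_eq_sub]; rfl

theorem torusMk_eq_zero_iff {z : ℂ} : torusMk L z = 0 ↔ z ∈ L.lattice :=
  QuotientAddGroup.eq_zero_iff z

theorem torusMk_mem_punctured {z : ℂ} : torusMk L z ∈ puncturedTorus L ↔ z ∉ L.lattice := by
  rw [← torusMk_eq_zero_iff]; rfl

theorem torus_chart_symm {e : OpenPartialHomeomorph (ComplexTorus L) ℂ}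
    (he : e ∈ atlas ℂ (ComplexTorus L)) {z : ℂ} (hz : z ∈ e.target) : e.symm z = torusMk L z := by
  obtain ⟨q, rfl⟩ := he
  simp [chartAt_self_eq]

/-- Every chart is a local inverse of the projection from ℂ. Hence a function induced by a periodic
f is f itself in every chart, and all computations take place in ℂ. -/
theorem chart_symm_coe {e : OpenPartialHomeomorph (puncturedTorus L) ℂ}
    (he : e ∈ atlas ℂ (puncturedTorus L)) {z : ℂ} (hz : z ∈ e.target) :
    ((e.symm z : puncturedTorus L) : ComplexTorus L) = torusMk L z := by
  obtain ⟨p, hp⟩ := Set.mem_iUnion.mp he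
  rw [Set.mem_singleton_iff] at hp
  subst hp
  have h1 := (chartAt ℂ (p : ComplexTorus L)).subtypeRestr_symm_apply ⟨p⟩ hz
  rw [Function.comp_apply] at h1
  rw [h1]
  exact torus_chart_symm (chart_mem_atlas ℂ _)
    (OpenPartialHomeomorph.subtypeRestr_target_subset (e := chartAt ℂ (p : ComplexTorus L)) ⟨p⟩ hz)

theorem torusMk_chart {e : OpenPartialHomeomorph (puncturedTorus L) ℂ}
    (he : e ∈ atlas ℂ (puncturedTorus L)) {p : puncturedTorus L} (hp : p ∈ e.source) :
    torusMk L (e p) = p := by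
  rw [← chart_symm_coe he (e.map_source hp), e.left_inv hp]

theorem notMem_lattice_of_mem_target {e : OpenPartialHomeomorph (puncturedTorus L) ℂ}
    (he : e ∈ atlas ℂ (puncturedTorus L)) {z : ℂ} (hz : z ∈ e.target) : z ∉ L.lattice := by
  rw [← torusMk_mem_punctured, ← chart_symm_coe he hz]
  exact (e.symm z).2

theorem chart_notMem_lattice (p : puncturedTorus L) : chartAt ℂ p p ∉ L.lattice :=
  notMem_lattice_of_mem_target (chart_mem_atlas ℂ p) (mem_chart_target ℂ p)

variable (L) in
/-- Invariance under the translations by lattice vectors. -/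
def LatticePeriodic {E : Type*} (f : ℂ → E) : Prop :=
  ∀ l ∈ L.lattice, ∀ z ∉ L.lattice, f (z + l) = f z

/-- The function on the punctured torus induced by a periodic function. -/
noncomputable def descend {E : Type*} (f : ℂ → E) (p : puncturedTorus L) : E :=
  f (Quotient.out (p : ComplexTorus L))

theorem torusMk_out (q : ComplexTorus L) : torusMk L (Quotient.out q) = q :=
  Quotient.out_eq q

theorem descend_eq {E : Type*} {f : ℂ → E} (hf : LatticePeriodic L f) {p : puncturedTorus L}
    {z : ℂ} (hz : torusMk L z = p) : descend f p = f z := by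
  have h1 := torusMk_out (p : ComplexTorus L)
  rw [← hz, torusMk_eq_iff] at h1
  have hzL : z ∉ L.lattice := by
    rw [← torusMk_mem_punctured, hz]; exact p.2
  have := hf _ (neg_mem h1) z hzL
  rw [descend, ← this]
  congr 1
  rw [← hz]; ring

theorem descend_chart_symm {E : Type*} {f : ℂ → E} (hf : LatticePeriodic L f)
    {e : OpenPartialHomeomorph (puncturedTorus L) ℂ}
    (he : e ∈ atlas ℂ (puncturedTorus L)) {z : ℂ} (hz : z ∈ e.target) :
    descend f (e.symm z) = f z :=
  descend_eq hf (chart_symm_coe he hz).symm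

theorem descend_eq_chart {E : Type*} {f : ℂ → E} (hf : LatticePeriodic L f)
    {e : OpenPartialHomeomorph (puncturedTorus L) ℂ}
    (he : e ∈ atlas ℂ (puncturedTorus L)) {p : puncturedTorus L} (hp : p ∈ e.source) :
    descend f p = f (e p) :=
  descend_eq hf (torusMk_chart he hp)

theorem continuousAt_descend {E : Type*} [TopologicalSpace E] {f : ℂ → E}
    (hf : LatticePeriodic L f) {p : puncturedTorus L} (h : ContinuousAt f (chartAt ℂ p p)) :
    ContinuousAt (descend f) p := by
  refine (h.comp (f := chartAt ℂ p)
    ((chartAt ℂ p).continuousAt (mem_chart_source ℂ p))).congr ?_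
  filter_upwards [(chartAt ℂ p).open_source.mem_nhds (mem_chart_source ℂ p)] with q hq
  exact (descend_eq_chart hf (chart_mem_atlas ℂ p) hq).symm

/-- The scalar field is left free: ℂ serves for holomorphy of F and G, ℝ for the metric and for line
integrals. -/
theorem hasMFDerivAt_descend {𝕜 E : Type*} [NontriviallyNormedField 𝕜] [NormedSpace 𝕜 ℂ]
    [NormedAddCommGroup E] [NormedSpace 𝕜 E] {f : ℂ → E} (hf : LatticePeriodic L f)
    {p : puncturedTorus L} {f' : ℂ →L[𝕜] E} (h : HasFDerivAt f f' (chartAt ℂ p p)) :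
    HasMFDerivAt 𝓘(𝕜, ℂ) 𝓘(𝕜, E) (descend f) p f' := by
  refine ⟨continuousAt_descend hf h.continuousAt, ?_⟩
  have h1 : HasFDerivAt (writtenInExtChartAt 𝓘(𝕜, ℂ) 𝓘(𝕜, E) p (descend f)) f' (chartAt ℂ p p) := by
    refine h.congr_of_eventuallyEq ?_
    filter_upwards [(chartAt ℂ p).open_target.mem_nhds (mem_chart_target ℂ p)] with z hz
    simp [writtenInExtChartAt, descend_chart_symm hf (chart_mem_atlas ℂ p) hz, chartAt_self_eq]
  simpa using! h1.hasFDerivWithinAt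

theorem contMDiffAt_descend {E : Type*} [NormedAddCommGroup E] [NormedSpace ℝ E] {f : ℂ → E}
    (hf : LatticePeriodic L f) {p : puncturedTorus L} {n : WithTop ℕ∞}
    (h : ContDiffAt ℝ n f (chartAt ℂ p p)) :
    ContMDiffAt 𝓘(ℝ, ℂ) 𝓘(ℝ, E) n (descend f) p := by
  rw [contMDiffAt_iff]
  refine ⟨continuousAt_descend hf h.continuousAt, ?_⟩
  refine ContDiffAt.contDiffWithinAt ?_
  simp only [mfld_simps]
  refine h.congr_of_eventuallyEq ?_
  filter_upwards [(chartAt ℂ p).open_target.mem_nhds (mem_chart_target ℂ p)] with z hz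
  simp [descend_chart_symm hf (chart_mem_atlas ℂ p) hz, chartAt_self_eq]

end Torus

/-! ### The Weierstrass data -/

section Front

variable {L : PeriodPair}

theorem periodic_wp (c : ℂ) : LatticePeriodic L (fun z => c * ℘[L] z) := fun l hl z _ => by
  beta_reduce
  rw [show z + l = z + (⟨l, hl⟩ : L.lattice) from rfl, L.weierstrassP_add_coe]

theorem periodic_wp' : LatticePeriodic L ℘'[L] := fun l hl z _ => by
  rw [show z + l = z + (⟨l, hl⟩ : L.lattice) from rfl, L.derivWeierstrassP_add_coe]

variable (L) in
/-- The function `F = c ℘` on the punctured torus. -/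
noncomputable def dataF (c : ℂ) : puncturedTorus L → ℂ := descend fun z => c * ℘[L] z

variable (L) in
/-- The function `G = ℘'` on the punctured torus. -/
noncomputable def dataG : puncturedTorus L → ℂ := descend ℘'[L]

variable (L) in
/-- The second derivative of `℘`. -/
noncomputable def wpSecond (z : ℂ) : ℂ := 6 * ℘[L] z ^ 2 - L.g₂ / 2

theorem hasMFDerivAt_dataF (c : ℂ) (p : puncturedTorus L) :
    HasMFDerivAt 𝓘(ℂ) 𝓘(ℂ) (dataF L c) p
      (ContinuousLinearMap.toSpanSingleton ℂ (c * ℘'[L] (chartAt ℂ p p))) :=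
  hasMFDerivAt_descend (periodic_wp c)
    ((hasDerivAt_weierstrassP L (chart_notMem_lattice p)).const_mul c).hasFDerivAt

theorem hasMFDerivAt_dataG (p : puncturedTorus L) :
    HasMFDerivAt 𝓘(ℂ) 𝓘(ℂ) (dataG L) p
      (ContinuousLinearMap.toSpanSingleton ℂ (wpSecond L (chartAt ℂ p p))) :=
  hasMFDerivAt_descend periodic_wp'
    (hasDerivAt_derivWeierstrassP L (chart_notMem_lattice p)).hasFDerivAt

theorem contDiffAt_wp {z : ℂ} (hz : z ∉ L.lattice) (n : WithTop ℕ∞) : ContDiffAt ℝ n ℘[L] z :=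
  (L.analyticOnNhd_weierstrassP z hz).contDiffAt.restrict_scalars ℝ

theorem contDiffAt_wp' {z : ℂ} (hz : z ∉ L.lattice) (n : WithTop ℕ∞) : ContDiffAt ℝ n ℘'[L] z :=
  (L.analyticOnNhd_derivWeierstrassP z hz).contDiffAt.restrict_scalars ℝ

theorem contMDiff_dataF (c : ℂ) (n : WithTop ℕ∞) : ContMDiff 𝓘(ℝ, ℂ) 𝓘(ℝ, ℂ) n (dataF L c) :=
  fun p => contMDiffAt_descend (periodic_wp c)
    (contDiffAt_const.mul (contDiffAt_wp (chart_notMem_lattice p) n))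

theorem contMDiff_dataG (n : WithTop ℕ∞) : ContMDiff 𝓘(ℝ, ℂ) 𝓘(ℝ, ℂ) n (dataG L) :=
  fun p => contMDiffAt_descend periodic_wp' (contDiffAt_wp' (chart_notMem_lattice p) n)

/-- `J = Re ∫ F dG`. -/
noncomputable def dataJ (L : PeriodPair) (c : ℂ) : puncturedTorus L → ℝ :=
  descend fun z => (c * periodIntegral L z).re

/-- The fundamental theorem of calculus for J ∘ γ. The left side vanishes on closed curves, which is
the period condition. -/
theorem lineIntegral_dataF_dataG {c : ℂ}
    (hJ : LatticePeriodic L fun z => (c * periodIntegral L z).re) {γ : ℝ → puncturedTorus L}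
    (hγ : IsC1Curve γ) :
    dataJ L c (γ 1) - dataJ L c (γ 0) = (lineIntegral (dataF L c) (dataG L) γ).re := by
  have hγG : ContDiffOn ℝ 1 (fun t => dataG L (γ t)) (Set.Icc 0 1) :=
    contMDiffOn_iff_contDiffOn.mp ((contMDiff_dataG 1).comp_contMDiffOn hγ)
  have hγF : ContinuousOn (fun t => dataF L c (γ t)) (Set.Icc 0 1) :=
    (contMDiff_dataF c 1).continuous.comp_continuousOn hγ.continuousOn
  -- At the endpoints `deriv` may take its default value, since γ is only C¹ within [0, 1]. On the
  -- open interval it agrees with the continuous `derivWithin`.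
  have hint : IntervalIntegrable
      (fun t => dataF L c (γ t) * deriv (fun s => dataG L (γ s)) t) MeasureTheory.volume 0 1 := by
    have h1 : ContinuousOn (fun t => dataF L c (γ t) *
        derivWithin (fun s => dataG L (γ s)) (Set.Icc 0 1) t) (Set.Icc 0 1) :=
      hγF.mul (hγG.continuousOn_derivWithin (uniqueDiffOn_Icc zero_lt_one) le_rfl)
    refine (ContinuousOn.intervalIntegrable_of_Icc zero_le_one h1).congr_uIoo ?_
    intro t ht
    rw [Set.uIoo_of_le zero_le_one] at ht
    simp only
    rw [derivWithin_of_mem_nhds (Icc_mem_nhds ht.1 ht.2)]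
  have hJc : ∀ p : puncturedTorus L, HasMFDerivAt 𝓘(ℝ, ℂ) 𝓘(ℝ, ℝ) (dataJ L c) p
      (Complex.reCLM.comp ((ContinuousLinearMap.toSpanSingleton ℂ
        (c * (℘[L] (chartAt ℂ p p) * wpSecond L (chartAt ℂ p p)))).restrictScalars ℝ)) := by
    intro p
    refine hasMFDerivAt_descend hJ ?_
    exact Complex.reCLM.hasFDerivAt.comp _ (((hasDerivAt_periodIntegral L
      (chart_notMem_lattice p)).const_mul c).hasFDerivAt.restrictScalars ℝ)
  have hGc : ∀ p : puncturedTorus L, HasMFDerivAt 𝓘(ℝ, ℂ) 𝓘(ℝ, ℂ) (dataG L) p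
      ((ContinuousLinearMap.toSpanSingleton ℂ (wpSecond L (chartAt ℂ p p))).restrictScalars ℝ) :=
    fun p => hasMFDerivAt_descend periodic_wp'
      ((hasDerivAt_derivWeierstrassP L (chart_notMem_lattice p)).hasFDerivAt.restrictScalars ℝ)
  have hcont : ContinuousOn (fun t => dataJ L c (γ t)) (Set.Icc 0 1) := by
    have : Continuous (dataJ L c) :=
      continuous_iff_continuousAt.mpr fun p => (hJc p).continuousAt
    exact this.comp_continuousOn hγ.continuousOn
  have hderiv : ∀ t ∈ Set.Ioo (0 : ℝ) 1, HasDerivAt (fun t => dataJ L c (γ t))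
      (dataF L c (γ t) * deriv (fun s => dataG L (γ s)) t).re t := by
    intro t ht
    have hγt : MDifferentiableAt 𝓘(ℝ) 𝓘(ℝ, ℂ) γ t :=
      (hγ.contMDiffAt (Icc_mem_nhds ht.1 ht.2)).mdifferentiableAt one_ne_zero
    obtain ⟨D, hD⟩ : ∃ D : ℝ →L[ℝ] ℂ, HasMFDerivAt 𝓘(ℝ) 𝓘(ℝ, ℂ) γ t D := ⟨_, hγt.hasMFDerivAt⟩
    have h1' : HasFDerivAt (dataJ L c ∘ γ) ((Complex.reCLM.comp
        ((ContinuousLinearMap.toSpanSingleton ℂ (c * (℘[L] (chartAt ℂ (γ t) (γ t)) *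
          wpSecond L (chartAt ℂ (γ t) (γ t))))).restrictScalars ℝ)).comp D) t :=
      hasMFDerivAt_iff_hasFDerivAt.mp ((hJc (γ t)).comp t hD)
    have h2' : HasFDerivAt (dataG L ∘ γ) (((ContinuousLinearMap.toSpanSingleton ℂ
        (wpSecond L (chartAt ℂ (γ t) (γ t)))).restrictScalars ℝ).comp D) t :=
      hasMFDerivAt_iff_hasFDerivAt.mp ((hGc (γ t)).comp t hD)
    have h1 := h1'.hasDerivAt
    have h2 := h2'.hasDerivAt
    rw [show (fun s => dataG L (γ s)) = dataG L ∘ γ from rfl, h2.deriv, dataF,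
      descend_eq_chart (periodic_wp c) (chart_mem_atlas ℂ (γ t)) (mem_chart_source ℂ (γ t))]
    refine h1.congr_deriv ?_
    change (D 1 * (c * (℘[L] (chartAt ℂ (γ t) (γ t)) * wpSecond L (chartAt ℂ (γ t) (γ t))))).re =
      (c * ℘[L] (chartAt ℂ (γ t) (γ t)) * (D 1 * wpSecond L (chartAt ℂ (γ t) (γ t)))).re
    congr 1
    ring
  have hre : IntervalIntegrable (fun t => (dataF L c (γ t) * deriv (fun s => dataG L (γ s)) t).re)
      MeasureTheory.volume 0 1 := ⟨hint.1.re, hint.2.re⟩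
  rw [lineIntegral, ← intervalIntegral.integral_eq_sub_of_hasDerivAt_of_le zero_le_one hcont
    hderiv hre]
  exact Complex.reCLM.intervalIntegral_comp_comm hint

theorem isImproperAffineFront_data {c : ℂ} (hc : c ≠ 0)
    (hJ : LatticePeriodic L fun z => (c * periodIntegral L z).re) :
    IsImproperAffineFront (dataF L c) (dataG L) (fun p =>
      (dataG L p + starRingEnd ℂ (dataF L c p),
      (1 / 2) * (‖dataG L p‖ ^ 2 - ‖dataF L c p‖ ^ 2) + (dataG L p * dataF L c p).re
        - 2 * dataJ L c p)) where
  holo_F p := (hasMFDerivAt_dataF c p).mdifferentiableAt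
  holo_G p := (hasMFDerivAt_dataG p).mdifferentiableAt
  regular p := by
    rintro ⟨h1, h2⟩
    rw [(hasMFDerivAt_dataF c p).mfderiv] at h1
    rw [(hasMFDerivAt_dataG p).mfderiv] at h2
    have h1' : (1 : ℂ) * (c * ℘'[L] (chartAt ℂ p p)) = 0 := congrArg (fun f : ℂ →L[ℂ] ℂ => f 1) h1
    have h2' : (1 : ℂ) * wpSecond L (chartAt ℂ p p) = 0 := congrArg (fun f : ℂ →L[ℂ] ℂ => f 1) h2
    rw [one_mul] at h1' h2'
    exact weierstrassP_regular L (chart_notMem_lattice p)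
      ((mul_eq_zero.mp h1').resolve_left hc) h2'
  period γ hγ h := by
    rw [← lineIntegral_dataF_dataG hJ hγ, h, sub_self]
  formula := ⟨dataJ L c, fun γ hγ => lineIntegral_dataF_dataG hJ hγ, fun p => rfl⟩

end Front

end ImproperAffine

namespace ImproperAffine

open scoped PeriodPair
open Filter

/-! ### Smooth metrics on the punctured torus -/

section Metric

variable {L : PeriodPair}

/-- The difference of two chart values of a point is a lattice vector. It varies continuously in a
discrete set, so it is locally constant. -/
theorem eventually_transition_eq {e e' : OpenPartialHomeomorph (puncturedTorus L) ℂ}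
    (he : e ∈ atlas ℂ (puncturedTorus L)) (he' : e' ∈ atlas ℂ (puncturedTorus L)) {z : ℂ}
    (hz : z ∈ e.target) (hz' : e.symm z ∈ e'.source) :
    ∀ᶠ w in 𝓝 z, e' (e.symm w) = w + (e' (e.symm z) - z) := by
  have hcs : ContinuousAt e.symm z := e.continuousAt_symm hz
  have hc : ContinuousAt (fun w => e' (e.symm w) - w) z :=
    ((e'.continuousAt hz').comp hcs).sub continuousAt_id
  have h1 := hc.preimage_mem_nhds
    (L.compl_lattice_sdiff_singleton_mem_nhds (e' (e.symm z) - z))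
  filter_upwards [h1, e.open_target.mem_nhds hz,
    hcs.preimage_mem_nhds (e'.open_source.mem_nhds hz')] with w hw hwt hws
  have hmem : e' (e.symm w) - w ∈ L.lattice := by
    rw [← torusMk_eq_iff, torusMk_chart he' hws, chart_symm_coe he hwt]
  have : e' (e.symm w) - w = e' (e.symm z) - z := by
    by_contra hne
    exact hw ⟨hmem, hne⟩
  rw [← this]; ring

/-- Transition maps are local translations, with derivative the identity. The charts thus trivialize
the tangent bundle consistently, and tensors keep their coefficients from chart to chart. -/
theorem coordChange_eq_id {x y p : puncturedTorus L} (hx : p ∈ (chartAt ℂ x).source)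
    (hy : p ∈ (chartAt ℂ y).source) :
    (tangentBundleCore 𝓘(ℝ, ℂ) (puncturedTorus L)).coordChange (achart ℂ x) (achart ℂ y) p
      = ContinuousLinearMap.id ℝ ℂ := by
  rw [tangentBundleCore_coordChange_achart]
  have h1 := eventually_transition_eq (chart_mem_atlas ℂ x) (chart_mem_atlas ℂ y)
    ((chartAt ℂ x).map_source hx) (by rwa [(chartAt ℂ x).left_inv hx])
  simp only [mfld_simps]
  rw [fderivWithin_univ]
  rw [Filter.EventuallyEq.fderiv_eq (f₁ := ((chartAt ℂ y) ∘ (chartAt ℂ x).symm)) h1]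
  simp

theorem contMDiff_descend_bilin {B : ℂ → ℂ →L[ℝ] ℂ →L[ℝ] ℝ} (hB : LatticePeriodic L B)
    (h : ∀ z ∉ L.lattice, ContDiffAt ℝ ∞ B z) :
    ContMDiff 𝓘(ℝ, ℂ) (𝓘(ℝ, ℂ).prod 𝓘(ℝ, ℂ →L[ℝ] ℂ →L[ℝ] ℝ)) ∞
      (fun p : puncturedTorus L => Bundle.TotalSpace.mk' (ℂ →L[ℝ] ℂ →L[ℝ] ℝ)
        (E := fun p => TangentSpace 𝓘(ℝ, ℂ) p →L[ℝ] TangentSpace 𝓘(ℝ, ℂ) p →L[ℝ] ℝ) p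
        (descend B p)) := by
  intro x
  rw [Bundle.contMDiffAt_section]
  refine (contMDiffAt_descend hB (h _ (chart_notMem_lattice x))).congr_of_eventuallyEq ?_
  filter_upwards [(chartAt ℂ x).open_source.mem_nhds (mem_chart_source ℂ x)] with y hy
  have h1 : (trivializationAt ℂ (TangentSpace 𝓘(ℝ, ℂ)) x).symmL ℝ y
      = ContinuousLinearMap.id ℝ ℂ := by
    rw [TangentBundle.symmL_trivializationAt_eq_core hy]
    exact coordChange_eq_id hy (mem_chart_source ℂ y)
  ext v w
  have hmem : y ∈ (trivializationAt (ℂ →L[ℝ] ℝ)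
      (fun x : puncturedTorus L => TangentSpace 𝓘(ℝ, ℂ) x →L[ℝ] ℝ) x).baseSet := by
    rw [hom_trivializationAt_baseSet]
    exact ⟨hy, trivial⟩
  simp only [hom_trivializationAt_apply, ContinuousLinearMap.inCoordinates, h1,
    ContinuousLinearMap.comp_apply, Bundle.Trivialization.continuousLinearMapAt_apply,
    Bundle.Trivialization.coe_linearMapAt_of_mem _ hmem]
  simp
  rfl

end Metric

end ImproperAffine

namespace ImproperAffine

open scoped PeriodPair
open Filter
open scoped Bundle

/-! ### Completeness -/

section Complete

/-- A metric is complete if some proper map to `ℂ` does not increase lengths. -/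
theorem isCompleteMetric_of_proper {S : Type*} [TopologicalSpace S] [ChartedSpace ℂ S]
    [IsManifold 𝓘(ℂ) ω S] [RegularSpace S]
    (g : Bundle.ContMDiffRiemannianMetric 𝓘(ℝ, ℂ) ∞ ℂ
      (fun p : S => TangentSpace 𝓘(ℝ, ℂ) p)) {X : S → ℂ} (hX : ContMDiff 𝓘(ℝ, ℂ) 𝓘(ℝ, ℂ) 1 X)
    (hg : ∀ (p : S) (v : TangentSpace 𝓘(ℝ, ℂ) p) (w : ℂ),
      w = mfderiv 𝓘(ℝ, ℂ) 𝓘(ℝ, ℂ) X p v → ‖w‖ ^ 2 ≤ g.inner p v v)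
    (hproper : ∀ R : ℝ, IsCompact {p | ‖X p‖ ≤ R}) : IsCompleteMetric g := by
  let : Bundle.RiemannianBundle (fun p : S => TangentSpace 𝓘(ℝ, ℂ) p) :=
    ⟨g.toContinuousRiemannianMetric.toRiemannianMetric⟩
  -- X is 1-Lipschitz for the Riemannian distance, because the image of a curve is no longer than
  -- the curve.
  have hlip : ∀ x y : S, edist (X x) (X y) ≤ Manifold.riemannianEDist 𝓘(ℝ, ℂ) x y := by
    intro x y
    refine le_of_forall_gt fun r hr => ?_
    obtain ⟨γ, rfl, rfl, hγ, hlen⟩ := Manifold.exists_lt_of_riemannianEDist_lt hr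
    refine lt_of_le_of_lt ?_ hlen
    have hXγ : ContDiffOn ℝ 1 (X ∘ γ) (Set.Icc 0 1) :=
      contMDiffOn_iff_contDiffOn.mp (hX.comp_contMDiffOn hγ)
    rw [edist_comm, edist_eq_enorm_sub]
    refine (enorm_sub_le_lintegral_deriv_of_contDiffOn_Icc hXγ zero_le_one).trans ?_
    rw [Manifold.pathELength_eq_lintegral_mfderiv_Icc,
      ← MeasureTheory.restrict_Ioo_eq_restrict_Icc]
    refine MeasureTheory.setLIntegral_mono' measurableSet_Ioo fun t ht => ?_
    have hγt : MDifferentiableAt 𝓘(ℝ) 𝓘(ℝ, ℂ) γ t :=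
      (hγ.contMDiffAt (Icc_mem_nhds ht.1 ht.2)).mdifferentiableAt one_ne_zero
    have hXt : MDifferentiableAt 𝓘(ℝ, ℂ) 𝓘(ℝ, ℂ) X (γ t) := (hX (γ t)).mdifferentiableAt one_ne_zero
    have h1 : deriv (X ∘ γ) t = mfderiv 𝓘(ℝ, ℂ) 𝓘(ℝ, ℂ) X (γ t) (mfderiv 𝓘(ℝ) 𝓘(ℝ, ℂ) γ t 1) := by
      have h2 := mfderiv_comp t hXt hγt
      rw [mfderiv_eq_fderiv] at h2
      exact congrArg (fun f : ℝ →L[ℝ] ℂ => f 1) h2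
    have h3 := hg (γ t) (mfderiv 𝓘(ℝ) 𝓘(ℝ, ℂ) γ t 1) _ h1
    have h4 : ‖deriv (X ∘ γ) t‖ ≤ ‖mfderiv 𝓘(ℝ) 𝓘(ℝ, ℂ) γ t 1‖ := by
      rw [norm_eq_sqrt_real_inner (mfderiv 𝓘(ℝ) 𝓘(ℝ, ℂ) γ t 1)]
      exact Real.le_sqrt_of_sq_le h3
    exact enorm_le_iff_norm_le.mpr h4
  let : PseudoEMetricSpace S := PseudoEMetricSpace.ofRiemannianMetric 𝓘(ℝ, ℂ) S
  change CompleteSpace S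
  refine ⟨fun {f} hf => ?_⟩
  obtain ⟨hne, h⟩ := EMetric.cauchy_iff.mp hf
  obtain ⟨t, htf, ht⟩ := h 1 one_pos
  have : NeBot f := ⟨hne⟩
  obtain ⟨x, hx⟩ := Filter.nonempty_of_mem htf
  -- A member of the Cauchy filter with diameter at most 1 has bounded image under X. Properness
  -- places it in a compact set, where the filter converges.
  have hsub : t ⊆ {p | ‖X p‖ ≤ ‖X x‖ + 1} := by
    intro p hp
    have h1 : edist (X p) (X x) < 1 := lt_of_le_of_lt (hlip p x) (ht p hp x hx)
    rw [edist_dist, ENNReal.ofReal_lt_one, dist_eq_norm] at h1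
    have := norm_sub_norm_le (X p) (X x)
    simp only [Set.mem_ofPred_eq]
    linarith
  obtain ⟨y, -, hy⟩ := (hproper (‖X x‖ + 1)).isComplete f hf
    (le_principal_iff.mpr (mem_of_superset htf hsub))
  exact ⟨y, hy⟩

/-! ### Compact sublevel sets and completeness on the punctured torus -/

variable {L : PeriodPair}

instance compactSpace_torus (L : PeriodPair) : CompactSpace (ComplexTorus L) := by
  have h := IsZLattice.isCompact_range_of_periodic L.lattice (torusMk L)
    (isLocalHomeomorph_torusMk L).continuous (fun z w hw => by
      rw [torusMk_eq_iff]; simpa using hw)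
  rw [(QuotientAddGroup.mk_surjective (s := L.lattice.toAddSubgroup)).range_eq] at h
  exact ⟨h⟩

/-- The torus is compact, so it is enough that the set is closed there. The preimage of its
complement consists of the lattice and {f > R}; it is open at lattice points because f tends to
infinity there. -/
theorem isCompact_descend_le {f : ℂ → ℝ} (hf : LatticePeriodic L f)
    (hc : ContinuousOn f (L.lattice : Set ℂ)ᶜ) (hlim : Tendsto f (𝓝[≠] 0) atTop) (R : ℝ) :
    IsCompact {p : puncturedTorus L | descend f p ≤ R} := by
  rw [Subtype.isCompact_iff]
  refine IsClosed.isCompact ?_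
  have hq : Topology.IsQuotientMap (torusMk L) := QuotientAddGroup.isQuotientMap_mk _
  rw [← hq.isClosed_preimage, ← isOpen_compl_iff]
  have hset : (torusMk L ⁻¹' (Subtype.val '' {p : puncturedTorus L | descend f p ≤ R}))ᶜ
      = {z | z ∈ L.lattice ∨ R < f z} := by
    ext z
    simp only [Set.mem_compl_iff, Set.mem_preimage, Set.mem_image, Set.mem_ofPred_eq]
    constructor
    · intro h
      by_contra hcon
      push Not at hcon
      refine h ⟨⟨torusMk L z, torusMk_mem_punctured.mpr hcon.1⟩, ?_, rfl⟩
      rw [descend_eq hf (z := z) rfl]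
      exact hcon.2
    · rintro h ⟨p, hp, hpz⟩
      have hz : z ∉ L.lattice := by rw [← torusMk_mem_punctured, ← hpz]; exact p.2
      rw [descend_eq hf hpz.symm] at hp
      exact absurd (h.resolve_left hz) (not_lt.mpr hp)
  rw [hset, isOpen_iff_mem_nhds]
  intro z hz
  by_cases hzL : z ∈ L.lattice
  · have h0 : ∀ᶠ w in 𝓝 (0 : ℂ), w ∈ L.lattice ∨ R < f w := by
      have := hlim.eventually_gt_atTop R
      rw [eventually_nhdsWithin_iff] at this
      filter_upwards [this] with w hw
      by_cases hw0 : w = 0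
      · left; rw [hw0]; exact zero_mem _
      · right; exact hw hw0
    have ht : Tendsto (fun w => w - z) (𝓝 z) (𝓝 0) := by
      have : ContinuousAt (fun w => w - z) z := by fun_prop
      simpa [ContinuousAt] using this
    filter_upwards [ht.eventually h0] with w hw
    by_cases hwL : w ∈ L.lattice
    · exact Or.inl hwL
    · have hwz : w - z ∉ L.lattice := fun h => hwL (by simpa using add_mem h hzL)
      have := hf z hzL (w - z) hwz
      rw [sub_add_cancel] at this
      right
      rw [this]
      exact hw.resolve_left hwz
  · have hz' := hz.resolve_left hzL
    have hca := hc.continuousAt ((isOpen_compl_lattice L).mem_nhds hzL)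
    filter_upwards [hca.eventually_const_lt hz'] with w hw using Or.inr hw

/-- The real inner product of `ℂ` as a bilinear map. -/
noncomputable def innerBilin : ℂ →L[ℝ] ℂ →L[ℝ] ℝ := innerSL ℝ

/-- The differential of `X = F̄ + G`. -/
noncomputable def frontDifferential (L : PeriodPair) (c z : ℂ) : ℂ →L[ℝ] ℂ :=
  (Complex.conjCLE : ℂ →L[ℝ] ℂ).comp (ContinuousLinearMap.mul ℝ ℂ (c * ℘'[L] z))
    + ContinuousLinearMap.mul ℝ ℂ (wpSecond L z)

theorem frontDifferential_apply (c z v : ℂ) : frontDifferential L c z v =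
    starRingEnd ℂ (c * ℘'[L] z * v) + wpSecond L z * v := rfl

theorem periodic_wpSecond : LatticePeriodic L (wpSecond L) := fun l hl z _ => by
  rw [wpSecond, show z + l = z + (⟨l, hl⟩ : L.lattice) from rfl, L.weierstrassP_add_coe, wpSecond]

theorem periodic_wp_one : LatticePeriodic L ℘[L] := fun l hl z _ => by
  rw [show z + l = z + (⟨l, hl⟩ : L.lattice) from rfl, L.weierstrassP_add_coe]

theorem periodic_frontX (c : ℂ) :
    LatticePeriodic L fun z => starRingEnd ℂ (c * ℘[L] z) + ℘'[L] z := fun l hl z hz => by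
  simp only [periodic_wp_one l hl z hz, periodic_wp' l hl z hz]

theorem contDiffAt_wpSecond {z : ℂ} (hz : z ∉ L.lattice) (n : WithTop ℕ∞) :
    ContDiffAt ℝ n (wpSecond L) z :=
  (contDiffAt_const.mul ((contDiffAt_wp hz n).pow 2)).sub contDiffAt_const

theorem hasMFDerivAt_frontX (c : ℂ) (p : puncturedTorus L) :
    HasMFDerivAt 𝓘(ℝ, ℂ) 𝓘(ℝ, ℂ) (fun q => starRingEnd ℂ (dataF L c q) + dataG L q) p
      (frontDifferential L c (chartAt ℂ p p)) := by
  refine hasMFDerivAt_descend (periodic_frontX c) ?_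
  have h1 := ((hasDerivAt_weierstrassP L
    (chart_notMem_lattice p)).const_mul c).hasFDerivAt.restrictScalars ℝ
  have h2 := (hasDerivAt_derivWeierstrassP L
    (chart_notMem_lattice p)).hasFDerivAt.restrictScalars ℝ
  have h3 := ((Complex.conjCLE : ℂ →L[ℝ] ℂ).hasFDerivAt.comp _ h1).add h2
  refine h3.congr_fderiv ?_
  ext v
  simp [frontDifferential_apply, wpSecond]
  ring

theorem flatForm_data (c : ℂ) (p : puncturedTorus L) (v w : ℂ) :
    flatForm (dataF L c) (dataG L) p v w = inner ℝ
      (frontDifferential L c (chartAt ℂ p p) v) (frontDifferential L c (chartAt ℂ p p) w) := by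
  have hd : ∀ u : ℂ, dX (dataF L c) (dataG L) p u = frontDifferential L c (chartAt ℂ p p) u :=
    fun u => congrArg (fun f : ℂ →L[ℝ] ℂ => f u) (hasMFDerivAt_frontX c p).mfderiv
  exact congrArg₂ (fun a b : ℂ => inner ℝ a b) (hd v) (hd w)

/-- To be read with x = ℘(z), a = g₂, b = g₃ and k = |c|²: |℘''|² grows like |x|⁴ and |c ℘'|² only
like |x|³, so G' dominates F' near the puncture. -/
theorem exists_growth (k : ℝ) (hk : 0 ≤ k) (a b : ℂ) : ∃ N : ℝ, ∀ x : ℂ, N ≤ ‖x‖ →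
    k * ‖4 * x ^ 3 - a * x - b‖ < ‖6 * x ^ 2 - a / 2‖ ^ 2 := by
  refine ⟨1 + ‖a‖ + k * (4 + ‖a‖ + ‖b‖), fun x hx => ?_⟩
  have ha := norm_nonneg a
  have hb := norm_nonneg b
  have hm : 0 ≤ k * (4 + ‖a‖ + ‖b‖) := by positivity
  have hR : 1 ≤ ‖x‖ := by linarith
  set R := ‖x‖ with hRdef
  have h1 : ‖4 * x ^ 3 - a * x - b‖ ≤ (4 + ‖a‖ + ‖b‖) * R ^ 3 := by
    calc ‖4 * x ^ 3 - a * x - b‖ ≤ ‖4 * x ^ 3‖ + ‖a * x‖ + ‖b‖ :=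
          (norm_sub_le _ _).trans (by gcongr; exact norm_sub_le _ _)
      _ = 4 * R ^ 3 + ‖a‖ * R + ‖b‖ * 1 := by simp [hRdef]
      _ ≤ 4 * R ^ 3 + ‖a‖ * R ^ 3 + ‖b‖ * R ^ 3 := by
        gcongr
        · exact le_self_pow₀ hR (by norm_num)
        · exact one_le_pow₀ hR
      _ = _ := by ring
  have h2 : R ^ 2 ≤ ‖6 * x ^ 2 - a / 2‖ := by
    have h3 := norm_sub_norm_le (6 * x ^ 2) (a / 2)
    have h4 : ‖6 * x ^ 2‖ = 6 * R ^ 2 := by simp [hRdef]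
    have h5 : ‖a / 2‖ = ‖a‖ / 2 := by simp
    rw [h4, h5] at h3
    have : R ≤ R ^ 2 := le_self_pow₀ hR (by norm_num)
    linarith
  calc k * ‖4 * x ^ 3 - a * x - b‖ ≤ k * ((4 + ‖a‖ + ‖b‖) * R ^ 3) := by gcongr
    _ = (k * (4 + ‖a‖ + ‖b‖)) * R ^ 3 := by ring
    _ < R * R ^ 3 := by
      gcongr
      linarith
    _ = (R ^ 2) ^ 2 := by ring
    _ ≤ _ := by gcongr

/-- Compactness of the unit circle. The bound makes the unit balls of the metric bounded in each
tangent space. -/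
theorem exists_lower_bound_of_pos (B : ℂ →L[ℝ] ℂ →L[ℝ] ℝ) (hB : ∀ v, v ≠ 0 → 0 < B v v) :
    ∃ m > 0, ∀ v, m * ‖v‖ ^ 2 ≤ B v v := by
  have hc : Continuous fun v => B v v := by fun_prop
  obtain ⟨u, hu, hmin⟩ := (isCompact_sphere (0 : ℂ) 1).exists_isMinOn
    (NormedSpace.sphere_nonempty.mpr zero_le_one) hc.continuousOn
  have hu0 : u ≠ 0 := by rintro rfl; simp at hu
  refine ⟨B u u, hB u hu0, fun v => ?_⟩
  by_cases hv : v = 0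
  · simp [hv]
  · have hv' : ‖v‖ ≠ 0 := norm_ne_zero_iff.mpr hv
    have h1 : (‖v‖⁻¹ • v) ∈ Metric.sphere (0 : ℂ) 1 := by
      simp [hv']
    have h2 := hmin h1
    simp only [Set.mem_ofPred_eq, map_smul, smul_apply, smul_eq_mul] at h2
    calc B u u * ‖v‖ ^ 2 ≤ ‖v‖⁻¹ * (‖v‖⁻¹ * B v v) * ‖v‖ ^ 2 := by gcongr
      _ = B v v := by field_simp

/-- The Riemannian metric on the punctured torus induced by a periodic family of scalar
products. -/
noncomputable def metricOfBilin {B : ℂ → ℂ →L[ℝ] ℂ →L[ℝ] ℝ} (hB : LatticePeriodic L B)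
    (hsm : ∀ z ∉ L.lattice, ContDiffAt ℝ ∞ B z) (hsymm : ∀ z v w, B z v w = B z w v)
    (hpos : ∀ z ∉ L.lattice, ∀ v, v ≠ 0 → 0 < B z v v) :
    Bundle.ContMDiffRiemannianMetric 𝓘(ℝ, ℂ) ∞ ℂ
      (fun p : puncturedTorus L => TangentSpace 𝓘(ℝ, ℂ) p) where
  inner p := descend B p
  symm p v w := hsymm _ (v : ℂ) w
  pos p v hv := by
    have h := hpos _ (chart_notMem_lattice p) v hv
    rw [← descend_eq_chart hB (chart_mem_atlas ℂ p) (mem_chart_source ℂ p)] at h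
    exact h
  isVonNBounded p := by
    change Bornology.IsVonNBounded ℝ {v : ℂ | descend B p v v < 1}
    rw [descend_eq_chart hB (chart_mem_atlas ℂ p) (mem_chart_source ℂ p)]
    obtain ⟨m, hm, hmv⟩ := exists_lower_bound_of_pos _ (hpos _ (chart_notMem_lattice p))
    refine (NormedSpace.isVonNBounded_closedBall ℝ ℂ (1 + m⁻¹)).subset fun v hv => ?_
    rw [mem_closedBall_zero_iff]
    have h1 : m * ‖v‖ ^ 2 < 1 := lt_of_le_of_lt (hmv v) hv
    have h2 : ‖v‖ ^ 2 < m⁻¹ := by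
      rw [inv_eq_one_div, lt_div_iff₀ hm]; linarith
    nlinarith [norm_nonneg v]
  contMDiff := contMDiff_descend_bilin hB hsm

/-- The triple pole of ℘' wins over the double pole of c ℘. This is the properness of X. -/
theorem tendsto_norm_frontX (c : ℂ) :
    Tendsto (fun z => ‖starRingEnd ℂ (c * ℘[L] z) + ℘'[L] z‖) (𝓝[≠] 0) atTop := by
  have h1 : Tendsto (fun z : ℂ => ‖z ^ 3 * ℘'[L] z‖ - ‖c * z * (z ^ 2 * ℘[L] z)‖) (𝓝[≠] 0) (𝓝 2) := by
    have hz : Tendsto (fun z : ℂ => c * z) (𝓝[≠] 0) (𝓝 0) := by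
      have : Continuous fun z : ℂ => c * z := by fun_prop
      simpa using (this.tendsto 0).mono_left nhdsWithin_le_nhds
    simpa using (tendsto_derivWeierstrassP_zero L).norm.sub
      (hz.mul (tendsto_weierstrassP_zero L)).norm
  have h2 : Tendsto (fun z : ℂ => ‖z‖⁻¹ ^ 3) (𝓝[≠] 0) atTop :=
    (tendsto_pow_atTop three_ne_zero).comp (tendsto_norm_nhdsNE_zero.inv_tendsto_nhdsGT_zero)
  refine tendsto_atTop_mono' _ ?_ (h1.pos_mul_atTop two_pos h2)
  filter_upwards [self_mem_nhdsWithin] with z hz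
  have hz' : ‖z‖ ≠ 0 := by simpa using hz
  have h3 : ‖℘'[L] z‖ - ‖c * ℘[L] z‖ ≤ ‖starRingEnd ℂ (c * ℘[L] z) + ℘'[L] z‖ := by
    have := norm_sub_norm_le (℘'[L] z) (-starRingEnd ℂ (c * ℘[L] z))
    rwa [sub_neg_eq_add, norm_neg, RCLike.norm_conj, add_comm (℘'[L] z)] at this
  refine le_trans (le_of_eq ?_) h3
  simp only [norm_mul, norm_pow]
  field_simp

/-- A real multiple of a bilinear map. -/
noncomputable def scaleBilin {E G : Type*} [NormedAddCommGroup E] [NormedSpace ℝ E]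
    [NormedAddCommGroup G] [NormedSpace ℝ G]
    (b : E →L[ℝ] E →L[ℝ] G) (t : ℝ) : E →L[ℝ] E →L[ℝ] G := t • b

theorem scaleBilin_zero {E G : Type*} [NormedAddCommGroup E] [NormedSpace ℝ E]
    [NormedAddCommGroup G] [NormedSpace ℝ G]
    (b : E →L[ℝ] E →L[ℝ] G) : scaleBilin b 0 = 0 := zero_smul ℝ b

/-- The pull-back of a bilinear map by a linear map. -/
noncomputable def pullBilin {E G : Type*} [NormedAddCommGroup E] [NormedSpace ℝ E]
    [NormedAddCommGroup G] [NormedSpace ℝ G]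
    (b : E →L[ℝ] E →L[ℝ] G) (A : E →L[ℝ] E) : E →L[ℝ] E →L[ℝ] G :=
  ((b.comp A).flip.comp A).flip

theorem contDiffAt_smul_vector {V W : Type*} [NormedAddCommGroup V] [NormedSpace ℝ V]
    [NormedAddCommGroup W] [NormedSpace ℝ W] (b : W) {χ : V → ℝ} {n : WithTop ℕ∞} {z : V}
    (hχ : ContDiffAt ℝ n χ z) : ContDiffAt ℝ n (fun z => χ z • b) z :=
  hχ.smul contDiffAt_const

theorem contDiff_flip {E G : Type*} [NormedAddCommGroup E] [NormedSpace ℝ E]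
    [NormedAddCommGroup G] [NormedSpace ℝ G] {n : WithTop ℕ∞} :
    ContDiff ℝ n (fun f : E →L[ℝ] E →L[ℝ] G => f.flip) :=
  IsBoundedLinearMap.contDiff ⟨⟨fun _ _ => rfl, fun _ _ => rfl⟩, 1, one_pos, fun f => by simp⟩

theorem contDiffAt_scaleBilin_add_pullBilin {V E G : Type*}
    [NormedAddCommGroup V] [NormedSpace ℝ V] [NormedAddCommGroup E] [NormedSpace ℝ E]
    [NormedAddCommGroup G] [NormedSpace ℝ G] (b : E →L[ℝ] E →L[ℝ] G) {χ : V → ℝ}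
    {A : V → E →L[ℝ] E} {n : WithTop ℕ∞} {z : V} (hχ : ContDiffAt ℝ n χ z)
    (hA : ContDiffAt ℝ n A z) :
    ContDiffAt ℝ n (fun z => scaleBilin b (χ z) + pullBilin b (A z)) z := by
  refine ContDiffAt.add (contDiffAt_smul_vector b hχ) ?_
  exact contDiff_flip.contDiffAt.comp z
    ((contDiff_flip.contDiffAt.comp z (contDiffAt_const.clm_comp hA)).clm_comp hA)

/-- The correction T is a cutoff function of |℘|² times the Euclidean form. It is positive wherever
dX may degenerate and vanishes near the puncture, where dX is injective. -/
theorem isCompleteFront_data (c : ℂ) : IsCompleteFront (dataF L c) (dataG L) := by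
  obtain ⟨N, hN⟩ := exists_growth (‖c‖ ^ 2) (by positivity) L.g₂ L.g₃
  -- Truncating N at 0 before squaring ensures that |℘|² ≥ M implies |℘| ≥ N.
  set M := max N 0 ^ 2 with hM
  have hpos : ∀ z ∉ L.lattice, M ≤ ‖℘[L] z‖ ^ 2 → ‖c * ℘'[L] z‖ < ‖wpSecond L z‖ := by
    intro z hz hMz
    have h1 : N ≤ ‖℘[L] z‖ :=
      (le_max_left _ _).trans (abs_le_of_sq_le_sq' hMz (norm_nonneg _)).2
    have h2 := hN _ h1
    rw [← L.derivWeierstrassP_sq z hz, norm_pow, ← mul_pow, ← norm_mul] at h2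
    exact lt_of_pow_lt_pow_left₀ 2 (norm_nonneg _) h2
  set χ : ℂ → ℝ := fun z => Real.smoothTransition (M - ‖℘[L] z‖ ^ 2) with hχ
  have hχper : LatticePeriodic L χ := fun l hl z hz => by
    simp only [hχ, periodic_wp_one l hl z hz]
  have hχsm : ∀ z ∉ L.lattice, ContDiffAt ℝ ∞ χ z := fun z hz =>
    Real.smoothTransition.contDiffAt.comp z
      (contDiffAt_const.sub ((contDiffAt_wp hz ∞).norm_sq ℝ))
  have hPper : LatticePeriodic L fun z => ‖℘[L] z‖ ^ 2 := fun l hl z hz => by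
    simp only [periodic_wp_one l hl z hz]
  set T : ℂ → ℂ →L[ℝ] ℂ →L[ℝ] ℝ := fun z => scaleBilin innerBilin (χ z) with hT
  have hTper : LatticePeriodic L T := fun l hl z hz => by simp only [hT, hχper l hl z hz]
  set B : ℂ → ℂ →L[ℝ] ℂ →L[ℝ] ℝ := fun z => T z +
    pullBilin innerBilin (frontDifferential L c z) with hB
  have hBapp : ∀ z v w, B z v w = χ z * inner ℝ v w
      + inner ℝ (frontDifferential L c z v) (frontDifferential L c z w) := fun z v w => rfl
  have hDper : LatticePeriodic L (frontDifferential L c) := fun l hl z hz => by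
    simp only [frontDifferential, periodic_wp' l hl z hz, periodic_wpSecond l hl z hz]
  have hBper : LatticePeriodic L B := fun l hl z hz => by
    simp only [hB, hTper l hl z hz, hDper l hl z hz]
  have hDsm : ∀ z ∉ L.lattice, ContDiffAt ℝ ∞ (frontDifferential L c) z := by
    intro z hz
    refine ContDiffAt.add (contDiffAt_const.clm_comp ?_) ?_
    · exact (ContinuousLinearMap.mul ℝ ℂ).contDiff.contDiffAt.comp z
        (contDiffAt_const.mul (contDiffAt_wp' hz ∞))
    · exact (ContinuousLinearMap.mul ℝ ℂ).contDiff.contDiffAt.comp z (contDiffAt_wpSecond hz ∞)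
  have hBsm : ∀ z ∉ L.lattice, ContDiffAt ℝ ∞ B z := by
    intro z hz
    exact contDiffAt_scaleBilin_add_pullBilin innerBilin (hχsm z hz) (hDsm z hz)
  have hBpos : ∀ z ∉ L.lattice, ∀ v, v ≠ 0 → 0 < B z v v := by
    intro z hz v hv
    rw [hBapp]
    have h0 : 0 ≤ χ z := Real.smoothTransition.nonneg _
    rcases lt_or_ge (‖℘[L] z‖ ^ 2) M with h | h
    · have h1 : 0 < χ z := Real.smoothTransition.pos_of_pos (sub_pos.mpr h)
      have h2 : 0 < inner ℝ v v := real_inner_self_pos.mpr hv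
      have h3 : 0 ≤ inner ℝ (frontDifferential L c z v) (frontDifferential L c z v) :=
        real_inner_self_nonneg
      positivity
    -- Here |℘''| > |c ℘'|, so the complex linear part of dX cannot cancel the antilinear part.
    · have h1 : frontDifferential L c z v ≠ 0 := by
        intro h0
        rw [frontDifferential_apply] at h0
        have h2 : ‖c * ℘'[L] z * v‖ = ‖wpSecond L z * v‖ := by
          rw [← RCLike.norm_conj (c * ℘'[L] z * v), eq_neg_of_add_eq_zero_left h0, norm_neg]
        rw [norm_mul, norm_mul (wpSecond L z)] at h2
        exact (hpos z hz h).ne (mul_right_cancel₀ (norm_ne_zero_iff.mpr hv) h2)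
      have h2 : 0 < inner ℝ (frontDifferential L c z v) (frontDifferential L c z v) :=
        real_inner_self_pos.mpr h1
      have h3 : 0 ≤ inner ℝ v v := real_inner_self_nonneg
      positivity
  have hBsymm : ∀ z v w, B z v w = B z w v := fun z v w => by
    rw [hBapp, hBapp, real_inner_comm, real_inner_comm (frontDifferential L c z v)]
  let g := metricOfBilin hBper hBsm hBsymm hBpos
  have hginner : ∀ (p : puncturedTorus L) (v w : ℂ), g.inner p v w
      = descend T p v w + flatForm (dataF L c) (dataG L) p v w := by
    intro p v w
    change descend B p v w = _
    rw [flatForm_data, descend_eq_chart hBper (chart_mem_atlas ℂ p) (mem_chart_source ℂ p),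
      descend_eq_chart hTper (chart_mem_atlas ℂ p) (mem_chart_source ℂ p)]
    rfl
  have hTapp : ∀ (p : puncturedTorus L) (v w : ℂ), descend T p v w
      = χ (chartAt ℂ p p) * inner ℝ v w := by
    intro p v w
    rw [descend_eq_chart hTper (chart_mem_atlas ℂ p) (mem_chart_source ℂ p)]
    rfl
  refine ⟨fun p => descend T p, ?_, ⟨{p | descend (fun z => ‖℘[L] z‖ ^ 2) p ≤ M}, ?_, ?_⟩,
    g, hginner, ?_⟩
  · intro p v w
    have key : ∀ v w : ℂ, descend T p v w = descend T p w v := fun v w => by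
      rw [hTapp, hTapp, real_inner_comm]
    exact key v w
  · refine isCompact_descend_le hPper
      (L.differentiableOn_weierstrassP.continuousOn.norm.pow 2)
      ((tendsto_pow_atTop two_ne_zero).comp (tendsto_norm_weierstrassP_zero L)) M
  · intro p hp
    have h1 : ¬ ‖℘[L] (chartAt ℂ p p)‖ ^ 2 ≤ M := by
      intro h
      refine hp ?_
      rw [Set.mem_ofPred_eq, descend_eq_chart hPper (chart_mem_atlas ℂ p) (mem_chart_source ℂ p)]
      exact h
    have h2 : χ (chartAt ℂ p p) = 0 :=
      Real.smoothTransition.zero_of_nonpos (sub_nonpos.mpr (not_le.mp h1).le)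
    have h3 : descend T p = (0 : ℂ →L[ℝ] ℂ →L[ℝ] ℝ) := by
      rw [descend_eq_chart hTper (chart_mem_atlas ℂ p) (mem_chart_source ℂ p), hT]
      simp only [h2, scaleBilin_zero]
    exact h3
  · refine isCompleteMetric_of_proper g (X := fun q => starRingEnd ℂ (dataF L c q) + dataG L q)
      ?_ ?_ ?_
    · intro p
      refine contMDiffAt_descend (periodic_frontX c) ?_
      exact (Complex.conjCLE.contDiff.contDiffAt.comp _ (contDiffAt_const.mul
        (contDiffAt_wp (chart_notMem_lattice p) 1))).add (contDiffAt_wp' (chart_notMem_lattice p) 1)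
    · have key : ∀ (p : puncturedTorus L) (v w : ℂ), w = frontDifferential L c (chartAt ℂ p p) v →
          ‖w‖ ^ 2 ≤ descend B p v v := by
        rintro p v w rfl
        rw [descend_eq_chart hBper (chart_mem_atlas ℂ p) (mem_chart_source ℂ p), hBapp,
          real_inner_self_eq_norm_sq (frontDifferential L c (chartAt ℂ p p) v)]
        exact le_add_of_nonneg_left
          (mul_nonneg (Real.smoothTransition.nonneg _) real_inner_self_nonneg)
      exact fun p v w hw => key p v w
        (Eq.trans (α := ℂ) hw (congrArg (fun f : ℂ →L[ℝ] ℂ => f v) (hasMFDerivAt_frontX c p).mfderiv))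
    · intro R
      have h1 := isCompact_descend_le (f := fun z => ‖starRingEnd ℂ (c * ℘[L] z) + ℘'[L] z‖)
        (fun l hl z hz => by simp only [periodic_wp_one l hl z hz, periodic_wp' l hl z hz])
        ((Complex.continuous_conj.comp_continuousOn (continuousOn_const.mul
          L.differentiableOn_weierstrassP.continuousOn)).add
          L.differentiableOn_derivWeierstrassP.continuousOn).norm (tendsto_norm_frontX c) R
      exact h1

end Complete

end ImproperAffine

namespace ImproperAffine

open scoped PeriodPair
open Filter

/-! ### The genus of the torus -/

section Genus

/-- The plane is a simply connected covering with the lattice as deck group. The fundamental group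
is thus the opposite of the lattice, already abelian and of rank 2. -/
theorem hasGenus_torus (L : PeriodPair) : HasGenus (ComplexTorus L) 1 := by
  refine ⟨inferInstance, Function.Surjective.connectedSpace QuotientAddGroup.mk_surjective
    continuous_quotient_mk', fun x => ?_⟩
  obtain ⟨z, hz⟩ := QuotientAddGroup.mk_surjective (s := L.lattice.toAddSubgroup) x
  let e₁ := (isAddQuotientCoveringMap_torusMk L).fundamentalGroupEquiv (x := x) ⟨z, hz⟩
  let e₂ : Abelianization (FundamentalGroup (ComplexTorus L) x) ≃*
      Multiplicative L.lattice.toAddSubgroup :=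
    (e₁.trans MulOpposite.opMulEquiv.symm).abelianizationCongr.trans
      Abelianization.equivOfComm.symm
  let e₃ : Additive (Abelianization (FundamentalGroup (ComplexTorus L) x)) ≃+ L.lattice :=
    MulEquiv.toAdditiveLeft e₂
  rw [e₃.toIntLinearEquiv.rank_eq, ← Module.finrank_eq_rank, L.finrank_lattice]
  simp

end Genus

end ImproperAffine

namespace ImproperAffine

open scoped PeriodPair
open Filter
open MeasureTheory
open scoped Pointwise

/-! ### Integrals of periodic functions over a fundamental domain -/

section Periodic

/-- The fundamental parallelogram of the lattice. -/
noncomputable def fundDomain (L : PeriodPair) : Set ℂ := ZSpan.fundamentalDomain L.basis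

variable {L : PeriodPair}

theorem isAddFundamentalDomain_fundDomain :
    IsAddFundamentalDomain L.lattice (fundDomain L) volume := by
  rw [L.lattice_eq_span_range_basis]
  exact ZSpan.isAddFundamentalDomain L.basis volume

instance : VAddInvariantMeasure L.lattice ℂ volume :=
  ⟨fun l s _ => measure_preimage_add volume (l : ℂ) s⟩

theorem isBounded_fundDomain : Bornology.IsBounded (fundDomain L) :=
  ZSpan.fundamentalDomain_isBounded L.basis

theorem exists_sub_mem_fundDomain (z : ℂ) : ∃ l ∈ L.lattice, z - l ∈ fundDomain L := by
  refine ⟨ZSpan.floor L.basis z, ?_, ZSpan.fract_mem_fundamentalDomain L.basis z⟩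
  rw [L.lattice_eq_span_range_basis]
  exact (ZSpan.floor L.basis z).2

theorem exists_bound_of_periodic {E : Type*} [SeminormedAddCommGroup E] {g : ℂ → E}
    (hg : ∀ l ∈ L.lattice, ∀ z, g (z + l) = g z) (hc : Continuous g) : ∃ C, ∀ z, ‖g z‖ ≤ C := by
  obtain ⟨r, hr⟩ := (isBounded_fundDomain (L := L)).subset_closedBall 0
  obtain ⟨C, hC⟩ := (isCompact_closedBall (0 : ℂ) r).exists_bound_of_continuousOn hc.continuousOn
  refine ⟨C, fun z => ?_⟩
  obtain ⟨l, hl, hz⟩ := exists_sub_mem_fundDomain (L := L) z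
  have := hg l hl (z - l)
  rw [sub_add_cancel] at this
  rw [this]
  exact hC _ (hr hz)

theorem volume_fundDomain_lt_top : volume (fundDomain L) < ⊤ :=
  isBounded_fundDomain.measure_lt_top

theorem integrableOn_fundDomain_of_periodic {E : Type*} [NormedAddCommGroup E]
    {g : ℂ → E} (hg : ∀ l ∈ L.lattice, ∀ z, g (z + l) = g z) (hc : Continuous g) :
    IntegrableOn g (fundDomain L) := by
  obtain ⟨C, hC⟩ := exists_bound_of_periodic hg hc
  exact IntegrableOn.of_bound volume_fundDomain_lt_top hc.aestronglyMeasurable C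
    (Eventually.of_forall hC)

/-- A translate of a fundamental domain is again a fundamental domain, and a periodic function has
the same integral over both. -/
theorem setIntegral_fundDomain_translate {g : ℂ → ℝ}
    (hg : ∀ l ∈ L.lattice, ∀ z, g (z + l) = g z) (a : ℂ) :
    ∫ z in fundDomain L, g (z + a) = ∫ z in fundDomain L, g z := by
  have h1 : IsAddFundamentalDomain L.lattice (a +ᵥ fundDomain L) volume :=
    isAddFundamentalDomain_fundDomain.vadd_of_comm a
  rw [isAddFundamentalDomain_fundDomain.setIntegral_eq h1 (f := g)
    (fun l x => by rw [Submodule.vadd_def, vadd_eq_add, add_comm]; exact hg l l.2 x)]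
  have h2 := (measurePreserving_vadd a (volume : Measure ℂ)).setIntegral_image_emb
    (measurableEmbedding_const_vadd a) g (fundDomain L)
  rw [Set.image_vadd] at h2
  rw [h2]
  simp only [vadd_eq_add, add_comm]

theorem periodic_fderiv {g : ℂ → ℝ} (hg : ∀ l ∈ L.lattice, ∀ z, g (z + l) = g z) :
    ∀ l ∈ L.lattice, ∀ z, fderiv ℝ g (z + l) = fderiv ℝ g z := fun l hl z => by
  rw [← fderiv_comp_add_right]
  congr 1
  exact funext (hg l hl)

/-- The integral of g(z + t v) over a period cell does not depend on t; differentiate under the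
integral at t = 0. This takes the place of Stokes' theorem. -/
theorem setIntegral_fderiv_eq_zero {g : ℂ → ℝ} (hg : ∀ l ∈ L.lattice, ∀ z, g (z + l) = g z)
    (hd : ContDiff ℝ 1 g) (v : ℂ) : ∫ z in fundDomain L, fderiv ℝ g z v = 0 := by
  have hc : Continuous fun z => fderiv ℝ g z v :=
    (hd.continuous_fderiv one_ne_zero).clm_apply continuous_const
  obtain ⟨C, hC⟩ := exists_bound_of_periodic (L := L) (g := fun z => fderiv ℝ g z v)
    (fun l hl z => by simp only [periodic_fderiv hg l hl z]) hc
  have h1 := (hasDerivAt_integral_of_dominated_loc_of_deriv_le (𝕜 := ℝ)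
    (μ := volume.restrict (fundDomain L)) (s := Set.univ) (x₀ := 0) (bound := fun _ => C)
    (F := fun t z => g (z + t * v)) (F' := fun t z => fderiv ℝ g (z + t * v) v) univ_mem
    (Eventually.of_forall fun t => (hd.continuous.comp (by fun_prop)).aestronglyMeasurable)
    (by simpa [IntegrableOn] using! integrableOn_fundDomain_of_periodic hg hd.continuous)
    (by simpa using hc.aestronglyMeasurable)
    (Eventually.of_forall fun z t _ => hC _)
    (integrableOn_const volume_fundDomain_lt_top.ne)
    (Eventually.of_forall fun z t _ => by
      have h2 : HasDerivAt (fun t : ℝ => z + t * v) v t := by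
        simpa using ((Complex.ofRealCLM.hasDerivAt (x := t)).mul_const v).const_add z
      exact ((hd.differentiable one_ne_zero _).hasFDerivAt).comp_hasDerivAt t h2)).2
  have h3 : (fun t : ℝ => ∫ z in fundDomain L, g (z + t * v))
      = fun _ => ∫ z in fundDomain L, g z :=
    funext fun t => setIntegral_fundDomain_translate hg _
  rw [h3] at h1
  simpa using (h1.unique (hasDerivAt_const _ _))

theorem laplacian_eq_fderiv {u : ℂ → ℝ} {z : ℂ} (hu : ContDiffAt ℝ 2 u z) :
    Laplacian.laplacian u z = fderiv ℝ (fun w => fderiv ℝ u w 1) z 1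
      + fderiv ℝ (fun w => fderiv ℝ u w Complex.I) z Complex.I := by
  have hd : DifferentiableAt ℝ (fderiv ℝ u) z :=
    (hu.fderiv_right (m := 1) (by norm_num)).differentiableAt one_ne_zero
  rw [InnerProductSpace.laplacian_eq_iteratedFDeriv_complexPlane]
  simp only [iteratedFDeriv_two_apply]
  rw [fderiv_clm_apply hd (differentiableAt_const _), fderiv_clm_apply hd (differentiableAt_const _)]
  simp

theorem continuous_laplacian {u : ℂ → ℝ} (hu : ContDiff ℝ 2 u) :
    Continuous (Laplacian.laplacian u) := by
  have h1 : ∀ v : ℂ, Continuous fun z => fderiv ℝ (fun w => fderiv ℝ u w v) z v := fun v =>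
    (((hu.fderiv_right (m := 1) (by norm_num)).clm_apply contDiff_const).continuous_fderiv
      one_ne_zero).clm_apply continuous_const
  refine ((h1 1).add (h1 Complex.I)).congr fun z => ?_
  rw [laplacian_eq_fderiv hu.contDiffAt]
  rfl

theorem periodic_laplacian {u : ℂ → ℝ} (hu : ContDiff ℝ 2 u)
    (hp : ∀ l ∈ L.lattice, ∀ z, u (z + l) = u z) :
    ∀ l ∈ L.lattice, ∀ z, Laplacian.laplacian u (z + l) = Laplacian.laplacian u z := by
  intro l hl z
  rw [laplacian_eq_fderiv hu.contDiffAt, laplacian_eq_fderiv hu.contDiffAt,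
    periodic_fderiv (fun l hl z => by rw [periodic_fderiv hp l hl z]) l hl,
    periodic_fderiv (fun l hl z => by rw [periodic_fderiv hp l hl z]) l hl]

theorem setIntegral_laplacian_eq_zero {u : ℂ → ℝ} (hu : ContDiff ℝ 2 u)
    (hp : ∀ l ∈ L.lattice, ∀ z, u (z + l) = u z) :
    ∫ z in fundDomain L, Laplacian.laplacian u z = 0 := by
  have h1 : ∀ v : ℂ, ContDiff ℝ 1 fun w => fderiv ℝ u w v := fun v =>
    (hu.fderiv_right (m := 1) (by norm_num)).clm_apply contDiff_const
  have h2 : ∀ v : ℂ, ∀ l ∈ L.lattice, ∀ z, fderiv ℝ u (z + l) v = fderiv ℝ u z v :=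
    fun v l hl z => by rw [periodic_fderiv hp l hl z]
  have h3 : ∀ v : ℂ, IntegrableOn (fun z => fderiv ℝ (fun w => fderiv ℝ u w v) z v)
      (fundDomain L) := fun v =>
    integrableOn_fundDomain_of_periodic
      (fun l hl z => by rw [periodic_fderiv (h2 v) l hl z])
      (((h1 v).continuous_fderiv one_ne_zero).clm_apply continuous_const)
  simp_rw [laplacian_eq_fderiv hu.contDiffAt]
  rw [integral_add (h3 1) (h3 Complex.I), setIntegral_fderiv_eq_zero (h2 1) (h1 1),
    setIntegral_fderiv_eq_zero (h2 _) (h1 _), add_zero]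

/-- Unfolding: the integral over the plane is the integral over a fundamental domain of the sum
over all lattice translates. -/
theorem setIntegral_tsum_translate {f : ℂ → ℝ} (hf : Integrable f) :
    ∫ z in fundDomain L, ∑' l : L.lattice, f (z + l) = ∫ z, f z := by
  have hvadd : ∀ (l : L.lattice) (z : ℂ), l +ᵥ z = z + l := fun l z => by
    rw [Submodule.vadd_def, vadd_eq_add, add_comm]
  have h1 := (isAddFundamentalDomain_fundDomain (L := L)).integral_eq_tsum'' f hf
  have h2 := (isAddFundamentalDomain_fundDomain (L := L)).lintegral_eq_tsum'' fun z => ‖f z‖ₑ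
  simp only [hvadd] at h1 h2
  rw [h1, integral_tsum]
  · exact fun l => ((measurePreserving_add_right volume (l : ℂ)).integrable_comp_of_integrable
      hf).aestronglyMeasurable.restrict
  · rw [← h2]
    exact hf.2.ne

end Periodic

end ImproperAffine

namespace ImproperAffine

open scoped PeriodPair
open Filter
open MeasureTheory

/-! ### A compactly supported function with a logarithmic pole -/

section LogBump

/-- Here f₁ = f' and f₂ is the value of f''. With s = |z|² the right side is 4 (s f')'(s), the
derivative of a flux. -/
theorem laplacian_radial {f f₁ : ℝ → ℝ} {f₂ : ℝ} {z : ℂ}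
    (hf : ∀ᶠ t in 𝓝 (‖z‖ ^ 2), HasDerivAt f (f₁ t) t) (hf₁ : HasDerivAt f₁ f₂ (‖z‖ ^ 2))
    (hc : ContDiffAt ℝ 2 f (‖z‖ ^ 2)) :
    Laplacian.laplacian (fun w : ℂ => f (‖w‖ ^ 2)) z = 4 * (‖z‖ ^ 2 * f₂ + f₁ (‖z‖ ^ 2)) := by
  have hN : ∀ w : ℂ, HasFDerivAt (fun w : ℂ => ‖w‖ ^ 2) (2 • innerSL ℝ w) w := fun w =>
    (hasStrictFDerivAt_norm_sq w).hasFDerivAt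
  have hNc : ContinuousAt (fun w : ℂ => ‖w‖ ^ 2) z := by fun_prop
  have h1 : ∀ v : ℂ, (fun w => fderiv ℝ (fun w : ℂ => f (‖w‖ ^ 2)) w v)
      =ᶠ[𝓝 z] fun w => f₁ (‖w‖ ^ 2) * (2 * inner ℝ v w) := by
    intro v
    filter_upwards [hNc.eventually hf] with w hw
    have h0 : HasFDerivAt (fun w : ℂ => f (‖w‖ ^ 2)) (f₁ (‖w‖ ^ 2) • (2 • innerSL ℝ w)) w :=
      hw.comp_hasFDerivAt w (hN w)
    rw [h0.fderiv]
    simp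
    left
    ring
  have h2 : ∀ v : ℂ, fderiv ℝ (fun w => fderiv ℝ (fun w : ℂ => f (‖w‖ ^ 2)) w v) z v
      = 4 * f₂ * inner ℝ v z ^ 2 + 2 * f₁ (‖z‖ ^ 2) * ‖v‖ ^ 2 := by
    intro v
    have h3 : HasFDerivAt (fun w : ℂ => 2 * inner ℝ v w) ((2 : ℝ) • innerSL ℝ v) z :=
      (innerSL ℝ v).hasFDerivAt.const_mul 2
    have h4 : HasFDerivAt (fun w : ℂ => f₁ (‖w‖ ^ 2)) (f₂ • (2 • innerSL ℝ z)) z :=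
      hf₁.comp_hasFDerivAt z (hN z)
    rw [(h1 v).fderiv_eq, (h4.fun_mul h3).fderiv]
    simp [real_inner_comm]
    ring
  rw [laplacian_eq_fderiv (u := fun w : ℂ => f (‖w‖ ^ 2)) (hc.comp z (contDiff_norm_sq ℝ).contDiffAt),
    h2, h2, Complex.inner, Complex.inner, ← Complex.normSq_eq_norm_sq z, Complex.normSq_apply]
  simp
  ring

/-- A smooth cutoff function, equal to `1` up to `ρ` and to `0` from `2 ρ` on. -/
noncomputable def cutoff (ρ s : ℝ) : ℝ := Real.smoothTransition (2 - s / ρ)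

/-- The function `-4 χ(|z|²) log |z|²`, where `χ` is a cutoff function. -/
noncomputable def logBump (ρ : ℝ) (z : ℂ) : ℝ := -4 * (cutoff ρ (‖z‖ ^ 2) * Real.log (‖z‖ ^ 2))

/-- The function `s f'(s)`, where `f(|z|²)` is the logarithmic bump. -/
noncomputable def logBumpFlux (ρ s : ℝ) : ℝ :=
  -4 * (s * (deriv (cutoff ρ) s * Real.log s) + cutoff ρ s)

/-- The Laplacian of the logarithmic bump, off the origin. -/
noncomputable def logBumpLaplacian (ρ : ℝ) (z : ℂ) : ℝ := 4 * deriv (logBumpFlux ρ) (‖z‖ ^ 2)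

variable {ρ : ℝ}

theorem contDiff_cutoff : ContDiff ℝ 2 (cutoff ρ) :=
  Real.smoothTransition.contDiff.comp (contDiff_const.sub (contDiff_id.div_const ρ))

theorem cutoff_eq_one (hρ : 0 < ρ) {s : ℝ} (hs : s ≤ ρ) : cutoff ρ s = 1 :=
  Real.smoothTransition.one_of_one_le (by linarith [(div_le_one hρ).mpr hs])

theorem cutoff_eq_zero (hρ : 0 < ρ) {s : ℝ} (hs : 2 * ρ ≤ s) : cutoff ρ s = 0 :=
  Real.smoothTransition.zero_of_nonpos (by linarith [(le_div_iff₀ hρ).mpr hs])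

/-- Near the origin the profile is -4 log s, whose flux s f' is constant. The Laplacian therefore
vanishes around 0 and extends continuously across the singularity. -/
theorem logBumpFlux_of_lt (hρ : 0 < ρ) {s : ℝ} (hs : s < ρ) :
    logBumpFlux ρ =ᶠ[𝓝 s] fun _ => -4 := by
  filter_upwards [eventually_lt_nhds hs] with t ht
  have h1 : cutoff ρ =ᶠ[𝓝 t] fun _ => 1 := by
    filter_upwards [eventually_lt_nhds ht] with u hu using cutoff_eq_one hρ hu.le
  simp [logBumpFlux, h1.deriv_eq, cutoff_eq_one hρ ht.le]

theorem logBumpFlux_of_gt (hρ : 0 < ρ) {s : ℝ} (hs : 2 * ρ < s) : logBumpFlux ρ s = 0 := by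
  have h1 : cutoff ρ =ᶠ[𝓝 s] fun _ => 0 := by
    filter_upwards [eventually_gt_nhds hs] with u hu using cutoff_eq_zero hρ hu.le
  simp [logBumpFlux, h1.deriv_eq, cutoff_eq_zero hρ hs.le]

theorem contDiff_logBumpFlux (hρ : 0 < ρ) : ContDiff ℝ 1 (logBumpFlux ρ) := by
  rw [contDiff_iff_contDiffAt]
  intro s
  rcases lt_or_ge s ρ with hs | hs
  · exact contDiffAt_const.congr_of_eventuallyEq (logBumpFlux_of_lt hρ hs)
  · have h0 : s ≠ 0 := (hρ.trans_le hs).ne'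
    have h1 : ContDiff ℝ 1 (deriv (cutoff ρ)) :=
      ((contDiff_succ_iff_deriv (n := 1)).mp (contDiff_cutoff (ρ := ρ))).2.2
    exact contDiffAt_const.mul ((contDiffAt_id.mul (h1.contDiffAt.mul
      (Real.contDiffAt_log.mpr h0))).add (contDiff_cutoff.of_le one_le_two).contDiffAt)

theorem continuous_logBumpLaplacian (hρ : 0 < ρ) : Continuous (logBumpLaplacian ρ) :=
  continuous_const.mul (((contDiff_logBumpFlux hρ).continuous_deriv le_rfl).comp (by fun_prop))

theorem logBumpLaplacian_eq_zero (hρ : 0 < ρ) {z : ℂ} (hz : 2 * ρ < ‖z‖ ^ 2) :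
    logBumpLaplacian ρ z = 0 := by
  have h1 : logBumpFlux ρ =ᶠ[𝓝 (‖z‖ ^ 2)] fun _ => 0 := by
    filter_upwards [eventually_gt_nhds hz] with u hu using logBumpFlux_of_gt hρ hu
  simp [logBumpLaplacian, h1.deriv_eq]

theorem logBump_eq_zero (hρ : 0 < ρ) {z : ℂ} (hz : 2 * ρ < ‖z‖ ^ 2) : logBump ρ z = 0 := by
  simp [logBump, cutoff_eq_zero hρ hz.le]

theorem logBump_of_le (hρ : 0 < ρ) {z : ℂ} (hz : ‖z‖ ^ 2 ≤ ρ) :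
    logBump ρ z = -4 * Real.log (‖z‖ ^ 2) := by
  simp [logBump, cutoff_eq_one hρ hz]

theorem contDiffAt_logBumpProfile {s : ℝ} (hs : s ≠ 0) :
    ContDiffAt ℝ 2 (fun s => -4 * (cutoff ρ s * Real.log s)) s :=
  contDiffAt_const.mul (contDiff_cutoff.contDiffAt.mul
    (Real.contDiffAt_log.mpr hs))

theorem contDiffAt_logBump {z : ℂ} (hz : z ≠ 0) : ContDiffAt ℝ 2 (logBump ρ) z :=
  ContDiffAt.comp (g := fun s => -4 * (cutoff ρ s * Real.log s)) (f := fun z : ℂ => ‖z‖ ^ 2) z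
    (contDiffAt_logBumpProfile (by simpa using hz)) (contDiff_norm_sq ℝ).contDiffAt

theorem laplacian_logBump (hρ : 0 < ρ) {z : ℂ} (hz : z ≠ 0) :
    Laplacian.laplacian (logBump ρ) z = logBumpLaplacian ρ z := by
  have hs : 0 < ‖z‖ ^ 2 := by positivity
  have hf : ∀ t : ℝ, 0 < t → HasDerivAt (fun s => -4 * (cutoff ρ s * Real.log s))
      (logBumpFlux ρ t / t) t := by
    intro t ht
    have h1 : HasDerivAt (cutoff ρ) (deriv (cutoff ρ) t) t :=
      (contDiff_cutoff.differentiable (by simp) t).hasDerivAt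
    refine ((h1.mul (Real.hasDerivAt_log ht.ne')).const_mul (-4)).congr_deriv ?_
    rw [logBumpFlux]
    field_simp
  have hm : HasDerivAt (logBumpFlux ρ) (deriv (logBumpFlux ρ) (‖z‖ ^ 2)) (‖z‖ ^ 2) :=
    ((contDiff_logBumpFlux hρ).differentiable one_ne_zero _).hasDerivAt
  have h2 := hm.div (hasDerivAt_id (‖z‖ ^ 2)) hs.ne'
  have h3 := laplacian_radial (f := fun s => -4 * (cutoff ρ s * Real.log s))
    (f₁ := fun t => logBumpFlux ρ t / t)
    (by filter_upwards [eventually_gt_nhds hs] with t ht using hf t ht) h2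
    (contDiffAt_logBumpProfile hs.ne')
  refine Eq.trans h3 ?_
  rw [logBumpLaplacian]
  simp only [id]
  field_simp
  ring

theorem hasCompactSupport_logBumpLaplacian (hρ : 0 < ρ) :
    HasCompactSupport (logBumpLaplacian ρ) := by
  refine HasCompactSupport.intro (isCompact_closedBall (0 : ℂ) (Real.sqrt (2 * ρ))) fun z hz => ?_
  refine logBumpLaplacian_eq_zero hρ ?_
  rw [mem_closedBall_zero_iff, not_le] at hz
  exact (Real.sqrt_lt' ((Real.sqrt_nonneg _).trans_lt hz)).mp hz

theorem integrable_logBumpLaplacian (hρ : 0 < ρ) : Integrable (logBumpLaplacian ρ) :=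
  (continuous_logBumpLaplacian hρ).integrable_of_hasCompactSupport
    (hasCompactSupport_logBumpLaplacian hρ)

/-- In polar coordinates the integral is 2π ∫ 4 r m'(r²) dr, with m the flux. The primitive 2 m(r²)
rises from -8 at r = 0 to 0 at infinity, which gives 2π · 8. -/
theorem integral_logBumpLaplacian (hρ : 0 < ρ) :
    ∫ z, logBumpLaplacian ρ z = 16 * Real.pi := by
  have h1 := integral_fun_norm_addHaar (volume : Measure ℂ)
    (fun r => 4 * deriv (logBumpFlux ρ) (r ^ 2))
  have hcd : Continuous (deriv (logBumpFlux ρ)) := (contDiff_logBumpFlux hρ).continuous_deriv le_rfl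
  have hz : ∀ s, 2 * ρ < s → deriv (logBumpFlux ρ) s = 0 := by
    intro s hs
    have h1 : logBumpFlux ρ =ᶠ[𝓝 s] fun _ => 0 := by
      filter_upwards [eventually_gt_nhds hs] with u hu using logBumpFlux_of_gt hρ hu
    simp [h1.deriv_eq]
  have hsq : ∀ᶠ r : ℝ in atTop, 2 * ρ < r ^ 2 :=
    (tendsto_pow_atTop two_ne_zero).eventually_gt_atTop _
  have h2 : ∫ y in Set.Ioi (0 : ℝ), y * (4 * deriv (logBumpFlux ρ) (y ^ 2)) = 8 := by
    have h3 : ∀ y ∈ Set.Ici (0 : ℝ), HasDerivAt (fun y => 2 * logBumpFlux ρ (y ^ 2))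
        (y * (4 * deriv (logBumpFlux ρ) (y ^ 2))) y := by
      intro y _
      have hm := ((contDiff_logBumpFlux hρ).differentiable one_ne_zero (y ^ 2)).hasDerivAt
      have hc : HasDerivAt (fun y => logBumpFlux ρ (y ^ 2))
          (deriv (logBumpFlux ρ) (y ^ 2) * ((2 : ℕ) * y ^ (2 - 1))) y :=
        HasDerivAt.comp (h := fun y : ℝ => y ^ 2) y hm (hasDerivAt_pow 2 y)
      refine (hc.const_mul 2).congr_deriv ?_
      simp
      ring
    have h4 : Tendsto (fun y : ℝ => 2 * logBumpFlux ρ (y ^ 2)) atTop (𝓝 0) := by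
      refine tendsto_const_nhds.congr' ?_
      filter_upwards [hsq] with r hr
      rw [logBumpFlux_of_gt hρ hr, mul_zero]
    have hcont : Continuous fun y : ℝ => y * (4 * deriv (logBumpFlux ρ) (y ^ 2)) := by fun_prop
    have h5 : IntegrableOn (fun y : ℝ => y * (4 * deriv (logBumpFlux ρ) (y ^ 2)))
        (Set.Ioi 0) := by
      refine Integrable.integrableOn (hcont.integrable_of_hasCompactSupport ?_)
      refine HasCompactSupport.intro (isCompact_closedBall (0 : ℝ) (Real.sqrt (2 * ρ)))
        fun y hy => ?_
      rw [mem_closedBall_zero_iff, not_le] at hy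
      have := (Real.sqrt_lt' ((Real.sqrt_nonneg _).trans_lt hy)).mp hy
      rw [Real.norm_eq_abs, sq_abs] at this
      rw [hz _ this]
      ring
    rw [integral_Ioi_of_hasDerivAt_of_tendsto' h3 h5 h4]
    have := (logBumpFlux_of_lt hρ hρ).eq_of_nhds
    norm_num [this]
  have h6 : volume.real (Metric.ball (0 : ℂ) 1) = Real.pi := by
    simp [Measure.real, Complex.volume_ball]
  simp only [Complex.finrank_real_complex, h6, Nat.add_one_sub_one, pow_one, smul_eq_mul, h2] at h1
  refine Eq.trans h1 ?_
  simp
  ring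

end LogBump

end ImproperAffine

namespace ImproperAffine

open scoped PeriodPair
open Filter
open MeasureTheory

/-! ### The integral of the Laplacian of the logarithm of the density -/

section LogDensity

variable {L : PeriodPair} {c : ℂ}

variable (L c) in
/-- The density `2 (|F'|² + |G'|²)` for `F = c ℘`, `G = ℘'`. -/
noncomputable def dataDensity (z : ℂ) : ℝ := 2 * (‖c * ℘'[L] z‖ ^ 2 + ‖wpSecond L z‖ ^ 2)

theorem dataDensity_add {l : ℂ} (hl : l ∈ L.lattice) (z : ℂ) :
    dataDensity L c (z + l) = dataDensity L c z := by
  have h1 := L.weierstrassP_add_coe z ⟨l, hl⟩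
  have h2 := L.derivWeierstrassP_add_coe z ⟨l, hl⟩
  simp only at h1 h2
  simp only [dataDensity, wpSecond, h1, h2]

theorem dataDensity_pos (hc : c ≠ 0) {z : ℂ} (hz : z ∉ L.lattice) : 0 < dataDensity L c z := by
  by_cases h : ℘'[L] z = 0
  · have := norm_pos_iff.mpr (weierstrassP_regular L hz h)
    rw [dataDensity, wpSecond]
    positivity
  · have : 0 < ‖c * ℘'[L] z‖ := norm_pos_iff.mpr (mul_ne_zero hc h)
    rw [dataDensity]
    positivity

theorem contDiffAt_dataDensity {z : ℂ} (hz : z ∉ L.lattice) (n : WithTop ℕ∞) :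
    ContDiffAt ℝ n (dataDensity L c) z :=
  contDiffAt_const.mul (((contDiffAt_const.mul (contDiffAt_wp' hz n)).norm_sq ℝ).add
    ((contDiffAt_wpSecond hz n).norm_sq ℝ))

variable (L c) in
/-- The density multiplied by `|z|⁸`, extended across the origin. -/
noncomputable def regularizedDensity (z : ℂ) : ℝ :=
  2 * (‖c * (z * (z ^ 3 * L.derivWeierstrassPExcept 0 z - 2))‖ ^ 2
    + ‖6 * (z ^ 2 * L.weierstrassPExcept 0 z + 1) ^ 2 - z ^ 4 * (L.g₂ / 2)‖ ^ 2)

theorem regularizedDensity_zero : regularizedDensity L c 0 = 72 := by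
  norm_num [regularizedDensity]

theorem contDiffAt_regularizedDensity : ContDiffAt ℝ 2 (regularizedDensity L c) 0 := by
  have h1 : ContDiffAt ℝ 2 (L.weierstrassPExcept 0) 0 :=
    (L.analyticAt_weierstrassPExcept 0).contDiffAt.restrict_scalars ℝ
  have h2 : ContDiffAt ℝ 2 (L.derivWeierstrassPExcept 0) 0 :=
    (L.analyticAt_derivWeierstrassPExcept 0).contDiffAt.restrict_scalars ℝ
  exact contDiffAt_const.mul (((contDiffAt_const.mul (contDiffAt_id.mul
    (((contDiffAt_id.pow 3).mul h2).sub contDiffAt_const))).norm_sq ℝ).add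
    (((contDiffAt_const.mul ((((contDiffAt_id.pow 2).mul h1).add contDiffAt_const).pow 2)).sub
      ((contDiffAt_id.pow 4).mul contDiffAt_const)).norm_sq ℝ))

/-- Since ℘'' has a pole of order four and ℘' one of order three, |z|⁸ times the density tends to 2
· 6² = 72 at the origin. Hence the -4 log|z|² in `logBump` and the value log 72 in `regularPart`. -/
theorem regularizedDensity_eq {z : ℂ} (hz : z ≠ 0) :
    regularizedDensity L c z = dataDensity L c z * (‖z‖ ^ 2) ^ 4 := by
  have h1 : L.weierstrassPExcept 0 z = ℘[L] z - 1 / z ^ 2 := by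
    have := L.weierstrassPExcept_add 0 z
    simp only [ZeroMemClass.coe_zero, sub_zero] at this
    rw [← this]
    simp
  have h2 : L.derivWeierstrassPExcept 0 z = ℘'[L] z + 2 / z ^ 3 := by
    have := L.derivWeierstrassPExcept_sub 0 z
    simp only [ZeroMemClass.coe_zero, sub_zero] at this
    rw [← this]
    ring
  have h3 : c * (z * (z ^ 3 * L.derivWeierstrassPExcept 0 z - 2)) = c * ℘'[L] z * z ^ 4 := by
    rw [h2]
    field_simp
    ring
  have h4 : 6 * (z ^ 2 * L.weierstrassPExcept 0 z + 1) ^ 2 - z ^ 4 * (L.g₂ / 2)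
      = wpSecond L z * z ^ 4 := by
    rw [h1, wpSecond]
    field_simp
    ring
  rw [regularizedDensity, h3, h4, dataDensity, norm_mul _ (z ^ 4), norm_mul _ (z ^ 4), norm_pow]
  ring

theorem exists_lattice_separation (L : PeriodPair) :
    ∃ R > 0, ∀ l ∈ L.lattice, l ≠ 0 → 4 * R ≤ ‖l‖ := by
  obtain ⟨ε, hε, h⟩ := Metric.mem_nhds_iff.mp (L.compl_lattice_sdiff_singleton_mem_nhds 0)
  refine ⟨ε / 4, by positivity, fun l hl hl0 => ?_⟩
  by_contra hlt
  exact h (mem_ball_zero_iff.mpr (by linarith)) ⟨hl, hl0⟩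

/-- At most one lattice translate of a point near a given one is small. -/
theorem exists_eventually_lt_norm_add {R : ℝ} (hR : 0 < R)
    (hsep : ∀ l ∈ L.lattice, l ≠ 0 → 4 * R ≤ ‖l‖) (z₀ : ℂ) :
    ∃ l₀ : L.lattice, ∀ᶠ z : ℂ in 𝓝 z₀, ∀ l : L.lattice, l ≠ l₀ → R < ‖z + l‖ := by
  -- If one translate lies within 2R of the origin, the others are at distance at least 4R from it.
  -- If none does, moving z₀ by less than R keeps every translate beyond R, and the choice of l₀ is
  -- immaterial.
  by_cases h : ∃ l₀ : L.lattice, ‖z₀ + l₀‖ < 2 * R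
  · obtain ⟨l₀, hl₀⟩ := h
    have hc : ContinuousAt (fun z : ℂ => ‖z + l₀‖) z₀ := by fun_prop
    refine ⟨l₀, ?_⟩
    filter_upwards [hc.eventually_lt_const hl₀] with z hz l hl
    have h1 := hsep _ (sub_mem l.2 l₀.2) (sub_ne_zero.mpr (Subtype.coe_injective.ne hl))
    have h2 := norm_sub_le (z + l) (z + l₀)
    rw [add_sub_add_left_eq_sub] at h2
    linarith
  · push Not at h
    refine ⟨0, ?_⟩
    filter_upwards [Metric.ball_mem_nhds z₀ hR] with z hz l _
    have h1 := norm_sub_le (z + l) (z - z₀)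
    rw [show z + l - (z - z₀) = z₀ + l by ring] at h1
    rw [mem_ball_iff_norm] at hz
    linarith [h l]

theorem eventually_tsum_eq_single {R : ℝ} {f : ℂ → ℝ} (hf : ∀ z, R < ‖z‖ → f z = 0) {z₀ : ℂ}
    {l₀ : L.lattice} (h : ∀ᶠ z : ℂ in 𝓝 z₀, ∀ l : L.lattice, l ≠ l₀ → R < ‖z + l‖) :
    (fun z => ∑' l : L.lattice, f (z + l)) =ᶠ[𝓝 z₀] fun z => f (z + l₀) := by
  filter_upwards [h] with z hz using tsum_eq_single l₀ fun l hl => hf _ (hz l hl)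

theorem tsum_translate_add (f : ℂ → ℝ) {l : ℂ} (hl : l ∈ L.lattice) (z : ℂ) :
    ∑' m : L.lattice, f (z + l + m) = ∑' m : L.lattice, f (z + m) := by
  rw [← (Equiv.addLeft (⟨l, hl⟩ : L.lattice)).tsum_eq fun m : L.lattice => f (z + m)]
  simp [add_assoc]

theorem continuous_tsum_translate {R : ℝ} (hR : 0 < R)
    (hsep : ∀ l ∈ L.lattice, l ≠ 0 → 4 * R ≤ ‖l‖) {f : ℂ → ℝ} (hf : ∀ z, R < ‖z‖ → f z = 0)
    (hc : Continuous f) : Continuous fun z => ∑' l : L.lattice, f (z + l) := by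
  rw [continuous_iff_continuousAt]
  intro z₀
  obtain ⟨l₀, hl₀⟩ := exists_eventually_lt_norm_add hR hsep z₀
  refine ContinuousAt.congr ?_ (eventually_tsum_eq_single hf hl₀).symm
  fun_prop

open Classical in
variable (L c) in
/-- The regular part of the logarithm of the density. -/
noncomputable def regularPart (ρ : ℝ) (z : ℂ) : ℝ :=
  if z ∈ L.lattice then Real.log 72
  else Real.log (dataDensity L c z) - ∑' l : L.lattice, logBump ρ (z + l)

theorem regularPart_add (ρ : ℝ) {l : ℂ} (hl : l ∈ L.lattice) (z : ℂ) :
    regularPart L c ρ (z + l) = regularPart L c ρ z := by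
  have h : z + l ∈ L.lattice ↔ z ∈ L.lattice :=
    ⟨fun h => by simpa using sub_mem h hl, fun h => add_mem h hl⟩
  by_cases hz : z ∈ L.lattice
  · rw [regularPart, regularPart, if_pos hz, if_pos (h.mpr hz)]
  · rw [regularPart, regularPart, if_neg hz, if_neg (mt h.mp hz), dataDensity_add hl,
      tsum_translate_add _ hl]

theorem logBump_of_lt_norm {R ρ : ℝ} (hR : 0 < R) (hρ : 2 * ρ = R ^ 2) (z : ℂ) (hz : R < ‖z‖) :
    logBump ρ z = 0 :=
  logBump_eq_zero (by nlinarith) (by rw [hρ]; gcongr)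

theorem logBumpLaplacian_of_lt_norm {R ρ : ℝ} (hR : 0 < R) (hρ : 2 * ρ = R ^ 2) (z : ℂ)
    (hz : R < ‖z‖) : logBumpLaplacian ρ z = 0 :=
  logBumpLaplacian_eq_zero (by nlinarith) (by rw [hρ]; gcongr)

/-- Near a point off the lattice, the logarithm of the density is the sum of its regular part and
one logarithmic bump. -/
theorem log_dataDensity_eventuallyEq {R ρ : ℝ} (hR : 0 < R) (hρ : 2 * ρ = R ^ 2) {z₀ : ℂ} (hz₀ : z₀ ∉ L.lattice)
    {l₀ : L.lattice} (h : ∀ᶠ z : ℂ in 𝓝 z₀, ∀ l : L.lattice, l ≠ l₀ → R < ‖z + l‖) :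
    (fun z => Real.log (dataDensity L c z))
      =ᶠ[𝓝 z₀] regularPart L c ρ + fun z => logBump ρ (z + l₀) := by
  filter_upwards [eventually_notMem_lattice hz₀,
    eventually_tsum_eq_single (logBump_of_lt_norm hR hρ) h] with z hz hz'
  rw [Pi.add_apply, regularPart, if_neg hz, hz']
  ring

theorem contDiffAt_logBump_translate (ρ : ℝ) {z a : ℂ} (hz : z + a ≠ 0) :
    ContDiffAt ℝ 2 (fun z => logBump ρ (z + a)) z :=
  ContDiffAt.comp (g := logBump ρ) (f := fun z => z + a) z (contDiffAt_logBump hz)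
    (contDiffAt_id.add contDiffAt_const)

theorem add_coe_ne_zero {z : ℂ} (hz : z ∉ L.lattice) (l : L.lattice) : z + l ≠ 0 := fun h =>
  hz (by rw [eq_neg_of_add_eq_zero_left h]; exact neg_mem l.2)

/-- By periodicity the lattice points reduce to 0, where subtracting the bump leaves the logarithm
of the regularized density. Elsewhere at most one bump is present locally, and it is smooth. -/
theorem contDiff_regularPart {R ρ : ℝ} (hR : 0 < R) (hρ : 2 * ρ = R ^ 2)
    (hsep : ∀ l ∈ L.lattice, l ≠ 0 → 4 * R ≤ ‖l‖)
    (hc0 : c ≠ 0) : ContDiff ℝ 2 (regularPart L c ρ) := by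
  rw [contDiff_iff_contDiffAt]
  intro z₀
  by_cases hz₀ : z₀ ∈ L.lattice
  · suffices h0 : ContDiffAt ℝ 2 (regularPart L c ρ) 0 by
      have h1 : regularPart L c ρ = regularPart L c ρ ∘ fun z => z - z₀ := by
        funext z
        rw [Function.comp_apply, sub_eq_add_neg, regularPart_add ρ (neg_mem hz₀)]
      rw [h1]
      refine ContDiffAt.comp z₀ ?_ (contDiffAt_id.sub contDiffAt_const)
      simpa using h0
    have hρ0 : 0 < ρ := by nlinarith
    refine ((contDiffAt_regularizedDensity (L := L) (c := c)).log
      (by rw [regularizedDensity_zero]; norm_num)).congr_of_eventuallyEq ?_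
    have hc : ContinuousAt (fun z : ℂ => ‖z‖ ^ 2) 0 := by fun_prop
    have hsmall : ∀ᶠ z in 𝓝 (0 : ℂ), ‖z‖ ^ 2 < ρ := hc.eventually_lt_const (by simpa using hρ0)
    filter_upwards [L.compl_lattice_sdiff_singleton_mem_nhds 0, hsmall] with z hz hzs
    by_cases hz0 : z = 0
    · rw [hz0, regularPart, if_pos (zero_mem _), regularizedDensity_zero]
    · have hzL : z ∉ L.lattice := fun h => hz ⟨h, hz0⟩
      have hzR : ‖z‖ < R := lt_of_pow_lt_pow_left₀ 2 hR.le (by linarith)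
      have h2 : ∑' l : L.lattice, logBump ρ (z + l) = logBump ρ z := by
        rw [tsum_eq_single (0 : L.lattice)]
        · simp
        · intro l hl
          refine logBump_of_lt_norm hR hρ _ ?_
          have h3 := hsep l l.2 (by simpa using hl)
          have h4 := norm_sub_le (z + l) z
          rw [add_sub_cancel_left] at h4
          linarith
      have hn : ‖z‖ ^ 2 ≠ 0 := by simpa using hz0
      rw [regularPart, if_neg hzL, h2, logBump_of_le hρ0 hzs.le, regularizedDensity_eq hz0,
        Real.log_mul (dataDensity_pos hc0 hzL).ne' (pow_ne_zero _ hn), Real.log_pow (‖z‖ ^ 2) 4]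
      push_cast
      ring
  · obtain ⟨l₀, hl₀⟩ := exists_eventually_lt_norm_add hR hsep z₀
    have h1 : regularPart L c ρ =ᶠ[𝓝 z₀]
        (fun z => Real.log (dataDensity L c z)) - fun z => logBump ρ (z + l₀) := by
      filter_upwards [log_dataDensity_eventuallyEq hR hρ hz₀ hl₀ (c := c)] with z hz
      rw [Pi.sub_apply, hz, Pi.add_apply]
      ring
    refine ContDiffAt.congr_of_eventuallyEq ?_ h1
    exact ((contDiffAt_dataDensity hz₀ 2).log (dataDensity_pos hc0 hz₀).ne').sub
      (contDiffAt_logBump_translate ρ (add_coe_ne_zero hz₀ l₀))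

theorem laplacian_comp_add_right (u : ℂ → ℝ) (a z : ℂ) :
    Laplacian.laplacian (fun z => u (z + a)) z = Laplacian.laplacian u (z + a) := by
  simp only [InnerProductSpace.laplacian_eq_iteratedFDeriv_complexPlane,
    iteratedFDeriv_comp_add_right]

theorem laplacian_log_dataDensity {R ρ : ℝ} (hR : 0 < R) (hρ : 2 * ρ = R ^ 2)
    (hsep : ∀ l ∈ L.lattice, l ≠ 0 → 4 * R ≤ ‖l‖)
    (hc0 : c ≠ 0) {z : ℂ} (hz : z ∉ L.lattice) :
    Laplacian.laplacian (fun z => Real.log (dataDensity L c z)) z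
      = Laplacian.laplacian (regularPart L c ρ) z
        + ∑' l : L.lattice, logBumpLaplacian ρ (z + l) := by
  obtain ⟨l₀, hl₀⟩ := exists_eventually_lt_norm_add hR hsep z
  have h0 := add_coe_ne_zero hz l₀
  rw [(InnerProductSpace.laplacian_congr_nhds
      (log_dataDensity_eventuallyEq hR hρ hz hl₀)).eq_of_nhds,
    (contDiff_regularPart hR hρ hsep hc0).contDiffAt.laplacian_add
      (contDiffAt_logBump_translate ρ h0), laplacian_comp_add_right,
    laplacian_logBump (by nlinarith) h0,
    (eventually_tsum_eq_single (logBumpLaplacian_of_lt_norm hR hρ) hl₀).eq_of_nhds]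

variable (L c) in
/-- The continuous periodic function that equals, off the lattice, the Laplacian of the logarithm
of the density. -/
theorem exists_continuous_laplacian_log (hc0 : c ≠ 0) : ∃ φ : ℂ → ℝ, Continuous φ ∧
    (∀ l ∈ L.lattice, ∀ z, φ (z + l) = φ z) ∧
    (∀ z ∉ L.lattice, Laplacian.laplacian (fun z => Real.log (dataDensity L c z)) z = φ z) ∧
    IntegrableOn φ (fundDomain L) ∧ ∫ z in fundDomain L, φ z = 16 * Real.pi := by
  obtain ⟨R, hR, hsep⟩ := exists_lattice_separation L
  -- The cutoff vanishes for |z|² ≥ 2ρ = R², so the bump lives in the disc of radius R.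
  obtain ⟨ρ, hρ⟩ : ∃ ρ : ℝ, 2 * ρ = R ^ 2 := ⟨R ^ 2 / 2, by ring⟩
  have hρ0 : 0 < ρ := by nlinarith
  have hU := contDiff_regularPart hR hρ hsep hc0
  have hUc := continuous_laplacian hU
  have hUp := periodic_laplacian (L := L) hU fun l hl z => regularPart_add ρ hl z
  have hSc := continuous_tsum_translate hR hsep (logBumpLaplacian_of_lt_norm hR hρ)
    (continuous_logBumpLaplacian hρ0)
  have hSp : ∀ l ∈ L.lattice, ∀ z, ∑' m : L.lattice, logBumpLaplacian ρ (z + l + m)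
      = ∑' m : L.lattice, logBumpLaplacian ρ (z + m) := fun l hl z => tsum_translate_add _ hl z
  have hUi := integrableOn_fundDomain_of_periodic hUp hUc
  have hSi := integrableOn_fundDomain_of_periodic (L := L)
    (g := fun z => ∑' m : L.lattice, logBumpLaplacian ρ (z + m)) hSp hSc
  refine ⟨fun z => Laplacian.laplacian (regularPart L c ρ) z
        + ∑' l : L.lattice, logBumpLaplacian ρ (z + l), hUc.add hSc,
    fun l hl z => by simp only [hUp l hl, hSp l hl],
    fun z hz => laplacian_log_dataDensity hR hρ hsep hc0 hz, hUi.add hSi, ?_⟩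
  -- The regular part integrates to zero. The lattice sum of bumps unfolds to the integral of a
  -- single bump over the plane.
  rw [integral_add hUi hSi,
    setIntegral_laplacian_eq_zero hU fun l hl z => regularPart_add ρ hl z,
    setIntegral_tsum_translate (integrable_logBumpLaplacian hρ0), integral_logBumpLaplacian hρ0,
    zero_add]

end LogDensity

end ImproperAffine

namespace ImproperAffine

open scoped PeriodPair
open Filter
open MeasureTheory
open scoped ENNReal

/-! ### The total curvature -/

section TotalCurvature

variable {L : PeriodPair} {c : ℂ}

theorem density_data (c : ℂ) {e : OpenPartialHomeomorph (puncturedTorus L) ℂ}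
    (he : e ∈ atlas ℂ (puncturedTorus L)) {z : ℂ} (hz : z ∈ e.target) :
    density (dataF L c) (dataG L) e z = dataDensity L c z := by
  have hzL := notMem_lattice_of_mem_target he hz
  have hF : dataF L c ∘ e.symm =ᶠ[𝓝 z] fun z => c * ℘[L] z := by
    filter_upwards [e.open_target.mem_nhds hz] with w hw using descend_chart_symm (periodic_wp c) he hw
  have hG : dataG L ∘ e.symm =ᶠ[𝓝 z] ℘'[L] := by
    filter_upwards [e.open_target.mem_nhds hz] with w hw using descend_chart_symm periodic_wp' he hw
  rw [density, hF.deriv_eq, hG.deriv_eq, ((hasDerivAt_weierstrassP L hzL).const_mul c).deriv,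
    (hasDerivAt_derivWeierstrassP L hzL).deriv]
  rfl

theorem gaussCurvature_data (c : ℂ) (p : puncturedTorus L) :
    gaussCurvature (dataF L c) (dataG L) p
      = -(Laplacian.laplacian (fun z => Real.log (dataDensity L c z)) (chartAt ℂ p p))
        / (2 * dataDensity L c (chartAt ℂ p p)) := by
  have h : (fun z => Real.log (density (dataF L c) (dataG L) (chartAt ℂ p) z))
      =ᶠ[𝓝 (chartAt ℂ p p)] fun z => Real.log (dataDensity L c z) := by
    filter_upwards [(chartAt ℂ p).open_target.mem_nhds (mem_chart_target ℂ p)] with z hz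
    rw [density_data c (chart_mem_atlas ℂ p) hz]
  rw [gaussCurvature, (InnerProductSpace.laplacian_congr_nhds h).eq_of_nhds,
    density_data c (chart_mem_atlas ℂ p) (mem_chart_target ℂ p)]

/-! ### The area measure on the punctured torus -/

/-- The projection from the complement of the lattice to the punctured torus. -/
def puncturedMk (L : PeriodPair) (z : ((L.lattice : Set ℂ)ᶜ : Set ℂ)) : puncturedTorus L :=
  ⟨torusMk L z, torusMk_mem_punctured.mpr z.2⟩

theorem continuous_puncturedMk : Continuous (puncturedMk L) :=
  (continuous_quotient_mk'.comp continuous_subtype_val).subtype_mk _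

variable (L c) in
/-- The measure `λ dx dy` on the fundamental parallelogram. -/
noncomputable def planeAreaMeasure : Measure ℂ :=
  (volume.restrict (fundDomain L)).withDensity fun z => ENNReal.ofReal (dataDensity L c z)

variable (L c) in
/-- The area measure of `dτ²` on the punctured torus. -/
noncomputable def dataAreaMeasure [MeasurableSpace (puncturedTorus L)] :
    Measure (puncturedTorus L) :=
  (Measure.comap Subtype.val (planeAreaMeasure L c)).map (puncturedMk L)

theorem measurableSet_compl_lattice : MeasurableSet ((L.lattice : Set ℂ)ᶜ) :=
  (isOpen_compl_lattice L).measurableSet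

theorem ae_notMem_lattice {μ : Measure ℂ} (hμ : μ ≪ volume) : ∀ᵐ z ∂μ, z ∈ (L.lattice : Set ℂ)ᶜ := by
  have h : ∀ᵐ z : ℂ, z ∈ (L.lattice : Set ℂ)ᶜ :=
    measure_eq_zero_iff_ae_notMem.mp ((lattice_countable L).measure_zero volume)
  exact hμ.ae_le h

theorem continuousOn_dataDensity : ContinuousOn (dataDensity L c) (L.lattice : Set ℂ)ᶜ :=
  fun _ hz => (contDiffAt_dataDensity hz 0).continuousAt.continuousWithinAt

theorem aemeasurable_ofReal_dataDensity {μ : Measure ℂ} (hμ : μ ≪ volume) :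
    AEMeasurable (fun z => ENNReal.ofReal (dataDensity L c z)) μ := by
  have h := continuousOn_dataDensity.aemeasurable (f := dataDensity L c) (μ := μ)
    (measurableSet_compl_lattice (L := L))
  rw [Measure.restrict_eq_self_of_ae_mem (ae_notMem_lattice hμ)] at h
  exact h.ennreal_ofReal

theorem planeAreaMeasure_absolutelyContinuous : planeAreaMeasure L c ≪ volume :=
  (withDensity_absolutelyContinuous _ _).trans Measure.restrict_le_self.absolutelyContinuous

/-- Summing over the lattice the restriction of a periodic density to the image of a set in a
chart. -/
theorem tsum_indicator_chart_image {e : OpenPartialHomeomorph (puncturedTorus L) ℂ}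
    (he : e ∈ atlas ℂ (puncturedTorus L)) {E : Set (puncturedTorus L)} (hE : E ⊆ e.source)
    {g : ℂ → ℝ≥0∞} (hg : ∀ l ∈ L.lattice, ∀ z, g (z + l) = g z) (z : ℂ) :
    ∑' l : L.lattice, (e '' E).indicator g (z + l)
      = (Subtype.val '' (puncturedMk L ⁻¹' E)).indicator g z := by
  have key : ∀ l ∈ L.lattice, z + l ∈ e '' E → ∃ hz : z ∈ (L.lattice : Set ℂ)ᶜ,
      puncturedMk L ⟨z, hz⟩ ∈ E ∧ z + l = e (puncturedMk L ⟨z, hz⟩) := by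
    rintro l hl ⟨p, hp, hpz⟩
    have h1 := notMem_lattice_of_mem_target he (e.map_source (hE hp))
    have h2 : z ∉ L.lattice := fun h => h1 (hpz ▸ add_mem h hl)
    have h3 : puncturedMk L ⟨z, h2⟩ = p := by
      apply Subtype.ext
      rw [← torusMk_chart he (hE hp), hpz]
      exact torusMk_eq_iff.mpr (by simpa using hl)
    exact ⟨h2, h3 ▸ hp, h3 ▸ hpz.symm⟩
  by_cases hzA : z ∈ Subtype.val '' (puncturedMk L ⁻¹' E)
  · obtain ⟨⟨w, hw⟩, hwE, rfl⟩ := hzA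
    rw [Set.indicator_of_mem (show w ∈ Subtype.val '' (puncturedMk L ⁻¹' E) from
      ⟨⟨w, hw⟩, hwE, rfl⟩)]
    have h1 : torusMk L w = torusMk L (e (puncturedMk L ⟨w, hw⟩)) :=
      (torusMk_chart he (hE hwE)).symm
    rw [torusMk_eq_iff] at h1
    -- The chart selects one representative of the class of w, so exactly one translate meets the
    -- image of E.
    rw [tsum_eq_single ⟨_, h1⟩]
    · have h2 : w + (e (puncturedMk L ⟨w, hw⟩) - w) = e (puncturedMk L ⟨w, hw⟩) := by ring
      rw [Set.indicator_of_mem, hg _ h1]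
      exact ⟨_, hwE, h2.symm⟩
    · intro l hl
      refine Set.indicator_of_notMem (fun h => hl ?_) _
      obtain ⟨hz, _, h3⟩ := key l l.2 h
      exact Subtype.ext (eq_sub_of_add_eq' h3)
  · rw [Set.indicator_of_notMem hzA, ENNReal.tsum_eq_zero]
    intro l
    refine Set.indicator_of_notMem (fun h => hzA ?_) _
    obtain ⟨hz, h2, _⟩ := key l l.2 h
    exact ⟨_, h2, rfl⟩

section Borel

variable [MeasurableSpace (puncturedTorus L)] [BorelSpace (puncturedTorus L)]

/-- An integral over the chart image of E unfolds into a sum over lattice translates on the period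
cell. Each point of the cell lying over E is counted once, so the push-forward from the cell gives
the same value in every chart. -/
theorem isAreaMeasure_data : IsAreaMeasure (dataF L c) (dataG L) (dataAreaMeasure L c) := by
  intro e he E hE hEm
  have hA : MeasurableSet (Subtype.val '' (puncturedMk L ⁻¹' E)) :=
    (MeasurableEmbedding.subtype_coe measurableSet_compl_lattice).measurableSet_image.mpr
      (continuous_puncturedMk.measurable hEm)
  have hE' : e '' E = e.target ∩ Subtype.val '' (puncturedMk L ⁻¹' E) := by
    ext z
    constructor
    · rintro ⟨p, hp, rfl⟩
      have ht := e.map_source (hE hp)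
      refine ⟨ht, ⟨_, notMem_lattice_of_mem_target he ht⟩, ?_, rfl⟩
      have : puncturedMk L ⟨_, notMem_lattice_of_mem_target he ht⟩ = p :=
        Subtype.ext (torusMk_chart he (hE hp))
      rw [Set.mem_preimage, this]
      exact hp
    · rintro ⟨ht, w, hw, rfl⟩
      have : puncturedMk L w = e.symm w := Subtype.ext (chart_symm_coe he ht).symm
      rw [Set.mem_preimage, this] at hw
      exact ⟨_, hw, e.right_inv ht⟩
  have hE'm : MeasurableSet (e '' E) := hE' ▸ e.open_target.measurableSet.inter hA
  have h1 : ∫⁻ z in e '' E, ENNReal.ofReal (density (dataF L c) (dataG L) e z)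
      = ∫⁻ z in e '' E, ENNReal.ofReal (dataDensity L c z) := by
    refine setLIntegral_congr_fun hE'm fun z hz => ?_
    rw [hE'] at hz
    simp only [density_data c he hz.1]
  have hvadd : ∀ (l : L.lattice) (z : ℂ), l +ᵥ z = z + l := fun l z => by
    rw [Submodule.vadd_def, vadd_eq_add, add_comm]
  rw [h1, ← lintegral_indicator hE'm,
    (isAddFundamentalDomain_fundDomain (L := L)).lintegral_eq_tsum'']
  simp only [hvadd]
  rw [← lintegral_tsum]
  · simp only [tsum_indicator_chart_image he hE
      (g := fun z => ENNReal.ofReal (dataDensity L c z))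
      fun l hl z => by simp only [dataDensity_add hl]]
    rw [lintegral_indicator hA, dataAreaMeasure,
      Measure.map_apply continuous_puncturedMk.measurable hEm,
      (MeasurableEmbedding.subtype_coe measurableSet_compl_lattice).comap_apply, planeAreaMeasure,
      withDensity_apply _ hA]
  · intro l
    have h2 : AEMeasurable ((e '' E).indicator fun z => ENNReal.ofReal (dataDensity L c z)) :=
      (aemeasurable_ofReal_dataDensity Measure.AbsolutelyContinuous.rfl).indicator hE'm
    exact (h2.comp_quasiMeasurePreserving
      (measurePreserving_add_right volume (l : ℂ)).quasiMeasurePreserving).restrict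

/-- The density cancels against the denominator of K, leaving -½ Δ log λ on the period cell. Its
integral is -½ · 16π; the lattice is a null set. -/
theorem integral_gaussCurvature_data (hc : c ≠ 0) :
    Integrable (gaussCurvature (dataF L c) (dataG L)) (dataAreaMeasure L c) ∧
      ∫ p, gaussCurvature (dataF L c) (dataG L) p ∂(dataAreaMeasure L c) = -8 * Real.pi := by
  obtain ⟨φ, hφc, hφp, hφ, hφi, hφI⟩ := exists_continuous_laplacian_log L c hc
  set κ : ℂ → ℝ := fun z => -φ z / (2 * dataDensity L c z) with hκ
  have hκp : LatticePeriodic L κ := fun l hl z _ => by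
    simp only [hκ, hφp l hl, dataDensity_add hl]
  have hg : gaussCurvature (dataF L c) (dataG L) = descend κ := by
    funext p
    rw [gaussCurvature_data, hφ _ (chart_notMem_lattice p),
      descend_eq_chart hκp (chart_mem_atlas ℂ p) (mem_chart_source ℂ p)]
  have hgc : Continuous (descend (L := L) κ) := by
    rw [continuous_iff_continuousAt]
    intro p
    refine continuousAt_descend hκp ?_
    have hz := chart_notMem_lattice p
    exact hφc.continuousAt.neg.div
      (continuousAt_const.mul (contDiffAt_dataDensity hz 0).continuousAt)
      (mul_pos two_pos (dataDensity_pos hc hz)).ne'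
  have hgq : ∀ z, descend κ (puncturedMk L z) = κ z := fun z => descend_eq hκp rfl
  have hac : volume.restrict (fundDomain L) ≪ volume :=
    Measure.restrict_le_self.absolutelyContinuous
  have hae : (fun z => (ENNReal.ofReal (dataDensity L c z)).toReal • κ z)
      =ᵐ[volume.restrict (fundDomain L)] fun z => -(1 / 2) * φ z := by
    filter_upwards [ae_notMem_lattice hac] with z hz
    have h0 := dataDensity_pos hc hz
    rw [ENNReal.toReal_ofReal h0.le, hκ, smul_eq_mul]
    field_simp
  have hκi : Integrable κ (planeAreaMeasure L c) := by
    rw [planeAreaMeasure, integrable_withDensity_iff_integrable_smul₀'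
      (aemeasurable_ofReal_dataDensity hac) (Eventually.of_forall fun _ => ENNReal.ofReal_lt_top),
      integrable_congr hae]
    exact hφi.const_mul _
  have hκI : ∫ z, κ z ∂(planeAreaMeasure L c) = -8 * Real.pi := by
    rw [planeAreaMeasure, integral_withDensity_eq_integral_toReal_smul₀
      (aemeasurable_ofReal_dataDensity hac) (Eventually.of_forall fun _ => ENNReal.ofReal_lt_top),
      integral_congr_ae hae, integral_const_mul, hφI]
    ring
  have hemb := MeasurableEmbedding.subtype_coe (measurableSet_compl_lattice (L := L))
  have hcomp : descend (L := L) κ ∘ puncturedMk L = κ ∘ Subtype.val := funext hgq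
  rw [hg, dataAreaMeasure]
  constructor
  · rw [integrable_map_measure hgc.aestronglyMeasurable continuous_puncturedMk.aemeasurable, hcomp,
      ← hemb.integrable_map_iff, hemb.map_comap]
    exact hκi.restrict
  · rw [integral_map continuous_puncturedMk.aemeasurable hgc.aestronglyMeasurable]
    simp only [hgq]
    rw [integral_subtype_comap measurableSet_compl_lattice κ,
      Measure.restrict_eq_self_of_ae_mem (ae_notMem_lattice planeAreaMeasure_absolutelyContinuous),
      hκI]

end Borel

theorem hasTotalCurvature_data (hc : c ≠ 0) :
    HasTotalCurvature (dataF L c) (dataG L) (-8 * Real.pi) := by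
  let : MeasurableSpace (puncturedTorus L) := borel _
  have : BorelSpace (puncturedTorus L) := ⟨rfl⟩
  exact ⟨dataAreaMeasure L c, isAreaMeasure_data, integral_gaussCurvature_data hc⟩

end TotalCurvature

end ImproperAffine

/-! ### The main theorem -/

theorem theorem4p10 :
    ∃ α₀ : Set.Ioo (0 : ℝ) Real.pi,
      Real.pi / 3 < (α₀ : ℝ) ∧ (α₀ : ℝ) < Real.pi / 2 ∧
      ImproperAffine.P α₀ = 0 ∧
      ImproperAffine.HasGenus
        (ImproperAffine.ComplexTorus (ImproperAffine.periods (ImproperAffine.expI α₀))) 1 ∧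
      ∃ (F G : ImproperAffine.puncturedTorus
            (ImproperAffine.periods (ImproperAffine.expI α₀)) → ℂ)
        (ψ : ImproperAffine.puncturedTorus
            (ImproperAffine.periods (ImproperAffine.expI α₀)) → ℂ × ℝ),
        ImproperAffine.IsImproperAffineFront F G ψ ∧
        ImproperAffine.IsCompleteFront F G ∧
        ImproperAffine.HasTotalCurvature F G (-8 * Real.pi) := by
  obtain ⟨α₀, h1, h2, hP⟩ := ImproperAffine.exists_P_eq_zero
  obtain ⟨c, hc, hc1, hc2⟩ := ImproperAffine.exists_re_mul_eq_zero hP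
  have hc1' : (c * (2 * (ImproperAffine.periods (ImproperAffine.expI α₀)).g₂
      * ImproperAffine.eta₁ (ImproperAffine.expI α₀)
      - 3 * (ImproperAffine.periods (ImproperAffine.expI α₀)).g₃ * 1)).re = 0 := by
    rw [mul_one]
    exact hc1
  exact ⟨α₀, h1, h2, hP, ImproperAffine.hasGenus_torus _, _, _, _,
    ImproperAffine.isImproperAffineFront_data hc fun l hl z hz =>
      ImproperAffine.re_periodIntegral_add _ hc1' hc2 hl hz,
    ImproperAffine.isCompleteFront_data c, ImproperAffine.hasTotalCurvature_data hc⟩
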